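/- Let $(B_i,A_i)_{i\ge 0}$ be i.i.d. random vectors with values in $[0,\infty)^2$, distributed as $(B,A)$, with $\mathbb P(A=B)=0$. Put $S_0=0$, $S_n=\sum_{i<n}(B_i-A_i)$, $M_n=\max\{S_0,\dots,S_n\}$, and let $N$ be the first $n$ with $S_n<0$ ($N=\infty$ if there is none, and $z^\infty=0$ for $|z|<1$). Let $h(s_1,s_2)=\mathbb E e^{-s_1B-s_2A}$ for $\mathrm{Re}\,s_1,\mathrm{Re}\,s_2\ge 0$. Assume that for every $s_2$ with $\mathrm{Re}\,s_2\ge 0$ there are polynomials $h_1(\cdot,s_2)$ and $h_2(\cdot,s_2)\not\equiv 0$ with $h=h_1/h_2$, that is $h\,h_2=h_1$, for $\mathrm{Re}\,s_1\ge 0$; that $\xi\mapsto h_i(\xi,-\xi)$, $i=1,2$, are holomorphic in $\mathrm{Re}\,\xi<0$; and that $h_2(\xi,-\xi)$ has only finitely many zeros there. Let $\xi_1(0),\dots,\xi_n(0)$ be the zeros, with multiplicity, of $\xi\mapsto h_2(\xi,-\xi)$ in $\mathrm{Re}\,\xi<0$. Then for every $z$ with $|z|<1$ the function $\xi\mapsto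 h_2(\xi,-\xi)-z\,h_1(\xi,-\xi)$ has, with multiplicity, the same number $n$ of zeros $\xi_1(z,0),\dots,\xi_n(z,0)$ in $\mathrm{Re}\,\xi<0$, and for $\mathrm{Re}\,s>0$ $$(1-z)\sum_{k=0}^\infty z^k\,\mathbb E e^{-sM_k}=\frac{\prod_{j=1}^n(s-\xi_j(0))}{\prod_{j=1}^n(s-\xi_j(z,0))}\cdot\frac{\prod_{j=1}^n\xi_j(z,0)}{\prod_{j=1}^n\xi_j(0)},$$ where the series converges absolutely, and $$\mathbb E z^N=1-(1-z)\frac{\prod_{j=1}^n\xi_j(0)}{\prod_{j=1}^n\xi_j(z,0)}.$$ If moreover $\mathbb E B<\mathbb E A$ (where $\mathbb E A=\infty$ is allowed), then $\xi\mapsto h_2(\xi,-\xi)-h_1(\xi,-\xi)$ also has exactly $n$ zeros $\xi_1(1,0),\dots,\xi_n(1,0)$ in $\mathrm{Re}\,\xi<0$ with multiplicity, $M_k$ converges in distribution to a real-valued random variable $M$, and for $\mathrm{Re}\,s>0$ $$\lim_{r\uparrow 1}(1-r)\sum_{k=0}^\infty r^k\,\mathbb E e^{-sM_k}=\mathbb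 E e^{-sM}=\frac{\prod_{j=1}^n(s-\xi_j(0))}{\prod_{j=1}^n(s-\xi_j(1,0))}\cdot\frac{\prod_{j=1}^n\xi_j(1,0)}{\prod_{j=1}^n\xi_j(0)}.$$ -/

import Mathlib

open MeasureTheory ProbabilityTheory Filter Topology

noncomputable section

namespace CorrelatedWalk

variable {Ω : Type*}

/-- The random walk `S_n = ∑_{i < n} (B_i - A_i)`, started at `S_0 = 0`. -/
def walk (B A : ℕ → Ω → ℝ) (n : ℕ) (ω : Ω) : ℝ :=
  ∑ i ∈ Finset.range n, (B i ω - A i ω)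

/-- The running maximum `M_n = max {S_0, S_1, ..., S_n}`. -/
def runMax (B A : ℕ → Ω → ℝ) (n : ℕ) (ω : Ω) : ℝ :=
  (Finset.range (n + 1)).sup' Finset.nonempty_range_add_one (fun k => walk B A k ω)

/-- The first index `n` with `S_n < 0`; it is `⊤` if the walk never becomes negative. -/
def firstNeg (B A : ℕ → Ω → ℝ) (ω : Ω) : ℕ∞ :=
  sInf {k : ℕ∞ | ∃ n : ℕ, k = (n : ℕ∞) ∧ walk B A n ω < 0}

/-- `z ^ N` for an extended natural number `N`, with `z ^ ∞ = 0` (used for `|z| < 1`). -/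
def zpowExt (z : ℂ) (N : ℕ∞) : ℂ :=
  if N = ⊤ then 0 else z ^ N.toNat

/-- The joint Laplace-Stieltjes transform `h(s₁, s₂) = E exp (-s₁ B - s₂ A)`. -/
def jointLST [MeasurableSpace Ω] (P : Measure Ω) (B A : Ω → ℝ) (s₁ s₂ : ℂ) : ℂ :=
  ∫ ω, Complex.exp (-s₁ * (B ω : ℂ) - s₂ * (A ω : ℂ)) ∂P

/-- `ξ 0, ..., ξ (n - 1)` are the zeros with negative real part of the function `f`, holomorphic
in the left half-plane, each listed as often as its multiplicity. -/
def IsLeftZeroList (f : ℂ → ℂ) {n : ℕ} (ξ : Fin n → ℂ) : Prop :=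
  (∀ j, (ξ j).re < 0) ∧
    ∀ w : ℂ, w.re < 0 → AnalyticAt ℂ f w ∧
      analyticOrderAt f w = ((Finset.univ.filter (fun j => ξ j = w)).card : ℕ∞)

end CorrelatedWalk

end

noncomputable section

namespace CorrelatedWalk

/-! The engine is the Wiener–Hopf factorisation of the step law `μ` of `B - A`, whose transform is
`h(s, -s)`. Rationality at `s₂ = 0` forces an exponential moment of `B` (`exists_integrable_exp`),
so this transform lives in a strip `-δ < Re s ≤ 0`. For `|z| < 1` one has `1 - z h(s, -s) = f₋(s)
f₊(s)` on such a strip, possibly narrower. Here `f₋` is one minus the joint transform of the first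
strictly negative time and position, and `f₊` the same for the first return to `[0, ∞)`
(`wienerHopf_factorization`). Lindley's recursion gives the transform of the maximum as `f₊(0) /
f₊(s)` (`genFun_reflected_mul_exitFactor`), and `E z^N = 1 - f₋(0)`. The task is to identify `f₊`.

Write `h₂(w, -w) = q(w) g(w)` with `q` the monic polynomial of the left zeros and `g` zero-free, and
put `G = h₁(w, -w) / g(w)`. Then `q f₊` on the right and `(q - z G) / f₋` on the left agree on the
strip and define an entire function. If `G` grows at most polynomially, Liouville makes it a
polynomial `W` of degree at most `n = deg q`. Averaging along the imaginary axis shows that `W` is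
monic of degree `n`, because `μ` has no atom at `0` (`exists_ladder_polynomial`). The zeros of `q -
z G` in the left half-plane are then those of `W`, since `f₋` does not vanish there, and all zeros
of `W` lie there, since `q` and `f₊` do not vanish on the closed right half-plane.

The hard point is the growth of `G` (`exists_growth_bound`): the polynomials `h₁(·, s₂)` and `h₂(·,
s₂)` are given separately for each `s₂`, without a degree bound and possibly with common factors.
The Taylor coefficients of `h(·, s)` at `s₁ = 1` are holomorphic in `s` and bounded by `1`. Baire's
theorem applied to their Hankel determinants bounds the degree uniformly (`exists_hankel_rank`).
Cramer's rule yields reduced denominators normalised to `1` at `s₁ = 1`. The exponential moment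
keeps their roots to the left of `-δ`, so their coefficients are bounded and extend holomorphically
to all `s` (`exists_bounded_denominator`). On the antidiagonal such a denominator `D` has, near a
vertical line, a logarithm with bounded imaginary part. A Cauchy transform turns this into `D E = W`
with a nonzero polynomial `W` and `E` of polynomial growth (`factor_of_bounded_arg`). As `|W|` is
bounded below far out, division by `D` costs only polynomial growth.

For `z = 1`, negative drift makes the maximum converge almost surely. The polynomials `W` for `z =
r` converge as `r ↑ 1`, because their values converge on the closed right half-plane and they are
monic of fixed degree (`exists_transform_polynomial_one`). -/

/-! ### Parametric integrals, Liouville's theorem and gluing of half-planes. -/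

/-- Holomorphy of parametric integrals with a locally uniform integrable bound. -/
theorem differentiableOn_integral {α : Type*} [MeasurableSpace α] {μ : Measure α} {U : Set ℂ}
    (hU : IsOpen U) {f : ℂ → α → ℂ} (hmeas : ∀ s ∈ U, AEStronglyMeasurable (f s) μ)
    (hdiff : ∀ᵐ a ∂μ, DifferentiableOn ℂ (fun s => f s a) U)
    (hbound : ∀ s₀ ∈ U, ∃ r > 0, ∃ g : α → ℝ, Integrable g μ ∧
      ∀ᵐ a ∂μ, ∀ s ∈ Metric.ball s₀ r, s ∈ U → ‖f s a‖ ≤ g a) :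
    DifferentiableOn ℂ (fun s => ∫ a, f s a ∂μ) U := by
  intro s₀ hs₀
  obtain ⟨r₀, hr₀, g, hg, hfg⟩ := hbound s₀ hs₀
  obtain ⟨r₁, hr₁, hball⟩ := Metric.isOpen_iff.1 hU s₀ hs₀
  set r := min r₀ r₁ / 2 with hr_def
  have hr : 0 < r := by positivity
  have hr0 : 2 * r ≤ r₀ := by rw [hr_def]; linarith [min_le_left r₀ r₁]
  have hr1 : 2 * r ≤ r₁ := by rw [hr_def]; linarith [min_le_right r₀ r₁]
  have hsubU : ∀ s, dist s s₀ < 2 * r → s ∈ U := fun s hs =>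
    hball (Metric.mem_ball.2 (hs.trans_le hr1))
  have hder : ∀ᵐ a ∂μ, ∀ x ∈ Metric.ball s₀ (r / 2),
      HasDerivAt (fun s => f s a) (deriv (fun s => f s a) x) x := by
    filter_upwards [hdiff] with a ha x hx
    have hxU : x ∈ U := hsubU x (by have := Metric.mem_ball.1 hx; linarith)
    exact ((ha x hxU).differentiableAt (hU.mem_nhds hxU)).hasDerivAt
  have hmain := hasDerivAt_integral_of_dominated_loc_of_deriv_le (μ := μ) (𝕜 := ℂ)
    (F := f) (x₀ := s₀) (s := Metric.ball s₀ (r / 2))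
    (F' := fun s a => deriv (fun s => f s a) s) (bound := fun a => g a / (r / 2))
    (Metric.ball_mem_nhds s₀ (by positivity)) ?_ ?_ ?_ ?_ ?_ hder
  · exact hmain.2.differentiableAt.differentiableWithinAt
  · filter_upwards [hU.mem_nhds hs₀] with s hs using hmeas s hs
  · refine hg.mono' (hmeas s₀ hs₀) ?_
    filter_upwards [hfg] with a ha
    exact ha s₀ (Metric.mem_ball_self hr₀) hs₀
  -- The derivative in the parameter is measurable as an almost everywhere limit of difference
  -- quotients along a fixed null sequence.
  · have hseq : Tendsto (fun n : ℕ => ((r / (n + 2) : ℝ) : ℂ)) atTop (𝓝[≠] 0) := by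
      rw [tendsto_nhdsWithin_iff]
      constructor
      · rw [show (0 : ℂ) = ((0 : ℝ) : ℂ) by simp]
        refine (Complex.continuous_ofReal.tendsto 0).comp ?_
        refine Tendsto.div_atTop tendsto_const_nhds ?_
        exact tendsto_atTop_add_const_right _ _ tendsto_natCast_atTop_atTop
      · refine Eventually.of_forall fun n => ?_
        simp only [Set.mem_compl_iff, Set.mem_singleton_iff, Complex.ofReal_eq_zero]
        positivity
    refine aestronglyMeasurable_of_tendsto_ae atTop
      (f := fun (n : ℕ) a => ((r / (n + 2) : ℝ) : ℂ)⁻¹ •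
        (f (s₀ + ((r / (n + 2) : ℝ) : ℂ)) a - f s₀ a)) ?_ ?_
    · intro n
      have hsub : s₀ + ((r / (n + 2) : ℝ) : ℂ) ∈ U := by
        refine hsubU _ ?_
        rw [dist_eq_norm, add_sub_cancel_left, Complex.norm_real, Real.norm_eq_abs,
          abs_of_pos (by positivity)]
        have : r / (n + 2) ≤ r / 1 := by
          gcongr
          linarith [(Nat.cast_nonneg n : (0 : ℝ) ≤ n)]
        linarith
      exact ((hmeas _ hsub).sub (hmeas _ hs₀)).const_smul (((r / (n + 2) : ℝ) : ℂ)⁻¹)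
    · filter_upwards [hder] with a ha
      have := (hasDerivAt_iff_tendsto_slope_zero.1
        (ha s₀ (Metric.mem_ball_self (by positivity)))).comp hseq
      exact this
  · filter_upwards [hfg, hdiff] with a ha hd x hx
    have hx' := Metric.mem_ball.1 hx
    -- Cauchy's estimate on a circle of radius `r / 2` turns the bound on `f` into one on its
    -- derivative.
    refine Complex.norm_deriv_le_of_forall_mem_sphere_norm_le (by positivity) ?_ ?_
    · refine (hd.mono ?_).diffContOnCl
      intro y hy
      rw [closure_ball x (by positivity)] at hy
      refine hsubU y ?_
      have := Metric.mem_closedBall.1 hy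
      linarith [dist_triangle y x s₀]
    · intro y hy
      have hy' := Metric.mem_sphere.1 hy
      have h2 : dist y s₀ < 2 * r := by linarith [dist_triangle y x s₀]
      exact ha y (Metric.mem_ball.2 (by linarith)) (hsubU y h2)
  · exact hg.div_const _

/-- An entire function of polynomial growth is a polynomial. -/
theorem exists_polynomial_of_growth {f : ℂ → ℂ} (hf : Differentiable ℂ f) {C : ℝ} {m : ℕ}
    (hb : ∀ s, ‖f s‖ ≤ C * (1 + ‖s‖) ^ m) :
    ∃ p : Polynomial ℂ, ∀ s, f s = p.eval s := by
  have hC : 0 ≤ C := by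
    have := (norm_nonneg _).trans (hb 0)
    simpa using this
  have hzero : ∀ k, m < k → iteratedDeriv k f 0 = 0 := by
    intro k hk
    have hle : ∀ R : ℝ, 1 ≤ R → ‖iteratedDeriv k f 0‖ ≤ (k.factorial * C * 2 ^ m) / R := by
      intro R hR
      have hR0 : 0 < R := by linarith
      have h1 := Complex.norm_iteratedDeriv_le_of_forall_mem_sphere_norm_le (c := 0) (n := k)
        (f := f) (C := C * (1 + R) ^ m) hR0 hf.diffContOnCl (by
          intro z hz
          have : ‖z‖ = R := by simpa using hz
          simpa [this] using hb z)
      refine h1.trans ?_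
      rw [div_le_div_iff₀ (by positivity) hR0]
      have h2 : (1 + R) ^ m ≤ (2 * R) ^ m := by gcongr; linarith
      have h3 : R ^ (m + 1) ≤ R ^ k := pow_le_pow_right₀ hR hk
      calc k.factorial * (C * (1 + R) ^ m) * R
          ≤ k.factorial * (C * (2 * R) ^ m) * R := by gcongr
        _ = k.factorial * C * 2 ^ m * R ^ (m + 1) := by rw [mul_pow]; ring
        _ ≤ k.factorial * C * 2 ^ m * R ^ k := by gcongr
    have hlim : Tendsto (fun R : ℝ => (k.factorial * C * 2 ^ m) / R) atTop (𝓝 0) :=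
      tendsto_const_nhds.div_atTop tendsto_id
    have : ‖iteratedDeriv k f 0‖ ≤ 0 := by
      refine ge_of_tendsto hlim ?_
      filter_upwards [eventually_ge_atTop 1] with R hR using hle R hR
    simpa using this
  refine ⟨∑ k ∈ Finset.range (m + 1),
    Polynomial.C ((k.factorial : ℂ)⁻¹ * iteratedDeriv k f 0) * Polynomial.X ^ k, fun s => ?_⟩
  have h := (Complex.taylorSeries_eq_of_entire' 0 s hf)
  rw [← h, tsum_eq_sum (s := Finset.range (m + 1))]
  · simp [Polynomial.eval_finsetSum]
  · intro k hk
    rw [hzero k (by simpa using hk)]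
    simp

/-- Functions holomorphic on overlapping half-planes and equal on the overlap glue to an
entire function. -/
theorem exists_entire_of_eqOn_strip {f₁ f₂ : ℂ → ℂ} {α β : ℝ} (hαβ : α < β)
    (h₁ : DifferentiableOn ℂ f₁ {s | α < s.re}) (h₂ : DifferentiableOn ℂ f₂ {s | s.re < β})
    (heq : ∀ s : ℂ, α < s.re → s.re < β → f₁ s = f₂ s) :
    ∃ f : ℂ → ℂ, Differentiable ℂ f ∧ (∀ s : ℂ, α < s.re → f s = f₁ s) ∧
      (∀ s : ℂ, s.re < β → f s = f₂ s) := by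
  have ho₁ : IsOpen {s : ℂ | α < s.re} := isOpen_lt continuous_const Complex.continuous_re
  have ho₂ : IsOpen {s : ℂ | s.re < β} := isOpen_lt Complex.continuous_re continuous_const
  let f : ℂ → ℂ := fun s => if α < s.re then f₁ s else f₂ s
  have hf1 : ∀ s : ℂ, α < s.re → f s = f₁ s := fun s hs => if_pos hs
  have hf2 : ∀ s : ℂ, s.re < β → f s = f₂ s := by
    intro s hs
    by_cases h : α < s.re
    · rw [hf1 s h, heq s h hs]
    · exact if_neg h
  refine ⟨f, fun s => ?_, hf1, hf2⟩
  by_cases h : α < s.re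
  · refine (h₁.differentiableAt (ho₁.mem_nhds h)).congr_of_eventuallyEq ?_
    filter_upwards [ho₁.mem_nhds h] with t ht using hf1 t ht
  · have h' : s.re < β := (not_lt.1 h).trans_lt hαβ
    refine (h₂.differentiableAt (ho₂.mem_nhds h')).congr_of_eventuallyEq ?_
    filter_upwards [ho₂.mem_nhds h'] with t ht using hf2 t ht

theorem exists_const_of_bounded_strip {f₁ f₂ : ℂ → ℂ} {α β C : ℝ} (hαβ : α < β)
    (h₁ : DifferentiableOn ℂ f₁ {s | α < s.re}) (h₂ : DifferentiableOn ℂ f₂ {s | s.re < β})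
    (heq : ∀ s : ℂ, α < s.re → s.re < β → f₁ s = f₂ s)
    (hb₁ : ∀ s : ℂ, α < s.re → ‖f₁ s‖ ≤ C) (hb₂ : ∀ s : ℂ, s.re < β → ‖f₂ s‖ ≤ C) :
    ∃ c : ℂ, (∀ s : ℂ, α < s.re → f₁ s = c) ∧ (∀ s : ℂ, s.re < β → f₂ s = c) := by
  obtain ⟨f, hf, hf1, hf2⟩ := exists_entire_of_eqOn_strip hαβ h₁ h₂ heq
  have hbd : Bornology.IsBounded (Set.range f) := by
    rw [isBounded_iff_forall_norm_le]
    refine ⟨C, ?_⟩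
    rintro _ ⟨s, rfl⟩
    by_cases h : α < s.re
    · rw [hf1 s h]; exact hb₁ s h
    · have h' : s.re < β := (not_lt.1 h).trans_lt hαβ
      rw [hf2 s h']; exact hb₂ s h'
  refine ⟨f 0, fun s hs => ?_, fun s hs => ?_⟩
  · rw [← hf1 s hs]; exact hf.apply_eq_apply_of_bounded hbd s 0
  · rw [← hf2 s hs]; exact hf.apply_eq_apply_of_bounded hbd s 0

/-- The growth bounds are needed only on the two sides of one line `Re = γ`. Neither function has to
be controlled up to the edge of its own half-plane. -/
theorem exists_polynomial_of_growth_strip {f₁ f₂ : ℂ → ℂ} {α β C : ℝ} {m : ℕ} (hαβ : α < β)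
    (h₁ : DifferentiableOn ℂ f₁ {s | α < s.re}) (h₂ : DifferentiableOn ℂ f₂ {s | s.re < β})
    (heq : ∀ s : ℂ, α < s.re → s.re < β → f₁ s = f₂ s) {γ : ℝ} (hγ₁ : α ≤ γ) (hγ₂ : γ < β)
    (hb₁ : ∀ s : ℂ, γ < s.re → ‖f₁ s‖ ≤ C * (1 + ‖s‖) ^ m)
    (hb₂ : ∀ s : ℂ, s.re ≤ γ → ‖f₂ s‖ ≤ C * (1 + ‖s‖) ^ m) :
    ∃ p : Polynomial ℂ, (∀ s : ℂ, α < s.re → f₁ s = p.eval s) ∧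
      (∀ s : ℂ, s.re < β → f₂ s = p.eval s) := by
  obtain ⟨f, hf, hf1, hf2⟩ := exists_entire_of_eqOn_strip hαβ h₁ h₂ heq
  obtain ⟨p, hp⟩ := exists_polynomial_of_growth hf (C := C) (m := m) (by
    intro s
    by_cases h : γ < s.re
    · rw [hf1 s (hγ₁.trans_lt h)]; exact hb₁ s h
    · have h' : s.re ≤ γ := not_lt.1 h
      rw [hf2 s (h'.trans_lt hγ₂)]; exact hb₂ s h')
  exact ⟨p, fun s hs => by rw [← hf1 s hs, hp], fun s hs => by rw [← hf2 s hs, hp]⟩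

/-! ### Cauchy integrals along vertical lines. -/

/-- Line integrals of a decaying holomorphic function over the two edges of a strip agree. -/
theorem integral_vertical_eq {g : ℂ → ℂ} {c₁ c₂ K T₀ : ℝ} (hc : c₁ ≤ c₂)
    (hg : DifferentiableOn ℂ g {z | c₁ ≤ z.re ∧ z.re ≤ c₂})
    (hi₁ : Integrable (fun t : ℝ => g (c₁ + t * Complex.I)))
    (hi₂ : Integrable (fun t : ℝ => g (c₂ + t * Complex.I)))
    (hdecay : ∀ z : ℂ, c₁ ≤ z.re → z.re ≤ c₂ → T₀ ≤ |z.im| → ‖g z‖ ≤ K / |z.im|) :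
    ∫ t : ℝ, g (c₁ + t * Complex.I) = ∫ t : ℝ, g (c₂ + t * Complex.I) := by
  have hrect : ∀ T : ℝ, 0 < T →
      (∫ t in (-T)..T, g (c₂ + t * Complex.I)) - (∫ t in (-T)..T, g (c₁ + t * Complex.I)) =
      Complex.I * ((∫ x in c₁..c₂, g (x + (-T : ℝ) * Complex.I)) -
        ∫ x in c₁..c₂, g (x + (T : ℝ) * Complex.I)) := by
    intro T hT
    have h := Complex.integral_boundary_rect_eq_zero_of_differentiableOn g
      (c₁ + (-T : ℝ) * Complex.I) (c₂ + (T : ℝ) * Complex.I) (by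
        refine hg.mono fun z hz => ?_
        rw [Complex.mem_reProdIm] at hz
        have := hz.1
        simpa [Set.uIcc_of_le hc] using this)
    simp only [Complex.add_re, Complex.ofReal_re, Complex.mul_re, Complex.I_re, mul_zero,
      Complex.ofReal_im, Complex.I_im, mul_one, sub_self, add_zero, Complex.add_im,
      Complex.mul_im, zero_add, smul_eq_mul] at h
    have h2 := congrArg (fun w => Complex.I * w) h
    simp only [mul_zero] at h2
    linear_combination (norm := (ring_nf; simp only [Complex.I_sq]; ring_nf)) (-1 : ℂ) * h2
  have hl : ∀ c : ℝ, Integrable (fun t : ℝ => g (c + t * Complex.I)) →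
      Tendsto (fun T : ℝ => ∫ t in (-T)..T, g (c + t * Complex.I)) atTop
        (𝓝 (∫ t : ℝ, g (c + t * Complex.I))) := fun c hi =>
    intervalIntegral_tendsto_integral hi tendsto_neg_atTop_atBot tendsto_id
  have hz : Tendsto (fun T : ℝ => (∫ t in (-T)..T, g (c₂ + t * Complex.I)) -
      (∫ t in (-T)..T, g (c₁ + t * Complex.I))) atTop (𝓝 0) := by
    have hb : Tendsto (fun T : ℝ => 2 * (K / T * |c₂ - c₁|)) atTop (𝓝 0) := by
      have : Tendsto (fun T : ℝ => K / T) atTop (𝓝 0) := tendsto_const_nhds.div_atTop tendsto_id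
      simpa using (this.mul_const |c₂ - c₁|).const_mul 2
    refine squeeze_zero_norm' ?_ hb
    filter_upwards [eventually_gt_atTop 0, eventually_ge_atTop T₀] with T hT hT0
    rw [hrect T hT, norm_mul, Complex.norm_I, one_mul, two_mul]
    refine (norm_sub_le _ _).trans (add_le_add ?_ ?_)
    · refine intervalIntegral.norm_integral_le_of_norm_le_const fun x hx => ?_
      rw [Set.uIoc_of_le hc] at hx
      have := hdecay (x + (-T : ℝ) * Complex.I) (by simpa using hx.1.le) (by simpa using hx.2)
        (by simpa [abs_of_pos hT] using hT0)
      simpa [abs_of_pos hT] using this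
    · refine intervalIntegral.norm_integral_le_of_norm_le_const fun x hx => ?_
      rw [Set.uIoc_of_le hc] at hx
      have := hdecay (x + (T : ℝ) * Complex.I) (by simpa using hx.1.le) (by simpa using hx.2)
        (by simpa [abs_of_pos hT] using hT0)
      simpa [abs_of_pos hT] using this
  have := tendsto_nhds_unique hz ((hl c₂ hi₂).sub (hl c₁ hi₁))
  exact (sub_eq_zero.1 this.symm).symm

theorem integral_div_sq_add_sq {α : ℝ} (hα : α ≠ 0) :
    Integrable (fun t : ℝ => α / (α ^ 2 + t ^ 2)) ∧
      ∫ t : ℝ, α / (α ^ 2 + t ^ 2) = Real.pi * SignType.sign α := by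
  have hfun : (fun t : ℝ => α / (α ^ 2 + t ^ 2)) = fun t : ℝ => α⁻¹ * (1 + (t / α) ^ 2)⁻¹ := by
    funext t
    have : α ^ 2 + t ^ 2 ≠ 0 := by positivity
    field_simp
  rw [hfun]
  constructor
  · exact (integrable_inv_one_add_sq.comp_div hα).const_mul _
  · rw [integral_const_mul, Measure.integral_comp_div (fun t => (1 + t ^ 2)⁻¹) α,
      integral_univ_inv_one_add_sq, smul_eq_mul]
    rcases lt_or_gt_of_ne hα with h | h
    · rw [abs_of_neg h, sign_neg h]; simp; field_simp
    · rw [abs_of_pos h, sign_pos h]; simp; field_simp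

/-- A single Cauchy kernel is not integrable, but a difference of two decays quadratically. Its real
part is a difference of Poisson kernels, each contributing `π` times a sign, and its imaginary part
is odd. -/
theorem integral_cauchy_sub {α β : ℝ} (hα : α ≠ 0) (hβ : β ≠ 0) :
    ∫ t : ℝ, (((α : ℂ) + t * Complex.I)⁻¹ - ((β : ℂ) + t * Complex.I)⁻¹) =
      Real.pi * ((SignType.sign α : ℝ) - (SignType.sign β : ℝ)) := by
  have hinv : ∀ γ : ℝ, γ ≠ 0 → ∀ t : ℝ, ((γ : ℂ) + t * Complex.I)⁻¹ =
      ((γ / (γ ^ 2 + t ^ 2) : ℝ) : ℂ) - ((t / (γ ^ 2 + t ^ 2) : ℝ) : ℂ) * Complex.I := by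
    intro γ hγ t
    have h1 : γ ^ 2 + t ^ 2 ≠ 0 := by positivity
    have h2 : ((γ : ℂ) + t * Complex.I) * ((γ : ℂ) - t * Complex.I) = γ ^ 2 + t ^ 2 := by
      ring_nf; simp only [Complex.I_sq]; ring
    have h3 : ((γ : ℂ) ^ 2 + (t : ℂ) ^ 2) ≠ 0 := by exact_mod_cast h1
    have h4 : (γ : ℂ) + t * Complex.I ≠ 0 := by
      intro h; rw [h, zero_mul] at h2; exact h3 h2.symm
    push_cast
    rw [inv_eq_iff_eq_inv, eq_comm, inv_eq_of_mul_eq_one_left]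
    field_simp
    linear_combination h2
  have hodd : ∫ t : ℝ, (t / (α ^ 2 + t ^ 2) - t / (β ^ 2 + t ^ 2)) = 0 := by
    have h := integral_neg_eq_self (fun t : ℝ => t / (α ^ 2 + t ^ 2) - t / (β ^ 2 + t ^ 2)) volume
    have h2 : (fun t : ℝ => (-t) / (α ^ 2 + (-t) ^ 2) - (-t) / (β ^ 2 + (-t) ^ 2)) =
        fun t : ℝ => -(t / (α ^ 2 + t ^ 2) - t / (β ^ 2 + t ^ 2)) := by
      funext t; rw [neg_sq]; ring
    rw [h2, integral_neg] at h
    linarith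
  have hoddi : Integrable (fun t : ℝ => t / (α ^ 2 + t ^ 2) - t / (β ^ 2 + t ^ 2)) := by
    have hα2 := (integral_div_sq_add_sq hα).1.const_mul (|β ^ 2 - α ^ 2| / (|α| * |β|))
    refine Integrable.mono' (hα2.abs) ?_ (Eventually.of_forall fun t => ?_)
    · refine Continuous.aestronglyMeasurable ?_
      refine Continuous.sub ?_ ?_
      · exact continuous_id.div (by fun_prop) fun t => by positivity
      · exact continuous_id.div (by fun_prop) fun t => by positivity
    · have h1 : 0 < α ^ 2 + t ^ 2 := by positivity
      have h2 : 0 < β ^ 2 + t ^ 2 := by positivity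
      have he : t / (α ^ 2 + t ^ 2) - t / (β ^ 2 + t ^ 2) =
          (β ^ 2 - α ^ 2) / (α ^ 2 + t ^ 2) * (t / (β ^ 2 + t ^ 2)) := by field_simp; ring
      have h3 : |t| / (β ^ 2 + t ^ 2) ≤ 1 / |β| := by
        rw [div_le_div_iff₀ h2 (by positivity)]
        nlinarith [sq_nonneg (|t| - |β|), sq_abs t, sq_abs β]
      rw [Real.norm_eq_abs, he, abs_mul, abs_div, abs_div, abs_of_pos h1, abs_of_pos h2, abs_mul,
        abs_div, abs_div, abs_of_pos h1, abs_mul, abs_abs, abs_abs, abs_abs]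
      calc |β ^ 2 - α ^ 2| / (α ^ 2 + t ^ 2) * (|t| / (β ^ 2 + t ^ 2))
          ≤ |β ^ 2 - α ^ 2| / (α ^ 2 + t ^ 2) * (1 / |β|) := by gcongr
        _ = _ := by
          have : |α| ≠ 0 := by positivity
          field_simp
  have hfun : (fun t : ℝ => (((α : ℂ) + t * Complex.I)⁻¹ - ((β : ℂ) + t * Complex.I)⁻¹)) =
      fun t : ℝ => ((α / (α ^ 2 + t ^ 2) - β / (β ^ 2 + t ^ 2) : ℝ) : ℂ) -
        ((t / (α ^ 2 + t ^ 2) - t / (β ^ 2 + t ^ 2) : ℝ) : ℂ) * Complex.I := by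
    funext t
    rw [hinv α hα, hinv β hβ]
    push_cast
    ring
  rw [hfun, integral_sub, integral_mul_const, integral_complex_ofReal, integral_complex_ofReal, hodd,
    integral_sub (integral_div_sq_add_sq hα).1 (integral_div_sq_add_sq hβ).1,
    (integral_div_sq_add_sq hα).2, (integral_div_sq_add_sq hβ).2]
  · push_cast; ring
  · exact ((integral_div_sq_add_sq hα).1.sub (integral_div_sq_add_sq hβ).1).ofReal
  · exact hoddi.ofReal.mul_const _

/-- The Cauchy kernel with pole `s` on the line `Re = c`, regularised at the point `b`. -/
def cauchyKer (c b : ℝ) (s : ℂ) (t : ℝ) : ℂ :=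
  ((c : ℂ) + t * Complex.I - s)⁻¹ - ((c : ℂ) + t * Complex.I - b)⁻¹

theorem line_sub_sq (c : ℝ) (s : ℂ) (t : ℝ) :
    ‖(c : ℂ) + t * Complex.I - s‖ ^ 2 = (c - s.re) ^ 2 + (t - s.im) ^ 2 := by
  rw [← Complex.normSq_eq_norm_sq, Complex.normSq_apply]
  simp
  ring

theorem line_sub_ne {c : ℝ} {s : ℂ} (h : c ≠ s.re) (t : ℝ) :
    (c : ℂ) + t * Complex.I - s ≠ 0 := by
  intro h0
  have := congrArg Complex.re h0
  simp at this
  exact h (by linarith)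

theorem norm_cauchyKer {c b : ℝ} {s : ℂ} (hs : c ≠ s.re) (hb : c ≠ b) (t : ℝ) :
    ‖cauchyKer c b s t‖ =
      ‖s - b‖ / (‖(c : ℂ) + t * Complex.I - s‖ * ‖(c : ℂ) + t * Complex.I - b‖) := by
  have h1 := line_sub_ne hs t
  have h2 := line_sub_ne (s := (b : ℂ)) (by simpa using hb) t
  rw [cauchyKer, ← norm_mul, ← norm_div]
  congr 1
  field_simp
  ring

theorem one_add_sq_le_line {c a R : ℝ} (ha : 0 < a) {s : ℂ} (hs : a ≤ |c - s.re|) (hR : ‖s‖ ≤ R)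
    (t : ℝ) :
    1 + t ^ 2 ≤ ((1 + 2 * R ^ 2) / a ^ 2 + 2) * ‖(c : ℂ) + t * Complex.I - s‖ ^ 2 := by
  rw [line_sub_sq]
  have hy : s.im ^ 2 ≤ R ^ 2 := by
    rw [← sq_abs]
    exact pow_le_pow_left₀ (abs_nonneg _) ((Complex.abs_im_le_norm s).trans hR) 2
  have ha2 : a ^ 2 ≤ (c - s.re) ^ 2 := by
    rw [← sq_abs (c - s.re)]
    exact pow_le_pow_left₀ ha.le hs 2
  have h1 : 1 + 2 * R ^ 2 ≤ (1 + 2 * R ^ 2) / a ^ 2 * (c - s.re) ^ 2 := by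
    rw [div_mul_eq_mul_div, le_div_iff₀ (by positivity)]
    exact mul_le_mul_of_nonneg_left ha2 (by positivity)
  have h2 : 0 ≤ (1 + 2 * R ^ 2) / a ^ 2 * (t - s.im) ^ 2 := by positivity
  nlinarith [sq_nonneg (t - 2 * s.im), sq_nonneg (c - s.re)]

/-- Local quadratic decay of the Cauchy kernel. -/
theorem norm_cauchyKer_le {c b a R : ℝ} (ha : 0 < a) {s : ℂ} (hs : a ≤ |c - s.re|)
    (hb : a ≤ |c - b|) (hR : ‖s‖ ≤ R) (hbR : |b| ≤ R) (t : ℝ) :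
    ‖cauchyKer c b s t‖ ≤ (2 * R * ((1 + 2 * R ^ 2) / a ^ 2 + 2)) * (1 + t ^ 2)⁻¹ := by
  have hs' : c ≠ s.re := by
    rintro h; rw [h] at hs; simp at hs; linarith
  have hb' : c ≠ b := by
    rintro h; rw [h] at hb; simp at hb; linarith
  rw [norm_cauchyKer hs' hb']
  have h1 := one_add_sq_le_line ha hs hR t
  have h2 := one_add_sq_le_line (s := (b : ℂ)) (c := c) ha (by simpa using hb)
    (by simpa using hbR) t
  have hA : 0 < ‖(c : ℂ) + t * Complex.I - s‖ := norm_pos_iff.2 (line_sub_ne hs' t)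
  have hB : 0 < ‖(c : ℂ) + t * Complex.I - b‖ :=
    norm_pos_iff.2 (line_sub_ne (s := (b : ℂ)) (by simpa using hb') t)
  set A := ‖(c : ℂ) + t * Complex.I - s‖
  set B := ‖(c : ℂ) + t * Complex.I - b‖
  set M := (1 + 2 * R ^ 2) / a ^ 2 + 2 with hM
  have hMpos : 0 < M := by positivity
  have hAB : 1 + t ^ 2 ≤ M * (A * B) := by
    have : (1 + t ^ 2) ^ 2 ≤ (M * (A * B)) ^ 2 := by
      calc (1 + t ^ 2) ^ 2 = (1 + t ^ 2) * (1 + t ^ 2) := by ring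
        _ ≤ (M * A ^ 2) * (M * B ^ 2) := by gcongr
        _ = _ := by ring
    exact le_of_sq_le_sq this (by positivity)
  have hsb : ‖s - b‖ ≤ 2 * R := by
    refine (norm_sub_le _ _).trans ?_
    have : ‖(b : ℂ)‖ ≤ R := by simpa using hbR
    linarith
  have hR0 : 0 ≤ R := (norm_nonneg _).trans hR
  rw [← div_eq_mul_inv, div_le_div_iff₀ (by positivity) (by positivity)]
  calc ‖s - b‖ * (1 + t ^ 2) ≤ (2 * R) * (M * (A * B)) := by gcongr
    _ = _ := by ring

theorem continuous_cauchyKer {c b : ℝ} {s : ℂ} (hs : c ≠ s.re) (hb : c ≠ b) :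
    Continuous (cauchyKer c b s) := by
  unfold cauchyKer
  refine Continuous.sub ?_ ?_
  · exact Continuous.inv₀ (by fun_prop) fun t => line_sub_ne hs t
  · exact Continuous.inv₀ (by fun_prop) fun t =>
      line_sub_ne (s := (b : ℂ)) (by simpa using hb) t

theorem integrable_cauchyKer {c b : ℝ} {s : ℂ} (hs : c ≠ s.re) (hb : c ≠ b) :
    Integrable (cauchyKer c b s) := by
  have h := fun t => norm_cauchyKer_le (c := c) (b := b) (a := min |c - s.re| |c - b|)
    (R := max ‖s‖ |b|) (s := s)
    (lt_min (abs_pos.2 (sub_ne_zero.2 hs)) (abs_pos.2 (sub_ne_zero.2 hb)))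
    (min_le_left _ _) (min_le_right _ _) (le_max_left _ _) (le_max_right _ _) t
  exact Integrable.mono' (integrable_inv_one_add_sq.const_mul _)
    (continuous_cauchyKer hs hb).aestronglyMeasurable (Eventually.of_forall h)

/-- This is the residue at `s`. The regularising pole `b` lies to the right of both lines and
contributes nothing. -/
theorem integral_cauchyKer_sub {c₁ c₂ b : ℝ} {s : ℂ} (h₁ : c₁ < s.re) (h₂ : s.re < c₂)
    (hb : c₂ < b) :
    (∫ t, cauchyKer c₂ b s t) - ∫ t, cauchyKer c₁ b s t = 2 * Real.pi := by
  have hα : c₂ - s.re ≠ 0 := by linarith [sub_pos.2 h₂] |> fun h : 0 < c₂ - s.re => h.ne'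
  have hβ : c₁ - s.re ≠ 0 := (sub_neg.2 h₁).ne
  have hα' : c₂ - b ≠ 0 := (sub_neg.2 hb).ne
  have hβ' : c₁ - b ≠ 0 := (sub_neg.2 (by linarith)).ne
  have hi₂ := integrable_cauchyKer (c := c₂) (b := b) (s := s) h₂.ne' hb.ne
  have hi₁ := integrable_cauchyKer (c := c₁) (b := b) (s := s) h₁.ne (by linarith)
  have hA := integral_cauchy_sub hα hβ
  have hB := integral_cauchy_sub hα' hβ'
  have hAi : Integrable (fun t : ℝ => (((c₂ - s.re : ℝ) : ℂ) + t * Complex.I)⁻¹ -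
      (((c₁ - s.re : ℝ) : ℂ) + t * Complex.I)⁻¹) := by
    by_contra hcon
    rw [integral_undef hcon, sign_pos (sub_pos.2 h₂), sign_neg (sub_neg.2 h₁)] at hA
    have : (Real.pi : ℂ) * 2 = 0 := by rw [hA]; norm_num
    exact Real.pi_ne_zero (by exact_mod_cast (mul_eq_zero.1 this).resolve_right two_ne_zero)
  rw [← integral_sub hi₂ hi₁]
  have hfun : (fun t => cauchyKer c₂ b s t - cauchyKer c₁ b s t) = fun t : ℝ =>
      ((((c₂ - s.re : ℝ) : ℂ) + (t - s.im : ℝ) * Complex.I)⁻¹ -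
        (((c₁ - s.re : ℝ) : ℂ) + (t - s.im : ℝ) * Complex.I)⁻¹) -
      ((((c₂ - b : ℝ) : ℂ) + t * Complex.I)⁻¹ - (((c₁ - b : ℝ) : ℂ) + t * Complex.I)⁻¹) := by
    funext t
    have h : ∀ c : ℝ, ((c - s.re : ℝ) : ℂ) + (t - s.im : ℝ) * Complex.I =
        (c : ℂ) + t * Complex.I - s := by
      intro c
      apply Complex.ext <;> simp
    have h' : ∀ c : ℝ, ((c - b : ℝ) : ℂ) + t * Complex.I = (c : ℂ) + t * Complex.I - b := by
      intro c; push_cast; ring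
    rw [h, h, h', h', cauchyKer, cauchyKer]
    ring
  rw [hfun]
  have hAi' := hAi.comp_sub_right s.im
  have hBi : Integrable (fun t : ℝ => (((c₂ - b : ℝ) : ℂ) + t * Complex.I)⁻¹ -
      (((c₁ - b : ℝ) : ℂ) + t * Complex.I)⁻¹) := by
    have := hAi'.sub (hi₂.sub hi₁)
    refine this.congr (Eventually.of_forall fun t => ?_)
    have := congrFun hfun t
    simp only [Pi.sub_apply] at this ⊢
    rw [this]; ring
  rw [integral_sub hAi' hBi, hB,
    integral_sub_right_eq_self (fun t : ℝ => (((c₂ - s.re : ℝ) : ℂ) + t * Complex.I)⁻¹ -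
      (((c₁ - s.re : ℝ) : ℂ) + t * Complex.I)⁻¹) s.im, hA,
    sign_pos (sub_pos.2 h₂), sign_neg (sub_neg.2 h₁), sign_neg (sub_neg.2 hb),
    sign_neg (sub_neg.2 (by linarith : c₁ < b))]
  simp only [SignType.coe_one, SignType.coe_neg]
  push_cast
  ring

/-- Cauchy's formula for bounded holomorphic functions in a strip. -/
theorem cauchy_strip {ψ : ℂ → ℂ} {α β c₁ c₂ b C : ℝ}
    (hψ : DifferentiableOn ℂ ψ {z | α < z.re ∧ z.re < β})
    (hC : ∀ z : ℂ, α < z.re → z.re < β → ‖ψ z‖ ≤ C) {s : ℂ}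
    (hα : α < c₁) (h₁ : c₁ < s.re) (h₂ : s.re < c₂) (hβ : c₂ < β) (hb : c₂ < b) :
    (∫ t : ℝ, ψ (c₂ + t * Complex.I) * cauchyKer c₂ b s t) -
      ∫ t : ℝ, ψ (c₁ + t * Complex.I) * cauchyKer c₁ b s t = 2 * Real.pi * ψ s := by
  have hopen : IsOpen {z : ℂ | α < z.re ∧ z.re < β} :=
    (isOpen_lt continuous_const Complex.continuous_re).inter
      (isOpen_lt Complex.continuous_re continuous_const)
  have hs : s ∈ {z : ℂ | α < z.re ∧ z.re < β} := ⟨by linarith, by linarith⟩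
  have hC0 : 0 ≤ C := (norm_nonneg _).trans (hC s hs.1 hs.2)
  -- Away from `s` this is `ψ z - ψ s` times the regularised kernel. Subtracting `ψ s` removes the
  -- pole, so the line integrals over both edges agree, and the constant `ψ s` brings in the residue
  -- computed before.
  let g : ℂ → ℂ := fun z => dslope ψ s z - (ψ z - ψ s) * (z - b)⁻¹
  have hg : DifferentiableOn ℂ g {z | c₁ ≤ z.re ∧ z.re ≤ c₂} := by
    have hsub : {z : ℂ | c₁ ≤ z.re ∧ z.re ≤ c₂} ⊆ {z : ℂ | α < z.re ∧ z.re < β} := fun z hz =>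
      ⟨hα.trans_le hz.1, hz.2.trans_lt hβ⟩
    have h1 := ((Complex.differentiableOn_dslope (hopen.mem_nhds hs)).2 hψ).mono hsub
    refine h1.sub (((hψ.mono hsub).sub_const _).mul ?_)
    refine DifferentiableOn.inv (by fun_prop) fun z hz h0 => ?_
    have := congrArg Complex.re h0
    simp at this
    have := hz.2
    linarith
  have hker : ∀ z : ℂ, z ≠ s → g z = (ψ z - ψ s) * ((z - s)⁻¹ - (z - b)⁻¹) := by
    intro z hz
    simp only [g, dslope_of_ne ψ hz, slope_def_field, div_eq_mul_inv]
    ring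
  have hgline : ∀ c : ℝ, c ≠ s.re → ∀ t : ℝ, g (c + t * Complex.I) =
      (ψ (c + t * Complex.I) - ψ s) * cauchyKer c b s t := by
    intro c hc t
    exact hker _ (sub_ne_zero.1 (line_sub_ne hc t))
  have hint : ∀ c : ℝ, α < c → c < β → c ≠ s.re → c < b →
      Integrable (fun t : ℝ => ψ (c + t * Complex.I) * cauchyKer c b s t) := by
    intro c h1 h2 h3 h4
    refine (integrable_cauchyKer h3 h4.ne).bdd_mul (c := C) ?_ (Eventually.of_forall fun t => ?_)
    · refine Continuous.aestronglyMeasurable ?_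
      refine hψ.continuousOn.comp_continuous (by fun_prop) fun t => ?_
      simpa using ⟨h1, h2⟩
    · exact hC _ (by simpa using h1) (by simpa using h2)
  have hgint : ∀ c : ℝ, α < c → c < β → c ≠ s.re → c < b →
      Integrable (fun t : ℝ => g (c + t * Complex.I)) ∧
      ∫ t : ℝ, g (c + t * Complex.I) = (∫ t : ℝ, ψ (c + t * Complex.I) * cauchyKer c b s t) -
        ψ s * ∫ t : ℝ, cauchyKer c b s t := by
    intro c h1 h2 h3 h4
    have hf : (fun t : ℝ => g (c + t * Complex.I)) = fun t : ℝ =>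
        ψ (c + t * Complex.I) * cauchyKer c b s t - ψ s * cauchyKer c b s t := by
      funext t; rw [hgline c h3 t]; ring
    have hk := (integrable_cauchyKer h3 h4.ne).const_mul (ψ s)
    rw [hf]
    exact ⟨(hint c h1 h2 h3 h4).sub hk, by
      rw [integral_sub (hint c h1 h2 h3 h4) hk, integral_const_mul]⟩
  have hg1 := hgint c₁ hα (by linarith) h₁.ne (by linarith)
  have hg2 := hgint c₂ (by linarith) hβ h₂.ne' hb
  have hEq := integral_vertical_eq (g := g) (c₁ := c₁) (c₂ := c₂) (T₀ := 2 * |s.im| + 1)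
    (K := 4 * C * ‖s - b‖) (by linarith) hg hg1.1 hg2.1 (by
      intro z hz1 hz2 hT
      have hns : |z.im| / 2 ≤ ‖z - s‖ := by
        have h1 := Complex.abs_im_le_norm (z - s)
        rw [Complex.sub_im] at h1
        have h2 := abs_sub_abs_le_abs_sub z.im s.im
        linarith [abs_nonneg s.im]
      have hnb : |z.im| ≤ ‖z - b‖ := by
        have h1 := Complex.abs_im_le_norm (z - b)
        simpa using h1
      have him : 1 ≤ |z.im| := by linarith [abs_nonneg s.im]
      have hzs : z - s ≠ 0 := norm_pos_iff.1 (by linarith)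
      have hzb : z - b ≠ 0 := norm_pos_iff.1 (by linarith)
      have h3 : (z - s)⁻¹ - (z - b)⁻¹ = (s - b) / ((z - s) * (z - b)) := by
        field_simp
        ring
      rw [hker z (sub_ne_zero.1 hzs), h3, norm_mul, norm_div, norm_mul]
      have h4 : ‖ψ z - ψ s‖ ≤ 2 * C := by
        refine (norm_sub_le _ _).trans ?_
        have := hC z (by linarith) (by linarith)
        have := hC s hs.1 hs.2
        linarith
      have h5 : |z.im| / 2 ≤ ‖z - s‖ * ‖z - b‖ := by
        calc |z.im| / 2 = |z.im| / 2 * 1 := by ring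
          _ ≤ ‖z - s‖ * ‖z - b‖ := by
            refine mul_le_mul hns (by linarith) zero_le_one (norm_nonneg _)
      calc ‖ψ z - ψ s‖ * (‖s - b‖ / (‖z - s‖ * ‖z - b‖))
          ≤ (2 * C) * (‖s - b‖ / (|z.im| / 2)) := by gcongr
        _ = 4 * C * ‖s - b‖ / |z.im| := by field_simp; ring)
  rw [hg1.2, hg2.2] at hEq
  have hk := integral_cauchyKer_sub h₁ h₂ hb
  linear_combination (-1 : ℂ) * hEq + ψ s * hk

/-- The Cauchy transform of a bounded function on a vertical line is holomorphic off the line. -/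
theorem differentiableOn_cauchyTransform {φ : ℝ → ℂ} {c b C : ℝ} (hφ : Continuous φ)
    (hC : ∀ t, ‖φ t‖ ≤ C) (hb : c ≠ b) :
    DifferentiableOn ℂ (fun s => ∫ t : ℝ, φ t * cauchyKer c b s t) {s | c ≠ s.re} := by
  have hopen : IsOpen {s : ℂ | c ≠ s.re} := isOpen_ne_fun continuous_const Complex.continuous_re
  have hC0 : 0 ≤ C := (norm_nonneg _).trans (hC 0)
  refine differentiableOn_integral hopen ?_ ?_ ?_
  · intro s hs
    exact (hφ.mul (continuous_cauchyKer hs hb)).aestronglyMeasurable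
  · refine Eventually.of_forall fun t => ?_
    unfold cauchyKer
    refine DifferentiableOn.const_mul (DifferentiableOn.sub_const ?_ _) _
    exact DifferentiableOn.inv (by fun_prop) fun s hs => line_sub_ne hs t
  · intro s₀ hs₀
    have h0 : 0 < |c - s₀.re| := abs_pos.2 (sub_ne_zero.2 hs₀)
    set a := min (|c - s₀.re| / 2) |c - b| with ha
    have hapos : 0 < a := lt_min (by linarith) (abs_pos.2 (sub_ne_zero.2 hb))
    set R := max (‖s₀‖ + |c - s₀.re|) |b| with hR
    refine ⟨|c - s₀.re| / 2, by linarith, fun t => C * ((2 * R * ((1 + 2 * R ^ 2) / a ^ 2 + 2)) *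
      (1 + t ^ 2)⁻¹), ?_, Eventually.of_forall fun t s hs _ => ?_⟩
    · exact (integrable_inv_one_add_sq.const_mul _).const_mul _
    · rw [Metric.mem_ball, dist_eq_norm] at hs
      rw [norm_mul]
      refine mul_le_mul (hC t) (norm_cauchyKer_le hapos ?_ (min_le_right _ _) ?_
        (le_max_right _ _) t) (norm_nonneg _) hC0
      · refine (min_le_left _ _).trans ?_
        have h1 := Complex.abs_re_le_norm (s - s₀)
        rw [Complex.sub_re] at h1
        have h2 := abs_sub_abs_le_abs_sub (c - s₀.re) (s.re - s₀.re)
        have h3 : c - s₀.re - (s.re - s₀.re) = c - s.re := by ring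
        rw [h3] at h2
        linarith
      · refine le_trans ?_ (le_max_left _ _)
        have := norm_sub_norm_le s s₀
        linarith

theorem integral_inv_add_abs {a T y : ℝ} (ha : 0 < a) (hy : |y| ≤ T) :
    IntervalIntegrable (fun t => (a + |t - y|)⁻¹) volume (-T) T ∧
    ∫ t in (-T)..T, (a + |t - y|)⁻¹ ≤ 2 * Real.log (1 + 2 * T / a) := by
  have hT : 0 ≤ T := (abs_nonneg _).trans hy
  have hy1 := (abs_le.1 hy).1
  have hy2 := (abs_le.1 hy).2
  have hcont : Continuous (fun t => (a + |t - y|)⁻¹) :=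
    Continuous.inv₀ (by fun_prop) fun t => by positivity
  refine ⟨hcont.intervalIntegrable _ _, ?_⟩
  rw [← intervalIntegral.integral_add_adjacent_intervals (hcont.intervalIntegrable (-T) y)
    (hcont.intervalIntegrable y T)]
  have h1 : ∫ t in (-T)..y, (a + |t - y|)⁻¹ = Real.log ((a + y + T) / a) := by
    have : ∫ t in (-T)..y, (a + |t - y|)⁻¹ = ∫ t in (-T)..y, ((a + y) - t)⁻¹ := by
      refine intervalIntegral.integral_congr fun t ht => ?_
      rw [Set.uIcc_of_le hy1] at ht
      rw [abs_of_nonpos (by linarith [ht.2])]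
      congr 1; ring
    rw [this, intervalIntegral.integral_comp_sub_left (fun x => x⁻¹) (a + y),
      integral_inv_of_pos (by linarith) (by linarith)]
    congr 2 <;> ring
  have h2 : ∫ t in y..T, (a + |t - y|)⁻¹ = Real.log ((a - y + T) / a) := by
    have : ∫ t in y..T, (a + |t - y|)⁻¹ = ∫ t in y..T, (t + (a - y))⁻¹ := by
      refine intervalIntegral.integral_congr fun t ht => ?_
      rw [Set.uIcc_of_le hy2] at ht
      rw [abs_of_nonneg (by linarith [ht.1])]
      congr 1; ring
    rw [this, intervalIntegral.integral_comp_add_right (fun x => x⁻¹) (a - y),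
      integral_inv_of_pos (by linarith) (by linarith)]
    congr 2 <;> ring
  rw [h1, h2, two_mul]
  refine add_le_add ?_ ?_
  · refine Real.log_le_log (div_pos (by linarith) ha) ?_
    rw [div_le_iff₀ ha, add_mul, div_mul_cancel₀ _ ha.ne']
    linarith
  · refine Real.log_le_log (div_pos (by linarith) ha) ?_
    rw [div_le_iff₀ ha, add_mul, div_mul_cancel₀ _ ha.ne']
    linarith

/-- The `L¹` norm of the Cauchy kernel grows logarithmically. -/
theorem exists_integral_norm_cauchyKer_le {c b a : ℝ} (ha : 0 < a) (hb : a ≤ |c - b|) :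
    ∃ K : ℝ, 0 ≤ K ∧ ∀ s : ℂ, a ≤ |c - s.re| →
      ∫ t, ‖cauchyKer c b s t‖ ≤ K * (1 + Real.log (2 + ‖s‖)) := by
  set K₀ : ℝ := 1 + (4 + 4 * |b|) / a with hK₀
  have hK₀1 : 1 ≤ K₀ := by
    rw [hK₀]; linarith [show 0 ≤ (4 + 4 * |b|) / a by positivity]
  have hlogK : 0 ≤ Real.log K₀ := Real.log_nonneg hK₀1
  refine ⟨8 * Real.log K₀ + 8 + 2 * Real.pi, by positivity, fun s hs => ?_⟩
  have hs' : c ≠ s.re := by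
    rintro h; rw [h] at hs; simp at hs; linarith
  have hb' : c ≠ b := by
    rintro h; rw [h] at hb; simp at hb; linarith
  -- Beyond `T` both distances in the denominator are at least `|t| / 2`, and the kernel is
  -- dominated by a Poisson kernel of width `T`, whose mass does not depend on `s`. Only the part
  -- with `|t| ≤ T` produces the logarithm.
  set T : ℝ := 2 * ‖s‖ + 2 * |b| + 2 with hT
  have hTpos : 0 < T := by positivity
  have him := Complex.abs_im_le_norm s
  have hyT : |s.im| ≤ T := by rw [hT]; linarith [abs_nonneg b, norm_nonneg s]
  obtain ⟨hI1, hI1'⟩ := integral_inv_add_abs ha hyT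
  obtain ⟨hI2, hI2'⟩ := integral_inv_add_abs (a := a) (T := T) (y := 0) ha (by simpa using hTpos.le)
  have hI := (hI1.const_mul 2).add (hI2.const_mul 2)
  have hJ := integral_div_sq_add_sq hTpos.ne'
  rw [sign_pos hTpos] at hJ
  have hset : IntegrableOn (fun t => 2 * (a + |t - s.im|)⁻¹ + 2 * (a + |t - 0|)⁻¹)
      (Set.Ioc (-T) T) := (intervalIntegrable_iff_integrableOn_Ioc_of_le (by linarith)).1 hI
  have hA : ∀ t : ℝ, (a + |t - s.im|) / 2 ≤ ‖(c : ℂ) + t * Complex.I - s‖ := by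
    intro t
    have h1 := Complex.abs_im_le_norm ((c : ℂ) + t * Complex.I - s)
    have h2 := Complex.abs_re_le_norm ((c : ℂ) + t * Complex.I - s)
    simp only [Complex.sub_im, Complex.add_im, Complex.ofReal_im, Complex.mul_im,
      Complex.ofReal_re, Complex.I_im, mul_one, Complex.I_re, mul_zero, add_zero, zero_add,
      Complex.sub_re, Complex.add_re, Complex.mul_re, sub_self] at h1 h2
    linarith
  have hB : ∀ t : ℝ, (a + |t - 0|) / 2 ≤ ‖(c : ℂ) + t * Complex.I - b‖ := by
    intro t
    have h1 := Complex.abs_im_le_norm ((c : ℂ) + t * Complex.I - b)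
    have h2 := Complex.abs_re_le_norm ((c : ℂ) + t * Complex.I - b)
    simp only [Complex.sub_im, Complex.add_im, Complex.ofReal_im, Complex.mul_im,
      Complex.ofReal_re, Complex.I_im, mul_one, Complex.I_re, mul_zero, add_zero, zero_add,
      Complex.sub_re, Complex.add_re, Complex.mul_re, sub_self, sub_zero] at h1 h2
    rw [sub_zero]
    linarith
  have hmaj : ∀ t : ℝ, ‖cauchyKer c b s t‖ ≤
      (Set.Ioc (-T) T).indicator
        (fun t => 2 * (a + |t - s.im|)⁻¹ + 2 * (a + |t - 0|)⁻¹) t + 2 * (T / (T ^ 2 + t ^ 2)) := by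
    intro t
    by_cases ht : t ∈ Set.Ioc (-T) T
    · rw [Set.indicator_of_mem ht]
      have h0 : 0 ≤ 2 * (T / (T ^ 2 + t ^ 2)) := by positivity
      have h1 : ‖cauchyKer c b s t‖ ≤ ‖(c : ℂ) + t * Complex.I - s‖⁻¹ +
          ‖(c : ℂ) + t * Complex.I - b‖⁻¹ := by
        rw [← norm_inv, ← norm_inv]
        exact norm_sub_le _ _
      have h2 : ‖(c : ℂ) + t * Complex.I - s‖⁻¹ ≤ 2 * (a + |t - s.im|)⁻¹ := by
        rw [← inv_inv (2 : ℝ), ← mul_inv]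
        refine inv_anti₀ (by positivity) ?_
        linarith [hA t]
      have h3 : ‖(c : ℂ) + t * Complex.I - b‖⁻¹ ≤ 2 * (a + |t - 0|)⁻¹ := by
        rw [← inv_inv (2 : ℝ), ← mul_inv]
        refine inv_anti₀ (by positivity) ?_
        linarith [hB t]
      linarith
    · rw [Set.indicator_of_notMem ht, zero_add, norm_cauchyKer hs' hb']
      have htT : T ≤ |t| := by
        by_contra hcon
        rw [not_le, abs_lt] at hcon
        exact ht ⟨hcon.1, hcon.2.le⟩
      have h1 : |t| / 2 ≤ ‖(c : ℂ) + t * Complex.I - s‖ := by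
        have h1 := Complex.abs_im_le_norm ((c : ℂ) + t * Complex.I - s)
        simp only [Complex.sub_im, Complex.add_im, Complex.ofReal_im, Complex.mul_im,
          Complex.ofReal_re, Complex.I_im, mul_one, Complex.I_re, mul_zero, add_zero,
          zero_add] at h1
        have h2 := abs_sub_abs_le_abs_sub t s.im
        linarith [abs_nonneg b, norm_nonneg s]
      have h2 : |t| ≤ ‖(c : ℂ) + t * Complex.I - b‖ := by
        have h1 := Complex.abs_im_le_norm ((c : ℂ) + t * Complex.I - b)
        simpa using h1
      have h3 : ‖s - b‖ ≤ T / 2 := by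
        refine (norm_sub_le _ _).trans ?_
        rw [Complex.norm_real, Real.norm_eq_abs]
        linarith
      have ht0 : 0 < |t| := hTpos.trans_le htT
      calc ‖s - b‖ / (‖(c : ℂ) + t * Complex.I - s‖ * ‖(c : ℂ) + t * Complex.I - b‖)
          ≤ (T / 2) / (|t| / 2 * |t|) := by gcongr
        _ = T / t ^ 2 := by rw [← sq_abs t]; field_simp
        _ ≤ 2 * (T / (T ^ 2 + t ^ 2)) := by
          have ht2 : 0 < t ^ 2 := by rw [← sq_abs]; positivity
          rw [mul_div_assoc', div_le_div_iff₀ ht2 (by positivity)]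
          have : T ^ 2 ≤ t ^ 2 := by rw [← sq_abs t]; gcongr
          nlinarith
  have hmajint : Integrable (fun t => (Set.Ioc (-T) T).indicator
        (fun t => 2 * (a + |t - s.im|)⁻¹ + 2 * (a + |t - 0|)⁻¹) t) :=
    (integrable_indicator_iff measurableSet_Ioc).2 hset
  have hbound : ∫ t, ‖cauchyKer c b s t‖ ≤ 8 * Real.log (1 + 2 * T / a) + 2 * Real.pi := by
    calc ∫ t, ‖cauchyKer c b s t‖ ≤ ∫ t, ((Set.Ioc (-T) T).indicator
        (fun t => 2 * (a + |t - s.im|)⁻¹ + 2 * (a + |t - 0|)⁻¹) t + 2 * (T / (T ^ 2 + t ^ 2))) :=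
          integral_mono (integrable_cauchyKer hs' hb').norm
            (hmajint.add (hJ.1.const_mul 2)) hmaj
      _ = (∫ t in (-T)..T, (2 * (a + |t - s.im|)⁻¹ + 2 * (a + |t - 0|)⁻¹)) + 2 * Real.pi := by
          rw [integral_add hmajint (hJ.1.const_mul 2), integral_indicator measurableSet_Ioc,
            integral_const_mul, hJ.2, intervalIntegral.integral_of_le (by linarith)]
          simp
      _ ≤ _ := by
          rw [intervalIntegral.integral_add (hI1.const_mul 2) (hI2.const_mul 2),
            intervalIntegral.integral_const_mul, intervalIntegral.integral_const_mul]
          linarith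
  have hlog : Real.log (1 + 2 * T / a) ≤ Real.log K₀ + Real.log (2 + ‖s‖) := by
    have hn := norm_nonneg s
    rw [← Real.log_mul (by positivity) (by positivity)]
    refine Real.log_le_log (by positivity) ?_
    rw [hK₀, add_mul, one_mul, div_mul_eq_mul_div]
    refine add_le_add (by linarith) ?_
    refine div_le_div_of_nonneg_right ?_ ha.le
    rw [hT]
    nlinarith [mul_nonneg (abs_nonneg b) hn, abs_nonneg b]
  have hl0 : 0 ≤ Real.log (2 + ‖s‖) := Real.log_nonneg (by linarith [norm_nonneg s])
  have hpi := Real.pi_pos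
  nlinarith [mul_nonneg hlogK hl0, mul_nonneg hpi.le hl0]

/-- Bound for the exponential of a Cauchy transform. -/
theorem exists_norm_exp_cauchyTransform_le {φ : ℝ → ℂ} {c b a C : ℝ}
    (hC : ∀ t, ‖φ t‖ ≤ C) (ha : 0 < a) (hb : a ≤ |c - b|) (w : ℂ) :
    ∃ (K : ℝ) (m : ℕ), 0 ≤ K ∧ ∀ s : ℂ, a ≤ |c - s.re| →
      ‖Complex.exp (w * ∫ t : ℝ, φ t * cauchyKer c b s t)‖ ≤ K * (1 + ‖s‖) ^ m := by
  obtain ⟨K, hK, hKs⟩ := exists_integral_norm_cauchyKer_le ha hb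
  have hC0 : 0 ≤ C := (norm_nonneg _).trans (hC 0)
  obtain ⟨m, hm⟩ := exists_nat_ge (‖w‖ * (C * K))
  refine ⟨Real.exp m * 2 ^ m, m, by positivity, fun s hs => ?_⟩
  have hs' : c ≠ s.re := by
    rintro h; rw [h] at hs; simp at hs; linarith
  have hb' : c ≠ b := by
    rintro h; rw [h] at hb; simp at hb; linarith
  have hn := norm_nonneg s
  have hl0 : 0 ≤ Real.log (2 + ‖s‖) := Real.log_nonneg (by linarith)
  have h1 : ‖w * ∫ t : ℝ, φ t * cauchyKer c b s t‖ ≤ m * (1 + Real.log (2 + ‖s‖)) := by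
    rw [norm_mul]
    have : ‖∫ t : ℝ, φ t * cauchyKer c b s t‖ ≤ C * (K * (1 + Real.log (2 + ‖s‖))) := by
      refine (norm_integral_le_of_norm_le
        ((integrable_cauchyKer hs' hb').norm.const_mul C) (Eventually.of_forall fun t => ?_)).trans ?_
      · rw [norm_mul]
        exact mul_le_mul_of_nonneg_right (hC t) (norm_nonneg _)
      · rw [integral_const_mul]
        exact mul_le_mul_of_nonneg_left (hKs s hs) hC0
    calc ‖w‖ * ‖∫ t : ℝ, φ t * cauchyKer c b s t‖
        ≤ ‖w‖ * (C * (K * (1 + Real.log (2 + ‖s‖)))) := by gcongr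
      _ = ‖w‖ * (C * K) * (1 + Real.log (2 + ‖s‖)) := by ring
      _ ≤ _ := by gcongr
  rw [Complex.norm_exp]
  have h2 : Real.exp (w * ∫ t : ℝ, φ t * cauchyKer c b s t).re ≤
      Real.exp (m * (1 + Real.log (2 + ‖s‖))) :=
    Real.exp_le_exp.2 ((Complex.re_le_norm _).trans h1)
  refine h2.trans ?_
  rw [mul_add, mul_one, Real.exp_add, mul_assoc]
  refine mul_le_mul_of_nonneg_left ?_ (Real.exp_pos _).le
  rw [Real.exp_nat_mul, Real.exp_log (by positivity), ← mul_pow]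
  gcongr
  linarith

/-! ### Reflection in a vertical line and functions of bounded argument. -/

/-- Reflection of a holomorphic function in the line `Re = ε`. -/
def reflect (ε : ℝ) (f : ℂ → ℂ) (s : ℂ) : ℂ :=
  (starRingEnd ℂ) (f (2 * ε - (starRingEnd ℂ) s))

theorem re_reflect_point (ε : ℝ) (s : ℂ) : (2 * ε - (starRingEnd ℂ) s).re = 2 * ε - s.re := by
  simp

theorem differentiableAt_reflect {ε : ℝ} {f : ℂ → ℂ} {s : ℂ}
    (h : DifferentiableAt ℂ f (2 * ε - (starRingEnd ℂ) s)) :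
    DifferentiableAt ℂ (reflect ε f) s := by
  have h1 : DifferentiableAt ℂ (fun w : ℂ => f (2 * ε - w)) ((starRingEnd ℂ) s) :=
    DifferentiableAt.comp _ h (by fun_prop)
  have h2 := h1.hasDerivAt.conj_conj
  rw [Complex.conj_conj] at h2
  exact h2.differentiableAt

/-- A holomorphic logarithm with bounded imaginary part has bounded oscillation on discs. -/
theorem norm_sub_le_of_im_le {L : ℂ → ℂ} {s₀ s : ℂ} {η C₀ : ℝ} (hη : 0 < η)
    (hL : DifferentiableOn ℂ L (Metric.ball s₀ η))
    (him : ∀ s ∈ Metric.ball s₀ η, |(L s).im| ≤ C₀) (hs : ‖s - s₀‖ ≤ η / 2) :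
    ‖L s - L s₀‖ ≤ 2 * (2 * C₀ + 1) := by
  have h0 : 0 ≤ C₀ := (abs_nonneg _).trans (him s₀ (Metric.mem_ball_self hη))
  have hmem : ∀ z ∈ Metric.ball (0 : ℂ) η, s₀ + z ∈ Metric.ball s₀ η := by
    intro z hz
    rw [Metric.mem_ball, dist_eq_norm, add_sub_cancel_left]
    simpa using hz
  -- Multiplication by `-i` turns the imaginary part into the real part, which is at most `2 C₀`.
  -- The extra `1` keeps the constant positive when `C₀ = 0`, and on half the radius the
  -- Borel–Carathéodory quotient is at most one.
  have h := Complex.borelCaratheodory_zero (f := fun z => -Complex.I * (L (s₀ + z) - L s₀))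
    (M := 2 * C₀ + 1) (R := η) (z := s - s₀) (by linarith) ?_ ?_ hη ?_ (by simp)
  · have hz : s₀ + (s - s₀) = s := by ring
    rw [norm_mul, norm_neg, Complex.norm_I, one_mul, hz] at h
    refine h.trans ?_
    rw [div_le_iff₀ (by linarith)]
    have : ‖s - s₀‖ ≤ η - ‖s - s₀‖ := by linarith
    have hC : 0 ≤ 2 * (2 * C₀ + 1) := by linarith
    exact mul_le_mul_of_nonneg_left this hC
  · refine DifferentiableOn.const_mul (DifferentiableOn.sub_const ?_ _) _
    exact hL.comp (by fun_prop) hmem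
  · intro z hz
    have h1 := abs_le.1 (him _ (hmem z hz))
    have h2 := abs_le.1 (him s₀ (Metric.mem_ball_self hη))
    simp
    linarith
  · rw [Metric.mem_ball, dist_zero_right]
    linarith

/-- A Riemann–Hilbert problem on the line `Re = ε`. The jump `L - reflect ε L` between `D` and its
reflection is bounded, so it splits as a difference `H₂ - H₁` of Cauchy transforms with logarithmic
growth. Then `D exp H₁` and `reflect ε D exp H₂` glue to an entire function of polynomial growth. No
upper bound on `1 / D` is assumed, and this is what the lemma replaces. -/
theorem factor_of_bounded_arg {D L : ℂ → ℂ} {ε η C C₀ : ℝ} {d : ℕ} (hη : 0 < η)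
    (hD : DifferentiableOn ℂ D {s | ε - η < s.re})
    (hDb : ∀ s : ℂ, ε - η < s.re → ‖D s‖ ≤ C * (1 + ‖s‖) ^ d)
    (hL : DifferentiableOn ℂ L {s | ε - η < s.re ∧ s.re < ε + η})
    (hexp : ∀ s : ℂ, ε - η < s.re → s.re < ε + η → Complex.exp (L s) = D s)
    (him : ∀ s : ℂ, ε - η < s.re → s.re < ε + η → |(L s).im| ≤ C₀) :
    ∃ (W : Polynomial ℂ) (E : ℂ → ℂ) (K : ℝ) (m : ℕ), W ≠ 0 ∧ ∀ s : ℂ, ε ≤ s.re →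
      W.eval s = D s * E s ∧ ‖E s‖ ≤ K * (1 + ‖s‖) ^ m := by
  have hoS : IsOpen {s : ℂ | ε - η < s.re ∧ s.re < ε + η} :=
    (isOpen_lt continuous_const Complex.continuous_re).inter
      (isOpen_lt Complex.continuous_re continuous_const)
  have hoR : IsOpen {s : ℂ | ε - η < s.re} := isOpen_lt continuous_const Complex.continuous_re
  have hC : 0 ≤ C := by
    have h := (norm_nonneg _).trans (hDb ε (by simpa using hη))
    exact nonneg_of_mul_nonneg_left h (by positivity)
  set ψ : ℂ → ℂ := fun s => L s - reflect ε L s with hψdef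
  have hmemr : ∀ s : ℂ, ε - η < s.re ∧ s.re < ε + η →
      ε - η < (2 * ε - (starRingEnd ℂ) s).re ∧ (2 * ε - (starRingEnd ℂ) s).re < ε + η := by
    intro s hs
    rw [re_reflect_point]
    constructor <;> linarith [hs.1, hs.2]
  have hψd : DifferentiableOn ℂ ψ {s | ε - η / 2 < s.re ∧ s.re < ε + η / 2} := by
    intro s hs
    have hs' : ε - η < s.re ∧ s.re < ε + η := ⟨by linarith [hs.1], by linarith [hs.2]⟩
    refine DifferentiableAt.differentiableWithinAt (DifferentiableAt.sub ?_ ?_)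
    · exact hL.differentiableAt (hoS.mem_nhds hs')
    · exact differentiableAt_reflect (hL.differentiableAt (hoS.mem_nhds (hmemr s hs')))
  -- The real part of `L` may be unbounded, but it cancels in `ψ` on the line `Re = ε`. The
  -- oscillation bound for `L` and for its reflected point gives `2 * (2 * C₀ + 1)` each, and `L s₀`
  -- minus its conjugate gives `2 * C₀`.
  set B : ℝ := 4 * (2 * C₀ + 1) + 2 * C₀ with hB
  have hψb : ∀ s : ℂ, ε - η / 2 < s.re → s.re < ε + η / 2 → ‖ψ s‖ ≤ B := by
    intro s h1 h2
    set s₀ : ℂ := (ε : ℂ) + s.im * Complex.I with hs₀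
    have hre0 : s₀.re = ε := by simp [hs₀]
    have hballsub : ∀ w ∈ Metric.ball s₀ η, ε - η < w.re ∧ w.re < ε + η := by
      intro w hw
      rw [Metric.mem_ball, dist_eq_norm] at hw
      have h := (Complex.abs_re_le_norm (w - s₀)).trans_lt hw
      rw [Complex.sub_re, hre0, abs_lt] at h
      constructor <;> linarith [h.1, h.2]
    have hLb : DifferentiableOn ℂ L (Metric.ball s₀ η) := hL.mono hballsub
    have himb : ∀ w ∈ Metric.ball s₀ η, |(L w).im| ≤ C₀ := fun w hw =>
      him w (hballsub w hw).1 (hballsub w hw).2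
    have hd1 : s - s₀ = ((s.re - ε : ℝ) : ℂ) := by
      apply Complex.ext <;> simp [hs₀]
    have hd2 : 2 * (ε : ℂ) - (starRingEnd ℂ) s - s₀ = ((ε - s.re : ℝ) : ℂ) := by
      apply Complex.ext <;> simp [hs₀]; ring
    have e1 := norm_sub_le_of_im_le (s := s) hη hLb himb (by
      rw [hd1, Complex.norm_real, Real.norm_eq_abs, abs_le]; constructor <;> linarith)
    have e2 := norm_sub_le_of_im_le (s := 2 * (ε : ℂ) - (starRingEnd ℂ) s) hη hLb himb (by
      rw [hd2, Complex.norm_real, Real.norm_eq_abs, abs_le]; constructor <;> linarith)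
    have e3 := himb s₀ (Metric.mem_ball_self hη)
    have hdecomp : ψ s = (L s - L s₀) + (L s₀ - (starRingEnd ℂ) (L s₀)) -
        (starRingEnd ℂ) (L (2 * (ε : ℂ) - (starRingEnd ℂ) s) - L s₀) := by
      simp only [hψdef, reflect, map_sub]
      ring
    have e4 : ‖L s₀ - (starRingEnd ℂ) (L s₀)‖ ≤ 2 * C₀ := by
      rw [Complex.sub_conj, norm_mul, Complex.norm_I, mul_one, Complex.norm_real,
        Real.norm_eq_abs, abs_mul, abs_two]
      linarith
    rw [hdecomp]
    refine (norm_sub_le _ _).trans ?_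
    rw [Complex.norm_conj]
    have := norm_add_le (L s - L s₀) (L s₀ - (starRingEnd ℂ) (L s₀))
    linarith
  have hline : ∀ c : ℝ, |c - ε| ≤ η / 4 → Continuous (fun t : ℝ => ψ (c + t * Complex.I)) ∧
      ∀ t : ℝ, ‖ψ (c + t * Complex.I)‖ ≤ B := by
    intro c hc
    rw [abs_le] at hc
    have hm : ∀ t : ℝ, ε - η / 2 < ((c : ℂ) + t * Complex.I).re ∧
        ((c : ℂ) + t * Complex.I).re < ε + η / 2 := by
      intro t
      simp
      constructor <;> linarith [hc.1, hc.2]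
    exact ⟨hψd.continuousOn.comp_continuous (by fun_prop) hm,
      fun t => hψb _ (hm t).1 (hm t).2⟩
  set c₁ : ℝ := ε - η / 4 with hc₁
  set c₂ : ℝ := ε + η / 4 with hc₂
  set b : ℝ := ε + η with hb
  obtain ⟨hcont1, hb1⟩ := hline c₁ (by
    rw [hc₁, abs_le]; constructor <;> linarith)
  obtain ⟨hcont2, hb2⟩ := hline c₂ (by
    rw [hc₂, abs_le]; constructor <;> linarith)
  have hcb1 : η / 4 ≤ |c₁ - b| := by
    rw [abs_of_nonpos] <;> (rw [hc₁, hb]; linarith)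
  have hcb2 : η / 4 ≤ |c₂ - b| := by
    rw [abs_of_nonpos] <;> (rw [hc₂, hb]; linarith)
  set w : ℂ := ((2 * Real.pi : ℝ) : ℂ)⁻¹ with hw
  obtain ⟨K₁, m₁, hK₁, hE₁⟩ := exists_norm_exp_cauchyTransform_le hb1 (by linarith) hcb1 w
  obtain ⟨K₂, m₂, hK₂, hE₂⟩ := exists_norm_exp_cauchyTransform_le hb2 (by linarith) hcb2 w
  set H₁ : ℂ → ℂ := fun s => w * ∫ t : ℝ, ψ (c₁ + t * Complex.I) * cauchyKer c₁ b s t with hH₁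
  set H₂ : ℂ → ℂ := fun s => w * ∫ t : ℝ, ψ (c₂ + t * Complex.I) * cauchyKer c₂ b s t with hH₂
  have hneb : ∀ c, η / 4 ≤ |c - b| → c ≠ b := by
    rintro c h rfl
    rw [sub_self, abs_zero] at h
    linarith
  have hH₁d : DifferentiableOn ℂ H₁ {s | c₁ < s.re} :=
    ((differentiableOn_cauchyTransform hcont1 hb1 (hneb _ hcb1)).mono
      (fun s (hs : c₁ < s.re) => hs.ne)).const_mul w
  have hH₂d : DifferentiableOn ℂ H₂ {s | s.re < c₂} :=
    ((differentiableOn_cauchyTransform hcont2 hb2 (hneb _ hcb2)).mono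
      (fun s (hs : s.re < c₂) => hs.ne')).const_mul w
  have hdiff : ∀ s : ℂ, c₁ < s.re → s.re < c₂ → H₂ s - H₁ s = ψ s := by
    intro s h1 h2
    have h := cauchy_strip (b := b) hψd hψb (s := s) (c₁ := c₁) (c₂ := c₂)
      (by rw [hc₁]; linarith) h1 h2 (by rw [hc₂]; linarith) (by rw [hc₂, hb]; linarith)
    have hpi : (2 * (Real.pi : ℂ)) ≠ 0 := by
      simp [Real.pi_ne_zero]
    simp only [hH₁, hH₂]
    rw [← mul_sub, h, hw]
    push_cast
    field_simp
  have hRb : ∀ s : ℂ, s.re < ε + η → ‖reflect ε D s‖ ≤ C * (1 + 2 * |ε|) ^ d * (1 + ‖s‖) ^ d := by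
    intro s hs
    rw [reflect, Complex.norm_conj]
    refine (hDb _ (by rw [re_reflect_point]; linarith)).trans ?_
    rw [mul_assoc, ← mul_pow]
    refine mul_le_mul_of_nonneg_left (pow_le_pow_left₀ (by positivity) ?_ _) hC
    have h1 : ‖2 * (ε : ℂ) - (starRingEnd ℂ) s‖ ≤ 2 * |ε| + ‖s‖ := by
      refine (norm_sub_le _ _).trans ?_
      rw [Complex.norm_conj, norm_mul, Complex.norm_real, Complex.norm_ofNat, Real.norm_eq_abs]
    nlinarith [norm_nonneg s, abs_nonneg ε, mul_nonneg (norm_nonneg s) (abs_nonneg ε)]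
  set Kt : ℝ := C * K₁ + C * (1 + 2 * |ε|) ^ d * K₂ with hKt
  have hpow : ∀ (s : ℂ) (p q : ℕ), p ≤ q → (1 + ‖s‖) ^ p ≤ (1 + ‖s‖) ^ q := fun s p q h =>
    pow_le_pow_right₀ (by linarith [norm_nonneg s]) h
  -- On the common strip the two sides are exponentials of `L + H₁` and `reflect ε L + H₂`, equal by
  -- `H₂ - H₁ = ψ`. Each growth bound is used only on its own side of `Re = ε`, at distance at least
  -- `η / 4` from the line of integration.
  obtain ⟨W, hW₁, hW₂⟩ := exists_polynomial_of_growth_strip (α := c₁) (β := c₂) (γ := ε)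
    (f₁ := fun s => D s * Complex.exp (H₁ s)) (f₂ := fun s => reflect ε D s * Complex.exp (H₂ s))
    (C := Kt) (m := d + m₁ + m₂) (by rw [hc₁, hc₂]; linarith)
    ((hD.mono fun s (hs : c₁ < s.re) => (by
      have h := hs; rw [hc₁] at h; show ε - η < s.re; linarith)).mul hH₁d.cexp)
    (by
      refine DifferentiableOn.mul ?_ hH₂d.cexp
      intro s hs
      have h : s.re < c₂ := hs
      refine (differentiableAt_reflect (hD.differentiableAt (hoR.mem_nhds ?_))).differentiableWithinAt
      show ε - η < _
      rw [re_reflect_point]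
      rw [hc₂] at h
      linarith)
    (by
      intro s h1 h2
      have hs' : ε - η < s.re ∧ s.re < ε + η := by
        rw [hc₁] at h1; rw [hc₂] at h2
        constructor <;> linarith
      have hr := hmemr s hs'
      have e := hdiff s h1 h2
      have e2 : reflect ε D s = Complex.exp (reflect ε L s) := by
        rw [reflect, ← hexp _ hr.1 hr.2, reflect, Complex.exp_conj]
      rw [← hexp s hs'.1 hs'.2, e2, ← Complex.exp_add, ← Complex.exp_add]
      congr 1
      simp only [hψdef] at e
      linear_combination (-1 : ℂ) * e)
    (by rw [hc₁]; linarith) (by rw [hc₂]; linarith)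
    (by
      intro s hs
      rw [norm_mul]
      calc ‖D s‖ * ‖Complex.exp (H₁ s)‖
          ≤ (C * (1 + ‖s‖) ^ d) * (K₁ * (1 + ‖s‖) ^ m₁) := by
            refine mul_le_mul (hDb s (by linarith)) (hE₁ s ?_) (norm_nonneg _) (by positivity)
            rw [abs_of_nonpos] <;> (rw [hc₁]; linarith)
        _ = C * K₁ * (1 + ‖s‖) ^ (d + m₁) := by rw [pow_add]; ring
        _ ≤ Kt * (1 + ‖s‖) ^ (d + m₁ + m₂) := by
            refine mul_le_mul ?_ (hpow s _ _ (by omega)) (by positivity) (by positivity)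
            rw [hKt]
            have : 0 ≤ C * (1 + 2 * |ε|) ^ d * K₂ := by positivity
            linarith)
    (by
      intro s hs
      rw [norm_mul]
      calc ‖reflect ε D s‖ * ‖Complex.exp (H₂ s)‖
          ≤ (C * (1 + 2 * |ε|) ^ d * (1 + ‖s‖) ^ d) * (K₂ * (1 + ‖s‖) ^ m₂) := by
            refine mul_le_mul (hRb s (by linarith)) (hE₂ s ?_) (norm_nonneg _) (by positivity)
            rw [abs_of_nonneg] <;> (rw [hc₂]; linarith)
        _ = C * (1 + 2 * |ε|) ^ d * K₂ * (1 + ‖s‖) ^ (d + m₂) := by rw [pow_add]; ring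
        _ ≤ Kt * (1 + ‖s‖) ^ (d + m₁ + m₂) := by
            refine mul_le_mul ?_ (hpow s _ _ (by omega)) (by positivity) (by positivity)
            rw [hKt]
            have : 0 ≤ C * K₁ := by positivity
            linarith)
  refine ⟨W, fun s => Complex.exp (H₁ s), K₁, m₁, ?_, fun s hs => ⟨?_, ?_⟩⟩
  · rintro rfl
    have h := hW₁ ε (by rw [hc₁]; simpa using hη)
    simp only [Polynomial.eval_zero] at h
    rw [← hexp ε (by simpa using hη) (by rw [Complex.ofReal_re]; linarith)] at h
    exact mul_ne_zero (Complex.exp_ne_zero _) (Complex.exp_ne_zero _) h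
  · exact (hW₁ s (by rw [hc₁]; linarith)).symm
  · refine hE₁ s ?_
    rw [abs_of_nonpos] <;> (rw [hc₁]; linarith)

/-! ### Polynomials with all roots in a left half-plane. -/

/-- The roots of a complex polynomial as a finite family. -/
theorem exists_root_family (p : Polynomial ℂ) :
    ∃ r : Fin p.natDegree → ℂ, (∀ j, r j ∈ p.roots) ∧
      ∀ u, p.eval u = p.leadingCoeff * ∏ j, (u - r j) := by
  have hs : p.Splits := IsAlgClosed.splits p
  have hcard : p.roots.toList.length = p.natDegree := by
    rw [Multiset.length_toList, hs.natDegree_eq_card_roots]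
  refine ⟨fun j => p.roots.toList[j.1]'(by rw [hcard]; exact j.2), fun j => ?_, fun u => ?_⟩
  · exact Multiset.mem_toList.1 (List.getElem_mem _)
  · rw [hs.eval_eq_prod_roots u]
    congr 1
    conv_lhs => rw [← Multiset.coe_toList p.roots]
    rw [Multiset.map_coe, Multiset.prod_coe, ← Fin.prod_univ_fun_getElem]
    exact (Fin.prod_congr' (fun j : Fin p.roots.toList.length => (u - p.roots.toList[j.1]))
      hcard.symm).symm

theorem exists_normalized_root_family {p : Polynomial ℂ} (h0 : p.eval 0 = 1) :
    ∃ r : Fin p.natDegree → ℂ, (∀ j, r j ≠ 0 ∧ p.eval (r j) = 0) ∧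
      ∀ u, p.eval u = ∏ j, (1 - u / r j) := by
  have hp : p ≠ 0 := by rintro rfl; simp at h0
  obtain ⟨r, hr, he⟩ := exists_root_family p
  have hroot : ∀ j, p.eval (r j) = 0 := fun j => (Polynomial.mem_roots hp).1 (hr j)
  have hne : ∀ j, r j ≠ 0 := by
    intro j hj
    have := hroot j
    rw [hj, h0] at this
    exact one_ne_zero this
  refine ⟨r, fun j => ⟨hne j, hroot j⟩, fun u => ?_⟩
  have h1 : p.leadingCoeff * ∏ j, (0 - r j) = 1 := by rw [← he 0, h0]
  have h2 : ∏ j, (u - r j) = (∏ j, (1 - u / r j)) * ∏ j, (0 - r j) := by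
    rw [← Finset.prod_mul_distrib]
    refine Finset.prod_congr rfl fun j _ => ?_
    have := hne j
    field_simp
    ring
  rw [he u, h2, mul_comm (∏ j, (1 - u / r j)), ← mul_assoc, h1, one_mul]

section RootBounds

variable {p : Polynomial ℂ} {δ₀ : ℝ}

theorem one_le_norm_root (hδ₀ : 0 ≤ δ₀) {r : ℂ} (hr : (1 + r).re ≤ -δ₀) : 1 ≤ ‖r‖ := by
  have h := Complex.abs_re_le_norm r
  simp at hr
  have := neg_abs_le r.re
  linarith

theorem norm_eval_le_of_roots (hδ₀ : 0 ≤ δ₀) (h0 : p.eval 0 = 1)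
    (hroots : ∀ r, p.eval r = 0 → (1 + r).re ≤ -δ₀) (u : ℂ) :
    ‖p.eval u‖ ≤ (1 + ‖u‖) ^ p.natDegree := by
  obtain ⟨r, hr, he⟩ := exists_normalized_root_family h0
  rw [he u, norm_prod]
  have hc : (1 + ‖u‖) ^ p.natDegree = ∏ _j : Fin p.natDegree, (1 + ‖u‖) := by simp
  rw [hc]
  refine Finset.prod_le_prod (fun j _ => norm_nonneg _) fun j _ => ?_
  refine (norm_sub_le _ _).trans ?_
  rw [norm_one, norm_div]
  have h1 := one_le_norm_root hδ₀ (hroots _ (hr j).2)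
  have := div_le_self (norm_nonneg u) h1
  linarith

/-- Each factor is `|r - u| / |r|` with `|r| ≤ |r - u| + |u|` and `|r - u| ≥ δ₀ - δ₁`. The bound
depends on `p` only through its degree, so absence of roots persists under limits of such
polynomials. -/
theorem le_norm_eval_of_roots {δ₁ : ℝ} (hδ : δ₁ < δ₀) (h0 : p.eval 0 = 1)
    (hroots : ∀ r, p.eval r = 0 → (1 + r).re ≤ -δ₀) {u : ℂ} (hu : -δ₁ ≤ (1 + u).re) :
    ((δ₀ - δ₁) / (δ₀ - δ₁ + ‖u‖)) ^ p.natDegree ≤ ‖p.eval u‖ := by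
  obtain ⟨r, hr, he⟩ := exists_normalized_root_family h0
  have hη : 0 < δ₀ - δ₁ := by linarith
  rw [he u, norm_prod]
  have hc : ((δ₀ - δ₁) / (δ₀ - δ₁ + ‖u‖)) ^ p.natDegree =
      ∏ _j : Fin p.natDegree, ((δ₀ - δ₁) / (δ₀ - δ₁ + ‖u‖)) := by
    rw [Finset.prod_const, Finset.card_univ, Fintype.card_fin]
  rw [hc]
  refine Finset.prod_le_prod (fun j _ => by positivity) fun j _ => ?_
  have hre := hroots _ (hr j).2
  have hrpos : 0 < ‖r j‖ := norm_pos_iff.2 (hr j).1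
  have h1 : δ₀ - δ₁ ≤ ‖r j - u‖ := by
    have h := Complex.abs_re_le_norm (r j - u)
    have h2 := neg_abs_le (r j - u).re
    simp at hre hu h h2
    linarith
  have h2 : ‖r j‖ ≤ ‖r j - u‖ + ‖u‖ := by
    have := norm_add_le (r j - u) u
    rwa [sub_add_cancel] at this
  have h3 : 1 - u / r j = (r j - u) / r j := by
    have := (hr j).1
    field_simp
  rw [h3, norm_div, div_le_div_iff₀ (by positivity) hrpos]
  nlinarith [norm_nonneg u, norm_nonneg (r j)]

/-- All roots have modulus at least `1`, so the Mahler measure is the modulus of the leading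
coefficient times that of all roots, that is `|p(0)| = 1`. Coefficients are then at most binomial
coefficients. -/
theorem norm_coeff_le_of_roots (hδ₀ : 0 ≤ δ₀) (h0 : p.eval 0 = 1)
    (hroots : ∀ r, p.eval r = 0 → (1 + r).re ≤ -δ₀) (i : ℕ) :
    ‖p.coeff i‖ ≤ 2 ^ p.natDegree := by
  have hp : p ≠ 0 := by rintro rfl; simp at h0
  have hM : p.mahlerMeasure = 1 := by
    rw [Polynomial.mahlerMeasure_eq_leadingCoeff_mul_prod_roots]
    have h1 : p.roots.map (fun a => max 1 ‖a‖) = p.roots.map (fun a => ‖0 - a‖) := by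
      refine Multiset.map_congr rfl fun a ha => ?_
      rw [zero_sub, norm_neg]
      exact max_eq_right (one_le_norm_root hδ₀ (hroots a ((Polynomial.mem_roots hp).1 ha)))
    have h2 := (IsAlgClosed.splits p).eval_eq_prod_roots 0
    rw [h0] at h2
    have h3 := congrArg norm h2
    rw [norm_mul, norm_one] at h3
    rw [h1, h3]
    congr 1
    have := map_multiset_prod (normHom : ℂ →*₀ ℝ) (p.roots.map fun a => 0 - a)
    simp only [Multiset.map_map] at this
    exact this.symm
  have h := p.norm_coeff_le_choose_mul_mahlerMeasure i
  rw [hM, mul_one] at h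
  refine h.trans ?_
  exact_mod_cast Nat.choose_le_two_pow _ _

/-- If `1 - u / r = x ≤ 0`, then `u = (1 - x) r` lies on the ray from `r` away from the origin,
which stays in the half-plane containing the roots. -/
theorem mem_slitPlane_of_roots (hδ₀ : 0 ≤ δ₀) {r u : ℂ} (hr : (1 + r).re ≤ -δ₀)
    (hu : -δ₀ < (1 + u).re) : 1 - u / r ∈ Complex.slitPlane := by
  have hr0 : r ≠ 0 := by
    rintro rfl
    simp at hr
    linarith
  by_contra hcon
  rw [Complex.mem_slitPlane_iff_not_le_zero, not_not] at hcon
  obtain ⟨hre, him⟩ := Complex.le_def.1 hcon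
  set x := 1 - u / r with hx
  have h1 : r - u = x * r := by
    rw [hx]
    field_simp
  have h2 := congrArg Complex.re h1
  simp only [Complex.sub_re, Complex.mul_re, Complex.zero_im, Complex.zero_re] at h2 hre him
  rw [him] at h2
  simp at hr hu
  nlinarith

/-- The logarithm of a polynomial along a ray from the origin. -/
def polyLog (p : Polynomial ℂ) (u : ℂ) : ℂ :=
  ∫ τ in (0 : ℝ)..1, u * p.derivative.eval (τ * u) / p.eval (τ * u)

/-- The integral is the sum of the principal logarithms of the factors `1 - u / r`, each with
imaginary part at most `π` in modulus. The integral form involves only the coefficients and no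
labelling of the roots, so it depends holomorphically on parameters. -/
theorem polyLog_spec (hδ₀ : 0 ≤ δ₀) (h0 : p.eval 0 = 1)
    (hroots : ∀ r, p.eval r = 0 → (1 + r).re ≤ -δ₀) {u : ℂ} (hu : -δ₀ < (1 + u).re) :
    Complex.exp (polyLog p u) = p.eval u ∧ |(polyLog p u).im| ≤ p.natDegree * Real.pi := by
  obtain ⟨r, hr, he⟩ := exists_normalized_root_family h0
  have hre := fun j => hroots _ (hr j).2
  have hτ : ∀ τ ∈ Set.uIcc (0 : ℝ) 1, -δ₀ < (1 + τ * u).re := by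
    intro τ hτ
    rw [Set.uIcc_of_le zero_le_one] at hτ
    simp at hu ⊢
    by_cases h1 : τ = 1
    · rw [h1]; linarith
    · have : τ < 1 := lt_of_le_of_ne hτ.2 h1
      nlinarith [hτ.1]
  have hslit : ∀ τ ∈ Set.uIcc (0 : ℝ) 1, ∀ j, 1 - (τ * u) / r j ∈ Complex.slitPlane :=
    fun τ h j => mem_slitPlane_of_roots hδ₀ (hre j) (hτ τ h)
  have hderiv : ∀ τ ∈ Set.uIcc (0 : ℝ) 1,
      HasDerivAt (fun τ : ℝ => ∑ j, Complex.log (1 - (τ * u) / r j))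
        (u * p.derivative.eval (τ * u) / p.eval (τ * u)) τ := by
    intro τ h
    have hj : ∀ j, HasDerivAt (fun τ : ℝ => Complex.log (1 - (τ * u) / r j))
        (-(u / r j) / (1 - (τ * u) / r j)) τ := by
      intro j
      refine HasDerivAt.clog_real ?_ (hslit τ h j)
      have h1 : HasDerivAt (fun τ : ℝ => (τ : ℂ)) 1 τ := Complex.ofRealCLM.hasDerivAt
      have h2 := ((h1.mul_const u).div_const (r j)).const_sub 1
      simpa using h2
    have hsum := HasDerivAt.fun_sum (u := Finset.univ) fun j _ => hj j
    refine hsum.congr_deriv ?_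
    have hlog : logDeriv (fun x => p.eval x) (τ * u) =
        ∑ j, logDeriv (fun x => 1 - x / r j) (τ * u) := by
      have : (fun x => p.eval x) = fun x => ∏ j, (1 - x / r j) := funext he
      rw [this]
      exact logDeriv_prod (fun j _ => Complex.slitPlane_ne_zero (hslit τ h j))
        (fun j _ => by fun_prop)
    rw [mul_div_assoc]
    have hl : logDeriv (fun x => p.eval x) (τ * u) =
        p.derivative.eval (τ * u) / p.eval (τ * u) := by
      rw [logDeriv_apply, Polynomial.deriv]
    rw [← hl, hlog, Finset.mul_sum]
    refine Finset.sum_congr rfl fun j _ => ?_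
    have : deriv (fun x => 1 - x / r j) (τ * u) = -(1 / r j) := by
      have := ((hasDerivAt_id (τ * u : ℂ)).div_const (r j)).const_sub 1
      exact this.deriv
    rw [logDeriv_apply, this]
    ring
  have hcont : ContinuousOn (fun τ : ℝ => u * p.derivative.eval (τ * u) / p.eval (τ * u))
      (Set.uIcc 0 1) := by
    refine ContinuousOn.div (by fun_prop) (by fun_prop) fun τ h => ?_
    rw [he]
    exact Finset.prod_ne_zero_iff.2 fun j _ => Complex.slitPlane_ne_zero (hslit τ h j)
  have hint : polyLog p u = ∑ j, Complex.log (1 - u / r j) := by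
    rw [polyLog, intervalIntegral.integral_eq_sub_of_hasDerivAt hderiv hcont.intervalIntegrable]
    simp
  constructor
  · rw [hint, Complex.exp_sum, he]
    refine Finset.prod_congr rfl fun j _ => Complex.exp_log ?_
    have := hslit 1 (by simp) j
    rw [Complex.ofReal_one, one_mul] at this
    exact Complex.slitPlane_ne_zero this
  · rw [hint, Complex.im_sum]
    refine (Finset.abs_sum_le_sum_abs _ _).trans ?_
    refine (Finset.sum_le_card_nsmul _ _ Real.pi fun j _ => ?_).trans (by simp)
    rw [Complex.log_im]
    exact Complex.abs_arg_le_pi _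

end RootBounds

/-! ### Hankel determinants and holomorphic families of rational functions. -/

/-- A family of vectors all of whose maximal minors vanish satisfies a linear relation. -/
theorem exists_relation_of_det_eq_zero {ι : Type*} {n : ℕ} (v : ι → Fin n → ℂ)
    (h : ∀ κ : Fin n → ι, Matrix.det (Matrix.of fun a => v (κ a)) = 0) :
    ∃ q : Fin n → ℂ, q ≠ 0 ∧ ∀ k, ∑ i, v k i * q i = 0 := by
  by_cases htop : Submodule.span ℂ (Set.range v) = ⊤
  · exfalso
    have hr : Module.finrank ℂ (Submodule.span ℂ (Set.range v)) = n := by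
      rw [htop, finrank_top, Module.finrank_fintype_fun_eq_card, Fintype.card_fin]
    obtain ⟨f, hf, hli⟩ : ∃ f : Fin n → Fin n → ℂ, (∀ i, f i ∈ Set.range v) ∧
        LinearIndependent ℂ f := by
      obtain ⟨f, hf, -, hli⟩ := Submodule.exists_fun_fin_finrank_span_eq ℂ (Set.range v)
      exact ⟨fun i => f (Fin.cast hr.symm i), fun i => hf _,
        hli.comp _ (Fin.cast_injective hr.symm)⟩
    choose κ hκ using hf
    have h1 := h κ
    rw [← Matrix.det_transpose] at h1
    have h2 : LinearIndependent ℂ (fun a => v (κ a)) := by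
      rw [show (fun a => v (κ a)) = f from funext hκ]
      exact hli
    have h3 := (Matrix.linearIndependent_rows_iff_isUnit
      (A := Matrix.of fun a => v (κ a))).1 h2
    rw [Matrix.isUnit_iff_isUnit_det, ← Matrix.det_transpose, h1] at h3
    exact not_isUnit_zero h3
  · obtain ⟨f, hf0, hf⟩ := Submodule.exists_le_ker_of_lt_top _ (lt_top_iff_ne_top.2 htop)
    refine ⟨fun i => f (Pi.single i 1), fun h0 => hf0 ?_, fun k => ?_⟩
    · refine LinearMap.pi_ext' fun i => LinearMap.ext_ring ?_
      simpa using congrFun h0 i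
    · have h1 : f (v k) = 0 := hf (Submodule.subset_span ⟨k, rfl⟩)
      rw [LinearMap.pi_apply_eq_sum_univ f (v k)] at h1
      rw [← h1]
      refine Finset.sum_congr rfl fun i _ => ?_
      rw [smul_eq_mul]
      congr 1
      show f _ = f _
      congr 1
      funext j
      simp [Pi.single_apply, eq_comm]

/-- The polynomial with given coefficients. -/
def vecPoly {n : ℕ} (q : Fin n → ℂ) : Polynomial ℂ :=
  ∑ i : Fin n, Polynomial.C (q i) * Polynomial.X ^ (i : ℕ)

theorem coeff_vecPoly {n : ℕ} (q : Fin n → ℂ) (k : ℕ) :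
    (vecPoly q).coeff k = if h : k < n then q ⟨k, h⟩ else 0 := by
  simp only [vecPoly, Polynomial.finsetSum_coeff, Polynomial.coeff_C_mul, Polynomial.coeff_X_pow,
    mul_ite, mul_one, mul_zero]
  split_ifs with h
  · rw [Finset.sum_eq_single ⟨k, h⟩]
    · simp
    · intro b _ hb
      rw [if_neg]
      rintro rfl
      exact hb rfl
    · simp
  · refine Finset.sum_eq_zero fun i _ => ?_
    rw [if_neg]
    rintro rfl
    exact h i.2

theorem vecPoly_coeff {n : ℕ} {Q : Polynomial ℂ} (hQ : ∀ k, n ≤ k → Q.coeff k = 0) :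
    vecPoly (fun i : Fin n => Q.coeff i) = Q := by
  ext k
  rw [coeff_vecPoly]
  split_ifs with h
  · rfl
  · exact (hQ k (not_lt.1 h)).symm

/-- From `k = n - 1` on, the natural subtraction `k - i` is never truncated. A vanishing coefficient
is then a linear relation for a row of the Hankel matrix. -/
theorem coeff_vecPoly_mul {n : ℕ} (q : Fin n → ℂ) (c : ℕ → ℂ) {k : ℕ} (hk : n ≤ k + 1) :
    PowerSeries.coeff k ((vecPoly q : PowerSeries ℂ) * PowerSeries.mk c) =
      ∑ i : Fin n, c (k - i) * q i := by
  rw [PowerSeries.coeff_mul, Finset.Nat.sum_antidiagonal_eq_sum_range_succ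
    (fun a b => PowerSeries.coeff a (vecPoly q : PowerSeries ℂ) *
      PowerSeries.coeff b (PowerSeries.mk c))]
  simp only [Polynomial.coeff_coe, PowerSeries.coeff_mk]
  rw [Finset.sum_subset_zero_on_sdiff (s₁ := Finset.range n) (s₂ := Finset.range (k + 1))
    (g := fun i => (vecPoly q).coeff i * c (k - i)) ?_ ?_ (fun _ _ => rfl) |>.symm]
  · rw [Finset.sum_range]
    refine Finset.sum_congr rfl fun i _ => ?_
    rw [coeff_vecPoly, dif_pos i.2, mul_comm]
  · exact Finset.range_subset_range.2 hk
  · intro i hi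
    simp only [Finset.mem_sdiff, Finset.mem_range, not_lt] at hi
    rw [coeff_vecPoly, dif_neg (not_lt.2 hi.2), zero_mul]

theorem hasSum_polynomial_mul {c : ℕ → ℂ} {H : ℂ → ℂ} (Q : Polynomial ℂ) {u : ℂ}
    (h : HasSum (fun k => c k * u ^ k) (H u)) :
    HasSum (fun k => PowerSeries.coeff k ((Q : PowerSeries ℂ) * PowerSeries.mk c) * u ^ k)
      (Q.eval u * H u) := by
  have hQs : HasSum (fun k => Q.coeff k * u ^ k) (Q.eval u) := by
    rw [Polynomial.eval_eq_sum_range]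
    refine hasSum_sum_of_ne_finset_zero fun k hk => ?_
    rw [Polynomial.coeff_eq_zero_of_natDegree_lt (by simpa using hk), zero_mul]
  have h1 := tsum_mul_tsum_eq_tsum_sum_antidiagonal_of_summable_norm hQs.summable.norm
    h.summable.norm
  have h2 := (summable_norm_sum_mul_antidiagonal_of_summable_norm hQs.summable.norm
    h.summable.norm).of_norm
  rw [hQs.tsum_eq, h.tsum_eq] at h1
  rw [h1]
  refine h2.hasSum.congr_fun ?_ |> fun h => h
  intro k
  rw [PowerSeries.coeff_mul, Finset.sum_mul]
  refine Finset.sum_congr rfl fun ij hij => ?_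
  replace hij := Finset.HasAntidiagonal.mem_antidiagonal.1 hij
  rw [Polynomial.coeff_coe, PowerSeries.coeff_mk, ← hij, pow_add]
  ring

theorem coeff_eq_of_hasSum {a b : ℕ → ℂ} {f : ℂ → ℂ}
    (ha : ∀ u : ℂ, ‖u‖ < 1 → HasSum (fun k => a k * u ^ k) (f u))
    (hb : ∀ u : ℂ, ‖u‖ < 1 → HasSum (fun k => b k * u ^ k) (f u)) : a = b := by
  have key : ∀ c : ℕ → ℂ, (∀ u : ℂ, ‖u‖ < 1 → HasSum (fun k => c k * u ^ k) (f u)) →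
      HasFPowerSeriesAt f (FormalMultilinearSeries.ofScalars ℂ c) 0 := by
    intro c hc
    rw [hasFPowerSeriesAt_iff]
    filter_upwards [Metric.ball_mem_nhds (0 : ℂ) one_pos] with u hu
    have := hc u (by simpa using hu)
    rw [zero_add]
    refine this.congr_fun ?_ |> fun h => h
    intro k
    rw [FormalMultilinearSeries.coeff_ofScalars, smul_eq_mul, mul_comm]
  exact FormalMultilinearSeries.ofScalars_series_injective ℂ ℂ
    ((key a ha).eq_formalMultilinearSeries (key b hb))

theorem hasSum_polynomial (P : Polynomial ℂ) (u : ℂ) :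
    HasSum (fun k => P.coeff k * u ^ k) (P.eval u) := by
  rw [Polynomial.eval_eq_sum_range]
  refine hasSum_sum_of_ne_finset_zero fun k hk => ?_
  rw [Polynomial.coeff_eq_zero_of_natDegree_lt (by simpa using hk), zero_mul]

theorem powerSeries_eq_of_eval_eq {c : ℕ → ℂ} {H : ℂ → ℂ} {P Q : Polynomial ℂ}
    (h : ∀ u : ℂ, ‖u‖ < 1 → HasSum (fun k => c k * u ^ k) (H u))
    (hPQ : ∀ u : ℂ, ‖u‖ < 1 → Q.eval u * H u = P.eval u) :
    (Q : PowerSeries ℂ) * PowerSeries.mk c = (P : PowerSeries ℂ) := by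
  ext k
  refine congrFun (coeff_eq_of_hasSum (f := fun u => P.eval u)
    (a := fun k => PowerSeries.coeff k ((Q : PowerSeries ℂ) * PowerSeries.mk c))
    (b := fun k => PowerSeries.coeff k (P : PowerSeries ℂ)) ?_ ?_) k
  · intro u hu
    have := hasSum_polynomial_mul Q (h u hu)
    rwa [hPQ u hu] at this
  · intro u _
    simpa using hasSum_polynomial P u

theorem eval_eq_of_powerSeries_eq {c : ℕ → ℂ} {H : ℂ → ℂ} {P Q : Polynomial ℂ} {u : ℂ}
    (h : HasSum (fun k => c k * u ^ k) (H u))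
    (hPQ : (Q : PowerSeries ℂ) * PowerSeries.mk c = (P : PowerSeries ℂ)) :
    Q.eval u * H u = P.eval u := by
  have h1 := hasSum_polynomial_mul Q h
  rw [hPQ] at h1
  have h2 := hasSum_polynomial P u
  simp only [Polynomial.coeff_coe] at h1
  exact h1.unique h2

/-- A power series whose product with `Q` has no coefficients from `n` on times `Q` is a
polynomial. -/
theorem exists_polynomial_of_coeff_zero {Q : Polynomial ℂ} {c : ℕ → ℂ} {n : ℕ}
    (h : ∀ k, n ≤ k → PowerSeries.coeff k ((Q : PowerSeries ℂ) * PowerSeries.mk c) = 0) :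
    (Q : PowerSeries ℂ) * PowerSeries.mk c =
      (PowerSeries.trunc n ((Q : PowerSeries ℂ) * PowerSeries.mk c) : Polynomial ℂ) := by
  ext k
  rw [Polynomial.coeff_coe, PowerSeries.coeff_trunc]
  split_ifs with hk
  · rfl
  · exact h k (not_lt.1 hk)

/-- The open right half-plane. -/
def rightHalf : Set ℂ := {s | 0 < s.re}

theorem isOpen_rightHalf : IsOpen rightHalf := isOpen_lt continuous_const Complex.continuous_re

theorem isPreconnected_rightHalf : IsPreconnected rightHalf :=
  (convex_halfSpace_re_gt 0).isPreconnected

theorem differentiableOn_det {n : ℕ} {U : Set ℂ} {M : ℂ → Matrix (Fin n) (Fin n) ℂ}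
    (h : ∀ a i, DifferentiableOn ℂ (fun s => M s a i) U) :
    DifferentiableOn ℂ (fun s => (M s).det) U := by
  simp only [Matrix.det_apply]
  refine DifferentiableOn.fun_sum fun σ _ => DifferentiableOn.const_smul ?_ _
  exact DifferentiableOn.fun_finsetProd fun i _ => h _ _

/-- The Hankel matrix of the sequence `c` with `n` columns and rows `κ`. -/
def hankelMatrix (c : ℕ → ℂ → ℂ) {n : ℕ} (κ : Fin n → ℕ) (s : ℂ) : Matrix (Fin n) (Fin n) ℂ :=
  Matrix.of fun a i => c (κ a - i) s

theorem eqOn_zero_of_isOpen {f : ℂ → ℂ} (hf : DifferentiableOn ℂ f rightHalf) {V : Set ℂ}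
    (hV : IsOpen V) (hne : V.Nonempty) (hsub : V ⊆ rightHalf) (h0 : ∀ s ∈ V, f s = 0) :
    ∀ s ∈ rightHalf, f s = 0 := by
  obtain ⟨s₀, hs₀⟩ := hne
  refine (hf.analyticOnNhd isOpen_rightHalf).eqOn_zero_of_preconnected_of_eventuallyEq_zero
    isPreconnected_rightHalf (hsub hs₀) ?_
  filter_upwards [hV.mem_nhds hs₀] with s hs using h0 s hs

/-- A holomorphic family of power series, each of which is a rational function, has uniformly
bounded degree. -/
theorem exists_hankel_rank {c : ℕ → ℂ → ℂ} (hc : ∀ k, DifferentiableOn ℂ (c k) rightHalf)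
    (hrat : ∀ s ∈ rightHalf, ∃ P Q : Polynomial ℂ, Q ≠ 0 ∧
      (Q : PowerSeries ℂ) * PowerSeries.mk (fun k => c k s) = (P : PowerSeries ℂ)) :
    ∃ d : ℕ, (∀ κ : Fin (d + 1) → ℕ, (∀ a, d + 1 ≤ κ a) → ∀ s ∈ rightHalf,
        (hankelMatrix c κ s).det = 0) ∧
      ∃ κ : Fin d → ℕ, (∀ a, d ≤ κ a) ∧ ∃ s ∈ rightHalf, (hankelMatrix c κ s).det ≠ 0 := by
  classical
  have hdiff : ∀ {n : ℕ} (κ : Fin n → ℕ),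
      DifferentiableOn ℂ (fun s => (hankelMatrix c κ s).det) rightHalf :=
    fun κ => differentiableOn_det fun a i => hc _
  have hex : ∃ n : ℕ, ∀ κ : Fin n → ℕ, (∀ a, n ≤ κ a) → ∀ s ∈ rightHalf,
      (hankelMatrix c κ s).det = 0 := by
    have : BaireSpace rightHalf := isOpen_rightHalf.baireSpace
    have : Nonempty rightHalf := ⟨⟨1, by simp [rightHalf]⟩⟩
    -- The closed sets of parameters on which all determinants of size `n` vanish cover the
    -- half-plane: once `n` exceeds both degrees, the denominator's coefficients form a kernel
    -- vector. By Baire one of them has interior, and the identity theorem extends the vanishing to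
    -- all parameters.
    obtain ⟨n, hn⟩ := nonempty_interior_of_iUnion_of_closed
      (X := rightHalf) (f := fun n : ℕ => {s : rightHalf | ∀ κ : Fin n → ℕ, (∀ a, n ≤ κ a) →
        (hankelMatrix c κ s).det = 0}) (by
        intro n
        simp only [Set.ofPred_forall]
        refine isClosed_iInter fun κ => isClosed_iInter fun _ => ?_
        exact isClosed_eq ((hdiff κ).continuousOn.domRestrict) continuous_const) (by
        rw [Set.eq_univ_iff_forall]
        rintro ⟨s, hs⟩
        obtain ⟨P, Q, hQ, hPQ⟩ := hrat s hs
        rw [Set.mem_iUnion]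
        set n := max P.natDegree Q.natDegree + 1 with hn
        refine ⟨n, fun κ hκ => ?_⟩
        have hvec : vecPoly (fun i : Fin n => Q.coeff i) = Q := vecPoly_coeff fun k hk =>
          Polynomial.coeff_eq_zero_of_natDegree_lt (by omega)
        refine Matrix.exists_mulVec_eq_zero_iff.1 ⟨fun i : Fin n => Q.coeff i, ?_, ?_⟩
        · intro h0
          rw [h0] at hvec
          apply hQ
          rw [← hvec]
          simp [vecPoly]
        · funext a
          have h1 := coeff_vecPoly_mul (fun i : Fin n => Q.coeff i) (fun k => c k s)
            (k := κ a) ((hκ a).trans (Nat.le_succ _))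
          rw [hvec, hPQ, Polynomial.coeff_coe,
            Polynomial.coeff_eq_zero_of_natDegree_lt (by have := hκ a; omega)] at h1
          simpa [Matrix.mulVec, dotProduct, hankelMatrix] using h1.symm)
    refine ⟨n, fun κ hκ => ?_⟩
    refine eqOn_zero_of_isOpen (hdiff κ)
      (isOpen_rightHalf.isOpenMap_subtype_val _ isOpen_interior) (hn.image _) ?_ ?_
    · rintro _ ⟨s, -, rfl⟩
      exact s.2
    · rintro _ ⟨s, hs, rfl⟩
      exact interior_subset hs κ hκ
  -- The least admissible size is positive, because the empty determinant is `1`. Writing it as `d +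
  -- 1` gives vanishing at size `d + 1` and, by minimality, a nonvanishing determinant at size `d`.
  set N := Nat.find hex with hN
  have hN0 : N ≠ 0 := by
    intro h0
    have := Nat.find_spec hex
    rw [← hN, h0] at this
    have h1 := this Fin.elim0 (fun a => a.elim0) 1 (by simp [rightHalf])
    simp at h1
  obtain ⟨d, hd⟩ := Nat.exists_eq_succ_of_ne_zero hN0
  refine ⟨d, ?_, ?_⟩
  · have := Nat.find_spec hex
    rw [← hN, hd] at this
    exact this
  · have := Nat.find_min hex (m := d) (by omega)
    push Not at this
    exact this

/-- Normalised denominators, given by Cramer's rule where the determinant does not vanish. -/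
def cramerCoeff (c : ℕ → ℂ → ℂ) {d : ℕ} (κ : Fin d → ℕ) (s : ℂ) : Fin (d + 1) → ℂ :=
  Fin.cons 1 fun i => (hankelMatrix c κ s).cramer (fun a => -c (κ a + 1) s) i /
    (hankelMatrix c κ s).det

theorem differentiableOn_cramerCoeff {c : ℕ → ℂ → ℂ}
    (hc : ∀ k, DifferentiableOn ℂ (c k) rightHalf) {d : ℕ} (κ : Fin d → ℕ) (i : Fin (d + 1)) :
    DifferentiableOn ℂ (fun s => cramerCoeff c κ s i)
      {s | s ∈ rightHalf ∧ (hankelMatrix c κ s).det ≠ 0} := by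
  have hsub : {s | s ∈ rightHalf ∧ (hankelMatrix c κ s).det ≠ 0} ⊆ rightHalf := fun s hs => hs.1
  refine Fin.cases ?_ (fun i => ?_) i
  · simp only [cramerCoeff, Fin.cons_zero]
    exact differentiableOn_const _
  · simp only [cramerCoeff, Fin.cons_succ]
    refine DifferentiableOn.div ?_ ((differentiableOn_det fun a i => hc _).mono hsub)
      fun s hs => hs.2
    simp only [Matrix.cramer_apply]
    refine (differentiableOn_det fun a j => ?_).mono hsub
    simp only [Matrix.updateCol_apply, hankelMatrix, Matrix.of_apply]
    split_ifs
    · exact (hc _).neg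
    · exact hc _

/-- Vanishing of all minors of size `d + 1` gives one nonzero relation valid for every row from `d +
1` on. Its first entry is nonzero, as the rest would otherwise lie in the kernel of an invertible
matrix of size `d`. After normalising that entry to `1`, the rows `κ a + 1` determine the others, so
the relation is the Cramer vector. -/
theorem coeff_cramerCoeff {c : ℕ → ℂ → ℂ} {d : ℕ} {κ : Fin d → ℕ} (hκ : ∀ a, d ≤ κ a) {s : ℂ}
    (hs : (hankelMatrix c κ s).det ≠ 0)
    (hzero : ∀ κ : Fin (d + 1) → ℕ, (∀ a, d + 1 ≤ κ a) → (hankelMatrix c κ s).det = 0)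
    {k : ℕ} (hk : d + 1 ≤ k) :
    PowerSeries.coeff k ((vecPoly (cramerCoeff c κ s) : PowerSeries ℂ) *
      PowerSeries.mk fun k => c k s) = 0 := by
  obtain ⟨q, hq, hrel⟩ := exists_relation_of_det_eq_zero
    (fun (k : {k : ℕ // d + 1 ≤ k}) (i : Fin (d + 1)) => c (k - i) s)
    (fun κ' => hzero (fun a => κ' a) fun a => (κ' a).2)
  have hM : ∀ x : Fin d → ℂ, (hankelMatrix c κ s).mulVec x = 0 → x = 0 := by
    intro x hx
    exact Matrix.eq_zero_of_mulVec_eq_zero hs hx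
  have hsplit : ∀ k, d + 1 ≤ k → c k s * q 0 + ∑ i : Fin d, c (k - 1 - i) s * q i.succ = 0 := by
    intro k hk
    have := hrel ⟨k, hk⟩
    rw [Fin.sum_univ_succ] at this
    simp only [Fin.val_zero, Nat.sub_zero, Fin.val_succ] at this
    rw [← this]
    congr 1
    refine Finset.sum_congr rfl fun i _ => ?_
    rw [Nat.sub_sub, Nat.add_comm 1]
  have hq0 : q 0 ≠ 0 := by
    intro h0
    have h1 : (fun i : Fin d => q i.succ) = 0 := by
      refine hM _ ?_
      funext a
      have := hsplit (κ a + 1) (Nat.succ_le_succ (hκ a))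
      rw [h0, mul_zero, zero_add] at this
      simpa [Matrix.mulVec, dotProduct, hankelMatrix] using this
    apply hq
    funext i
    refine Fin.cases h0 (fun j => ?_) i
    exact congrFun h1 j
  have huniq : cramerCoeff c κ s = fun i => q i / q 0 := by
    have hx : (fun i : Fin d => q i.succ / q 0) = fun i =>
        (hankelMatrix c κ s).cramer (fun a => -c (κ a + 1) s) i /
          (hankelMatrix c κ s).det := by
      rw [← sub_eq_zero]
      refine hM _ ?_
      rw [Matrix.mulVec_sub, sub_eq_zero]
      have h2 : (hankelMatrix c κ s).mulVec (fun i =>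
          (hankelMatrix c κ s).cramer (fun a => -c (κ a + 1) s) i /
          (hankelMatrix c κ s).det) = fun a => -c (κ a + 1) s := by
        have h3 := Matrix.mulVec_cramer (hankelMatrix c κ s) (fun a => -c (κ a + 1) s)
        have h4 : (fun i => (hankelMatrix c κ s).cramer (fun a => -c (κ a + 1) s) i /
          (hankelMatrix c κ s).det) = (hankelMatrix c κ s).det⁻¹ •
            (hankelMatrix c κ s).cramer (fun a => -c (κ a + 1) s) := by
          funext i
          rw [Pi.smul_apply, smul_eq_mul, div_eq_inv_mul]
        rw [h4, Matrix.mulVec_smul, h3, smul_smul, inv_mul_cancel₀ hs, one_smul]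
      rw [h2]
      funext a
      have h5 := hsplit (κ a + 1) (Nat.succ_le_succ (hκ a))
      simp only [Matrix.mulVec, dotProduct, hankelMatrix, Matrix.of_apply]
      rw [Nat.add_sub_cancel] at h5
      have h6 : ∑ i : Fin d, c (κ a - i) s * (q i.succ / q 0) =
          (∑ i : Fin d, c (κ a - i) s * q i.succ) / q 0 := by
        rw [Finset.sum_div]
        exact Finset.sum_congr rfl fun i _ => by ring
      rw [h6, div_eq_iff hq0]
      linear_combination h5
    funext i
    refine Fin.cases ?_ (fun j => ?_) i
    · simp [cramerCoeff, hq0]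
    · rw [cramerCoeff, Fin.cons_succ]
      exact (congrFun hx j).symm
  rw [coeff_vecPoly_mul _ _ (by omega), huniq]
  have h7 := hrel ⟨k, hk⟩
  have h8 : ∑ i : Fin (d + 1), c (k - i) s * (q i / q 0) =
      (∑ i : Fin (d + 1), c (k - i) s * q i) / q 0 := by
    rw [Finset.sum_div]
    exact Finset.sum_congr rfl fun i _ => by ring
  rw [h8, h7, zero_div]

theorem eval_zero_vecPoly_cramerCoeff {c : ℕ → ℂ → ℂ} {d : ℕ} (κ : Fin d → ℕ) (s : ℂ) :
    (vecPoly (cramerCoeff c κ s)).eval 0 = 1 := by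
  rw [← Polynomial.coeff_zero_eq_eval_zero, coeff_vecPoly, dif_pos (Nat.succ_pos d)]
  rfl

theorem natDegree_vecPoly_le {d : ℕ} (q : Fin (d + 1) → ℂ) : (vecPoly q).natDegree ≤ d := by
  rw [Polynomial.natDegree_le_iff_coeff_eq_zero]
  intro k hk
  rw [coeff_vecPoly, dif_neg (by omega)]

/-- Where the Hankel determinant does not vanish, numerator and denominator are coprime; hence the
roots of the denominator are poles. -/
theorem root_cramerCoeff {c : ℕ → ℂ → ℂ} {d : ℕ} {κ : Fin d → ℕ} (hκ : ∀ a, d ≤ κ a) {s : ℂ}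
    (hs : (hankelMatrix c κ s).det ≠ 0) {P : Polynomial ℂ} (hPd : P.natDegree ≤ d)
    (hP : (vecPoly (cramerCoeff c κ s) : PowerSeries ℂ) * PowerSeries.mk (fun k => c k s) =
      (P : PowerSeries ℂ)) {r : ℂ} (hr : (vecPoly (cramerCoeff c κ s)).eval r = 0) :
    P.eval r ≠ 0 := by
  intro hPr
  set Q := vecPoly (cramerCoeff c κ s) with hQ
  have hQ0 : Q ≠ 0 := by
    intro h
    have := eval_zero_vecPoly_cramerCoeff (c := c) κ s
    rw [← hQ, h] at this
    simp at this
  have hQd : Q.natDegree ≤ d := natDegree_vecPoly_le _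
  obtain ⟨Q₁, hQ₁⟩ := Polynomial.dvd_iff_isRoot.2 hr
  obtain ⟨P₁, hP₁⟩ := Polynomial.dvd_iff_isRoot.2 hPr
  have hX : (Polynomial.X - Polynomial.C r) ≠ 0 := Polynomial.X_sub_C_ne_zero r
  have hQ₁0 : Q₁ ≠ 0 := by rintro rfl; simp at hQ₁; exact hQ0 hQ₁
  have hQ₁d : Q₁.natDegree + 1 ≤ d := by
    rw [hQ₁, Polynomial.natDegree_mul hX hQ₁0, Polynomial.natDegree_X_sub_C] at hQd
    omega
  have hcancel : (Q₁ : PowerSeries ℂ) * PowerSeries.mk (fun k => c k s) = (P₁ : PowerSeries ℂ) := by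
    have hX' : ((Polynomial.X - Polynomial.C r : Polynomial ℂ) : PowerSeries ℂ) ≠ 0 := by
      rw [Ne, Polynomial.coe_eq_zero_iff]
      exact hX
    refine mul_left_cancel₀ hX' ?_
    rw [← mul_assoc, ← Polynomial.coe_mul, ← Polynomial.coe_mul, ← hQ₁, ← hP₁, hP]
  have hP₁c : ∀ k, d ≤ k → P₁.coeff k = 0 := by
    intro k hk
    by_cases hP0 : P₁ = 0
    · rw [hP0, Polynomial.coeff_zero]
    · refine Polynomial.coeff_eq_zero_of_natDegree_lt ?_
      rw [hP₁, Polynomial.natDegree_mul hX hP0, Polynomial.natDegree_X_sub_C] at hPd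
      omega
  have hvec : vecPoly (fun i : Fin d => Q₁.coeff i) = Q₁ := vecPoly_coeff fun k hk =>
    Polynomial.coeff_eq_zero_of_natDegree_lt (by omega)
  have h0 : (fun i : Fin d => Q₁.coeff i) = 0 := by
    refine Matrix.eq_zero_of_mulVec_eq_zero hs ?_
    funext a
    have h1 := coeff_vecPoly_mul (fun i : Fin d => Q₁.coeff i) (fun k => c k s)
      (k := κ a) ((hκ a).trans (Nat.le_succ _))
    rw [hvec, hcancel, Polynomial.coeff_coe, hP₁c _ (hκ a)] at h1
    simpa [Matrix.mulVec, dotProduct, hankelMatrix] using h1.symm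
  rw [h0] at hvec
  apply hQ₁0
  rw [← hvec]
  simp [vecPoly]

theorem eval_vecPoly {n : ℕ} (q : Fin n → ℂ) (u : ℂ) :
    (vecPoly q).eval u = ∑ i : Fin n, q i * u ^ (i : ℕ) := by
  simp [vecPoly, Polynomial.eval_finsetSum]

/-- Bounded functions of a parameter that are holomorphic off the zeros of a nonzero holomorphic
function extend holomorphically. -/
theorem exists_extension_of_bounded {g : ℂ → ℂ} (hg : DifferentiableOn ℂ g rightHalf)
    (hg0 : ∃ s ∈ rightHalf, g s ≠ 0) {f : ℂ → ℂ}
    (hf : DifferentiableOn ℂ f {s | s ∈ rightHalf ∧ g s ≠ 0}) {K : ℝ}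
    (hb : ∀ s ∈ rightHalf, g s ≠ 0 → ‖f s‖ ≤ K) :
    ∃ F : ℂ → ℂ, DifferentiableOn ℂ F rightHalf ∧ ∀ s ∈ rightHalf, g s ≠ 0 → F s = f s := by
  have hopen : IsOpen {s | s ∈ rightHalf ∧ g s ≠ 0} :=
    hg.continuousOn.isOpen_inter_preimage isOpen_rightHalf isOpen_ne
  have hagree : ∀ s ∈ rightHalf, g s ≠ 0 → limUnder (𝓝[≠] s) f = f s := by
    intro s hs hgs
    have := (hf.differentiableAt (hopen.mem_nhds ⟨hs, hgs⟩)).continuousAt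
    exact (this.tendsto.mono_left nhdsWithin_le_nhds).limUnder_eq
  refine ⟨fun s => limUnder (𝓝[≠] s) f, ?_, hagree⟩
  intro s₀ hs₀
  have hev : ∀ᶠ s in 𝓝[≠] s₀, g s ≠ 0 := by
    rcases (hg.analyticAt (isOpen_rightHalf.mem_nhds hs₀)).eventually_eq_zero_or_eventually_ne_zero
      with h | h
    · exfalso
      obtain ⟨s, hs, h1⟩ := hg0
      exact h1 ((hg.analyticOnNhd isOpen_rightHalf).eqOn_zero_of_preconnected_of_eventuallyEq_zero
        isPreconnected_rightHalf hs₀ h hs)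
    · exact h
  rw [eventually_nhdsWithin_iff] at hev
  obtain ⟨r, hr, hball⟩ := Metric.eventually_nhds_iff_ball.1
    (hev.and (isOpen_rightHalf.eventually_mem hs₀))
  have hsub : Metric.ball s₀ r \ {s₀} ⊆ {s | s ∈ rightHalf ∧ g s ≠ 0} := fun s hs =>
    ⟨(hball s hs.1).2, (hball s hs.1).1 hs.2⟩
  have h := Complex.differentiableOn_update_limUnder_of_bddAbove (f := f)
    (Metric.ball_mem_nhds s₀ hr) (hf.mono hsub) ⟨K, by
      rintro _ ⟨s, hs, rfl⟩
      exact hb s (hsub hs).1 (hsub hs).2⟩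
  refine DifferentiableAt.differentiableWithinAt ?_
  refine (h.differentiableAt (Metric.ball_mem_nhds s₀ hr)).congr_of_eventuallyEq ?_
  filter_upwards [Metric.ball_mem_nhds s₀ hr] with s hs
  by_cases h1 : s = s₀
  · subst h1
    simp
  · rw [Function.update_of_ne h1]
    exact hagree s (hsub ⟨hs, h1⟩).1 (hsub ⟨hs, h1⟩).2

/-- Closed conditions established where the Hankel determinant is nonzero pass to all parameters
through this density. -/
theorem rightHalf_subset_closure {g : ℂ → ℂ} (hg : DifferentiableOn ℂ g rightHalf)
    (hg0 : ∃ s ∈ rightHalf, g s ≠ 0) {s : ℂ} (hs : s ∈ rightHalf) :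
    ∃ᶠ w in 𝓝 s, w ∈ rightHalf ∧ g w ≠ 0 := by
  intro h
  obtain ⟨s₁, hs₁, h1⟩ := hg0
  refine h1 ((hg.analyticOnNhd isOpen_rightHalf).eqOn_zero_of_preconnected_of_eventuallyEq_zero
    isPreconnected_rightHalf hs ?_ hs₁)
  filter_upwards [h, isOpen_rightHalf.mem_nhds hs] with w hw hw'
  by_contra h2
  exact hw ⟨hw', h2⟩

/-- Holomorphic denominators of a holomorphic family of rational functions without poles in
`-δ < Re (1 + u)`. -/
theorem exists_bounded_denominator {c : ℕ → ℂ → ℂ} {H : ℂ → ℂ → ℂ} {δ : ℝ} (hδ : 0 < δ)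
    (hc : ∀ k, DifferentiableOn ℂ (c k) rightHalf) (hc1 : ∀ k, ∀ s ∈ rightHalf, ‖c k s‖ ≤ 1)
    (hsum : ∀ s ∈ rightHalf, ∀ u, ‖u‖ < 1 → HasSum (fun k => c k s * u ^ k) (H s u))
    (hH : ∀ s ∈ rightHalf, DifferentiableOn ℂ (H s) {u | -δ < (1 + u).re})
    (hrat : ∀ s ∈ rightHalf, ∃ P Q : Polynomial ℂ, Q ≠ 0 ∧
      (Q : PowerSeries ℂ) * PowerSeries.mk (fun k => c k s) = (P : PowerSeries ℂ)) :
    ∃ (d : ℕ) (q : Fin (d + 1) → ℂ → ℂ), (∀ i, DifferentiableOn ℂ (q i) rightHalf) ∧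
      (∀ s ∈ rightHalf, (vecPoly fun i => q i s).eval 0 = 1) ∧
      (∀ s ∈ rightHalf, ∀ r, (vecPoly fun i => q i s).eval r = 0 → (1 + r).re ≤ -δ) ∧
      ∀ s ∈ rightHalf, ∃ P : Polynomial ℂ, P.natDegree ≤ d ∧
        (∀ i, ‖P.coeff i‖ ≤ (d + 1) * 2 ^ d) ∧
        ((vecPoly fun i => q i s : Polynomial ℂ) : PowerSeries ℂ) *
          PowerSeries.mk (fun k => c k s) = (P : PowerSeries ℂ) := by
  obtain ⟨d, hzero, κ, hκ, hne⟩ := exists_hankel_rank hc hrat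
  set g : ℂ → ℂ := fun s => (hankelMatrix c κ s).det with hg
  have hgd : DifferentiableOn ℂ g rightHalf := differentiableOn_det fun a i => hc _
  have hUo : IsOpen {u : ℂ | -δ < (1 + u).re} := isOpen_lt continuous_const (by fun_prop)
  have hUc : IsPreconnected {u : ℂ | -δ < (1 + u).re} := by
    have : {u : ℂ | -δ < (1 + u).re} = {u : ℂ | -δ - 1 < u.re} := by
      ext u
      simp only [Set.mem_ofPred_eq, Complex.add_re, Complex.one_re]
      constructor <;> intro h <;> linarith
    rw [this]
    exact (convex_halfSpace_re_gt _).isPreconnected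
  -- The identity `Q H = P` near `u = 0` continues to the whole half-plane where `H` is holomorphic.
  -- A root of `Q` there would also be a root of `P`, against coprimality.
  have hroots : ∀ s ∈ rightHalf, g s ≠ 0 → ∀ r, (vecPoly (cramerCoeff c κ s)).eval r = 0 →
      (1 + r).re ≤ -δ := by
    intro s hs hgs r hr
    by_contra! hre
    have hP := exists_polynomial_of_coeff_zero (Q := vecPoly (cramerCoeff c κ s))
      (c := fun k => c k s) (n := d + 1)
      fun k hk => coeff_cramerCoeff hκ hgs (fun κ' h' => hzero κ' h' s hs) hk
    set P : Polynomial ℂ := PowerSeries.trunc (d + 1) ((vecPoly (cramerCoeff c κ s) :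
      PowerSeries ℂ) * PowerSeries.mk fun k => c k s) with hPdef
    have hPd : P.natDegree ≤ d := Nat.lt_succ_iff.1 (PowerSeries.natDegree_trunc_lt _ _)
    refine root_cramerCoeff hκ hgs hPd hP hr ?_
    have heq : Set.EqOn (fun u => (vecPoly (cramerCoeff c κ s)).eval u * H s u)
        (fun u => P.eval u) {u : ℂ | -δ < (1 + u).re} := by
      refine AnalyticOnNhd.eqOn_of_preconnected_of_eventuallyEq (𝕜 := ℂ) (z₀ := 0) ?_ ?_ hUc
        (by simpa using by linarith) ?_
      · exact (((Polynomial.differentiable _).differentiableOn).mul (hH s hs)).analyticOnNhd hUo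
      · exact ((Polynomial.differentiable _).differentiableOn).analyticOnNhd hUo
      · filter_upwards [Metric.ball_mem_nhds (0 : ℂ) one_pos] with u hu
        exact eval_eq_of_powerSeries_eq (hsum s hs u (by simpa using hu)) hP
    have := heq hre
    simp only [hr, zero_mul] at this
    exact this.symm
  have hcoef : ∀ i, ∀ s ∈ rightHalf, g s ≠ 0 → ‖cramerCoeff c κ s i‖ ≤ 2 ^ d := by
    intro i s hs hgs
    have h1 := norm_coeff_le_of_roots hδ.le (eval_zero_vecPoly_cramerCoeff κ s) (hroots s hs hgs) i
    rw [coeff_vecPoly, dif_pos i.2] at h1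
    exact h1.trans (pow_le_pow_right₀ one_le_two (natDegree_vecPoly_le _))
  -- The location of the roots bounds the Cramer coefficients by `2 ^ d`, so their singularities at
  -- the zeros of `g` are removable.
  choose q hqd hqe using fun i => exists_extension_of_bounded hgd hne
    (differentiableOn_cramerCoeff hc κ i) (hcoef i)
  have hqv : ∀ s ∈ rightHalf, g s ≠ 0 → (fun i => q i s) = cramerCoeff c κ s := by
    intro s hs hgs
    funext i
    exact hqe i s hs hgs
  have hcont : ∀ s ∈ rightHalf, ∀ i, ContinuousAt (q i) s := fun s hs i =>
    ((hqd i).differentiableAt (isOpen_rightHalf.mem_nhds hs)).continuousAt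
  have hccont : ∀ s ∈ rightHalf, ∀ k, ContinuousAt (c k) s := fun s hs k =>
    ((hc k).differentiableAt (isOpen_rightHalf.mem_nhds hs)).continuousAt
  have hdense : ∀ {s}, s ∈ rightHalf → ∃ᶠ w in 𝓝 s, w ∈ rightHalf ∧ g w ≠ 0 :=
    rightHalf_subset_closure hgd hne
  have hfreq : ∀ {s : ℂ} {f : ℂ → ℝ} {a : ℝ}, s ∈ rightHalf → ContinuousAt f s →
      (∀ w ∈ rightHalf, g w ≠ 0 → a ≤ f w) → a ≤ f s := by
    intro s f a hs hf h
    exact ge_of_tendsto_of_frequently hf.tendsto ((hdense hs).mono fun w hw => h w hw.1 hw.2)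
  have hq0 : ∀ s ∈ rightHalf, (vecPoly fun i => q i s).eval 0 = 1 := by
    intro s hs
    have h1 := hfreq (f := fun w => -‖(vecPoly fun i => q i w).eval 0 - 1‖) (a := 0) hs (by
      simp only [eval_vecPoly]
      have := hcont s hs
      fun_prop) fun w hw hgw => by
        rw [hqv w hw hgw, eval_zero_vecPoly_cramerCoeff]
        simp
    have h2 : ‖(vecPoly fun i => q i s).eval 0 - 1‖ ≤ 0 := by linarith
    exact sub_eq_zero.1 (norm_le_zero_iff.1 h2)
  refine ⟨d, q, hqd, hq0, ?_, ?_⟩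
  · intro s hs r hr
    by_contra! hre
    obtain ⟨δ₁, h1, h2⟩ := exists_between hre
    have hη : 0 < δ + δ₁ := by linarith
    -- The lower bound away from the roots depends only on `d`, `δ`, `δ₁` and `r`. It therefore
    -- survives the limit to a parameter where `g` vanishes and excludes a root there.
    have h3 := hfreq (f := fun w => ‖(vecPoly fun i => q i w).eval r‖)
      (a := ((δ + δ₁) / (δ + δ₁ + ‖r‖)) ^ d) hs (by
      simp only [eval_vecPoly]
      have := hcont s hs
      fun_prop) fun w hw hgw => by
        rw [hqv w hw hgw]
        have h4 := le_norm_eval_of_roots (δ₁ := -δ₁) (δ₀ := δ) (by linarith)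
          (eval_zero_vecPoly_cramerCoeff κ w) (hroots w hw hgw) (u := r) (by linarith)
        rw [sub_neg_eq_add] at h4
        refine le_trans (pow_le_pow_of_le_one (by positivity) ?_ (natDegree_vecPoly_le _)) h4
        exact div_le_one_of_le₀ (by linarith [norm_nonneg r]) (by positivity)
    simp only [hr, norm_zero] at h3
    have : 0 < ((δ + δ₁) / (δ + δ₁ + ‖r‖)) ^ d := by positivity
    linarith
  · intro s hs
    have hz : ∀ k, d + 1 ≤ k → PowerSeries.coeff k
        (((vecPoly fun i => q i s : Polynomial ℂ) : PowerSeries ℂ) *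
          PowerSeries.mk (fun k => c k s)) = 0 := by
      intro k hk
      rw [coeff_vecPoly_mul _ _ (by omega)]
      have h1 := hfreq (f := fun w => -‖∑ i : Fin (d + 1), c (k - i) w * q i w‖) (a := 0) hs (by
        have := hcont s hs
        have := hccont s hs
        fun_prop) fun w hw hgw => by
          have h5 := coeff_cramerCoeff hκ hgw (fun κ' h' => hzero κ' h' w hw) hk
          rw [coeff_vecPoly_mul _ _ (by omega), ← hqv w hw hgw] at h5
          rw [h5]
          simp
      exact norm_le_zero_iff.1 (by linarith)
    have hP := exists_polynomial_of_coeff_zero hz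
    have hqb : ∀ i, ‖(vecPoly fun i => q i s).coeff i‖ ≤ 2 ^ d := by
      intro i
      rw [coeff_vecPoly]
      split_ifs with hi
      · have h1 := hfreq (f := fun w => -‖q ⟨i, hi⟩ w‖) (a := -2 ^ d) hs (by
          have := hcont s hs
          fun_prop) fun w hw hgw => by
            rw [hqe _ w hw hgw]
            exact neg_le_neg (hcoef _ w hw hgw)
        linarith
      · rw [norm_zero]
        positivity
    refine ⟨_, Nat.lt_succ_iff.1 (PowerSeries.natDegree_trunc_lt _ _), ?_, hP⟩
    intro i
    rw [PowerSeries.coeff_trunc]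
    split_ifs with hi
    · rw [PowerSeries.coeff_mul]
      refine (norm_sum_le _ _).trans ?_
      refine (Finset.sum_le_card_nsmul _ _ (2 ^ d) ?_).trans ?_
      · rintro ⟨a, b⟩ -
        rw [norm_mul, Polynomial.coeff_coe, PowerSeries.coeff_mk]
        calc _ ≤ 2 ^ d * (1 : ℝ) := mul_le_mul (hqb a) (hc1 b s hs) (norm_nonneg _) (by positivity)
          _ = 2 ^ d := mul_one _
      · rw [Finset.Nat.card_antidiagonal, nsmul_eq_mul]
        refine mul_le_mul_of_nonneg_right ?_ (by positivity)
        exact_mod_cast hi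
    · rw [norm_zero]
      positivity

/-! ### The denominators on the antidiagonal. -/

theorem eval_derivative_vecPoly {n : ℕ} (q : Fin n → ℂ) (u : ℂ) :
    (vecPoly q).derivative.eval u = ∑ i : Fin n, q i * ((i : ℕ) * u ^ ((i : ℕ) - 1)) := by
  simp [vecPoly, Polynomial.eval_finsetSum, Polynomial.derivative_X_pow]

/-- For `0 < Re s < δ` the whole segment from `0` to `-1 - s` stays to the right of the roots. The
integrand is then a quotient holomorphic in `s`, locally bounded uniformly along the segment. -/
theorem differentiableOn_polyLog {d : ℕ} {q : Fin (d + 1) → ℂ → ℂ} {δ : ℝ}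
    (hq : ∀ i, DifferentiableOn ℂ (q i) rightHalf)
    (hroots : ∀ s ∈ rightHalf, ∀ r, (vecPoly fun i => q i s).eval r = 0 → (1 + r).re ≤ -δ) :
    DifferentiableOn ℂ (fun s => polyLog (vecPoly fun i => q i s) (-1 - s))
      {s | 0 < s.re ∧ s.re < δ} := by
  set U : Set ℂ := {s | 0 < s.re ∧ s.re < δ} with hU
  have hUo : IsOpen U := (isOpen_lt continuous_const Complex.continuous_re).inter
    (isOpen_lt Complex.continuous_re continuous_const)
  have hUr : U ⊆ rightHalf := fun s hs => hs.1
  set f : ℂ → ℝ → ℂ := fun s τ => (-1 - s) *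
    (∑ i : Fin (d + 1), q i s * ((i : ℕ) * (τ * (-1 - s)) ^ ((i : ℕ) - 1))) /
    (∑ i : Fin (d + 1), q i s * (τ * (-1 - s)) ^ (i : ℕ)) with hf
  have hne : ∀ s ∈ U, ∀ τ ∈ Set.Icc (0 : ℝ) 1,
      (∑ i : Fin (d + 1), q i s * (τ * (-1 - s)) ^ (i : ℕ)) ≠ 0 := by
    intro s hs τ hτ h0
    rw [← eval_vecPoly (fun i => q i s)] at h0
    have := hroots s (hUr hs) _ h0
    simp only [Complex.add_re, Complex.one_re, Complex.mul_re, Complex.ofReal_re,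
      Complex.ofReal_im, zero_mul, sub_zero, Complex.sub_re, Complex.neg_re] at this
    nlinarith [hs.1, hs.2, hτ.1, hτ.2, mul_nonneg (sub_nonneg.2 hτ.2) hs.1.le]
  have hjoint : ContinuousOn (fun p : ℂ × ℝ => f p.1 p.2) (U ×ˢ Set.Icc (0 : ℝ) 1) := by
    have hqc : ∀ i, ContinuousOn (fun p : ℂ × ℝ => q i p.1) (U ×ˢ Set.Icc (0 : ℝ) 1) := fun i =>
      ((hq i).continuousOn.mono hUr).comp continuousOn_fst fun p hp => hp.1
    refine ContinuousOn.div ?_ ?_ fun p hp => hne p.1 hp.1 p.2 hp.2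
    · refine ContinuousOn.mul (by fun_prop) (continuousOn_finsetSum _ fun i _ => ?_)
      exact (hqc i).mul (by fun_prop)
    · refine continuousOn_finsetSum _ fun i _ => ?_
      exact (hqc i).mul (by fun_prop)
  have heq : ∀ s, polyLog (vecPoly fun i => q i s) (-1 - s) =
      ∫ τ, f s τ ∂(volume.restrict (Set.Ioc (0 : ℝ) 1)) := by
    intro s
    rw [polyLog, intervalIntegral.integral_of_le zero_le_one]
    simp only [eval_vecPoly, eval_derivative_vecPoly, hf]
  simp only [heq]
  refine differentiableOn_integral hUo ?_ ?_ ?_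
  · intro s hs
    refine ContinuousOn.aestronglyMeasurable ?_ measurableSet_Ioc
    exact hjoint.comp (f := fun τ : ℝ => (s, τ)) (by fun_prop)
      fun τ hτ => ⟨hs, Set.Ioc_subset_Icc_self hτ⟩
  · refine (ae_restrict_iff' measurableSet_Ioc).2 (Eventually.of_forall fun τ hτ => ?_)
    have := fun i => (hq i).mono hUr
    refine DifferentiableOn.fun_div ?_ ?_ fun s hs => hne s hs τ (Set.Ioc_subset_Icc_self hτ)
    · fun_prop
    · fun_prop
  · intro s₀ hs₀
    obtain ⟨r, hr, hrU⟩ := Metric.nhds_basis_closedBall.mem_iff.1 (hUo.mem_nhds hs₀)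
    obtain ⟨K, hK⟩ := ((isCompact_closedBall s₀ r).prod
      (isCompact_Icc (a := (0 : ℝ)) (b := 1))).exists_bound_of_continuousOn
      (hjoint.mono (Set.prod_mono hrU subset_rfl))
    refine ⟨r, hr, fun _ => K, integrable_const K, ?_⟩
    refine (ae_restrict_iff' measurableSet_Ioc).2 (Eventually.of_forall fun τ hτ s hs _ => ?_)
    exact hK (s, τ) ⟨Metric.ball_subset_closedBall hs, Set.Ioc_subset_Icc_self hτ⟩

/-- The denominator on the antidiagonal `u = -1 - s` is a polynomial up to a factor of polynomial
growth. -/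
theorem exists_polynomial_factor {d : ℕ} {q : Fin (d + 1) → ℂ → ℂ} {δ : ℝ}
    (hq : ∀ i, DifferentiableOn ℂ (q i) rightHalf)
    (hq0 : ∀ s ∈ rightHalf, (vecPoly fun i => q i s).eval 0 = 1)
    (hroots : ∀ s ∈ rightHalf, ∀ r, (vecPoly fun i => q i s).eval r = 0 → (1 + r).re ≤ -δ)
    {ε : ℝ} (hε : 0 < ε) (hεδ : ε < δ) :
    ∃ (W : Polynomial ℂ) (E : ℂ → ℂ) (K : ℝ) (m : ℕ), W ≠ 0 ∧ ∀ s : ℂ, ε ≤ s.re →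
      W.eval s = (vecPoly fun i => q i s).eval (-1 - s) * E s ∧ ‖E s‖ ≤ K * (1 + ‖s‖) ^ m := by
  -- The strip of half-width `η` about `Re = ε` has to lie within `0 < Re < δ`, where the logarithm
  -- exists.
  obtain ⟨η, hη, hη'⟩ := exists_between (lt_min hε (sub_pos.2 hεδ))
  have h1 : η < ε := hη'.trans_le (min_le_left _ _)
  have h2 : η < δ - ε := hη'.trans_le (min_le_right _ _)
  have hδ : 0 < δ := hε.trans hεδ
  refine factor_of_bounded_arg (D := fun s => (vecPoly fun i => q i s).eval (-1 - s))
    (L := fun s => polyLog (vecPoly fun i => q i s) (-1 - s)) (C := 2 ^ d) (d := d)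
    (C₀ := d * Real.pi) hη ?_ ?_ ?_ ?_ ?_
  · have hsub : {s : ℂ | ε - η < s.re} ⊆ rightHalf := fun s (hs : ε - η < s.re) =>
      (by linarith : 0 < s.re)
    have := fun i => (hq i).mono hsub
    simp only [eval_vecPoly]
    fun_prop
  · intro s hs
    have hs' : s ∈ rightHalf := by
      have : 0 < s.re := by linarith
      exact this
    refine (norm_eval_le_of_roots hδ.le (hq0 s hs') (hroots s hs') _).trans ?_
    have h3 : 1 + ‖-1 - s‖ ≤ 2 * (1 + ‖s‖) := by
      have := norm_sub_le (-1 : ℂ) s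
      rw [norm_neg, norm_one] at this
      linarith [norm_nonneg s]
    calc _ ≤ (1 + ‖-1 - s‖) ^ d :=
          pow_le_pow_right₀ (by linarith [norm_nonneg (-1 - s)]) (natDegree_vecPoly_le _)
      _ ≤ (2 * (1 + ‖s‖)) ^ d := pow_le_pow_left₀ (by positivity) h3 d
      _ = _ := mul_pow _ _ _
  · refine (differentiableOn_polyLog hq hroots).mono fun s hs => ⟨?_, ?_⟩
    · linarith [hs.1]
    · linarith [hs.2]
  · intro s hs hs1
    refine (polyLog_spec hδ.le (hq0 s (?_ : 0 < s.re)) (hroots s (?_ : 0 < s.re)) ?_).1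
    · linarith
    · linarith
    · simp
      linarith
  · intro s hs hs1
    refine (polyLog_spec hδ.le (hq0 s (?_ : 0 < s.re)) (hroots s (?_ : 0 < s.re)) ?_).2.trans ?_
    · linarith
    · linarith
    · simp
      linarith
    · gcongr
      exact natDegree_vecPoly_le _

/-! ### Rational transforms, Taylor coefficients and exponential moments. -/

theorem hasSum_of_eq {E : Type*} [AddCommMonoid E] [TopologicalSpace E] {f g : ℕ → E} {a : E}
    (h : HasSum g a) (e : ∀ k, f k = g k) : HasSum f a := by
  rwa [funext e]

/-- In lowest terms a rational function bounded on a closed half-plane has no poles there. As the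
poles are finitely many, a gap remains beyond the boundary, and the Taylor series converges on a
disc of radius larger than `1`. -/
theorem exists_summable_beyond {c : ℕ → ℂ} {H : ℂ → ℂ}
    (hsum : ∀ u : ℂ, ‖u‖ < 1 → HasSum (fun k => c k * u ^ k) (H u))
    (hb : ∀ u : ℂ, 0 ≤ (1 + u).re → ‖H u‖ ≤ 1) {P Q : Polynomial ℂ} (hQ : Q ≠ 0)
    (hQP : ∀ u : ℂ, 0 ≤ (1 + u).re → Q.eval u * H u = P.eval u) :
    ∃ δ : ℝ, 0 < δ ∧ Summable fun k => c k * (-(1 + δ : ℂ)) ^ k := by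
  classical
  have hball : ∀ u : ℂ, ‖u‖ < 1 → 0 ≤ (1 + u).re := by
    intro u hu
    have := neg_abs_le u.re
    have := Complex.abs_re_le_norm u
    simp
    linarith
  obtain ⟨g, hg0, a, b, hab, hPa, hQb⟩ : ∃ g : Polynomial ℂ, g ≠ 0 ∧ ∃ a b : Polynomial ℂ,
      IsCoprime a b ∧ P = g * a ∧ Q = g * b := by
    let := EuclideanDomain.gcdMonoid (Polynomial ℂ)
    have hg : gcd P Q ≠ 0 := fun h => hQ ((gcd_eq_zero_iff P Q).1 h).2
    exact ⟨gcd P Q, hg, P / gcd P Q, Q / gcd P Q, isCoprime_div_gcd_div_gcd hQ,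
      (EuclideanDomain.mul_div_cancel' hg (gcd_dvd_left P Q)).symm,
      (EuclideanDomain.mul_div_cancel' hg (gcd_dvd_right P Q)).symm⟩
  have hb0 : b ≠ 0 := by rintro rfl; simp at hQb; exact hQ hQb
  have hroot : ∀ r, b.eval r = 0 → (1 + r).re < 0 := by
    intro r hr
    by_contra! hre
    -- The bound `|H| ≤ 1` gives `|a| ≤ |b|` only off the zeros of the common factor. Moving right
    -- from `r` avoids them and stays in the half-plane. In the limit `a` vanishes at the root `r`
    -- of `b`, against coprimality.
    have hev : ∀ᶠ t : ℝ in 𝓝[>] 0, ‖a.eval (r + t)‖ ≤ ‖b.eval (r + t)‖ := by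
      have hfin : {t : ℝ | g.eval (r + t) = 0}.Finite := by
        refine ((g.roots.toFinset : Set ℂ).toFinite.preimage
          (f := fun t : ℝ => r + (t : ℂ)) ?_).subset ?_
        · intro x _ y _ hxy
          simpa using hxy
        · intro t ht
          simpa [hg0] using ht
      have h1 : ∀ᶠ t : ℝ in 𝓝 0, t ∉ {t : ℝ | g.eval (r + t) = 0} \ {0} :=
        (hfin.sdiff (t := {0})).isClosed.isOpen_compl.mem_nhds (by simp)
      filter_upwards [nhdsWithin_le_nhds h1, self_mem_nhdsWithin] with t ht ht0
      rw [Set.mem_Ioi] at ht0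
      have hg : g.eval (r + t) ≠ 0 := fun h => ht ⟨h, ht0.ne'⟩
      have hre' : 0 ≤ (1 + (r + t) : ℂ).re := by
        simp at hre ⊢
        linarith
      have h2 := hQP (r + t) hre'
      rw [hPa, hQb, Polynomial.eval_mul, Polynomial.eval_mul, mul_assoc] at h2
      rw [← mul_left_cancel₀ hg h2, norm_mul]
      exact mul_le_of_le_one_right (norm_nonneg _) (hb _ hre')
    have hta : Tendsto (fun t : ℝ => ‖a.eval (r + t)‖) (𝓝[>] 0) (𝓝 ‖a.eval r‖) := by
      have : Continuous fun t : ℝ => ‖a.eval (r + t)‖ := by fun_prop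
      simpa using (this.tendsto 0).mono_left nhdsWithin_le_nhds
    have htb : Tendsto (fun t : ℝ => ‖b.eval (r + t)‖) (𝓝[>] 0) (𝓝 ‖b.eval r‖) := by
      have : Continuous fun t : ℝ => ‖b.eval (r + t)‖ := by fun_prop
      simpa using (this.tendsto 0).mono_left nhdsWithin_le_nhds
    have hle := le_of_tendsto_of_tendsto hta htb hev
    rw [hr, norm_zero, norm_le_zero_iff] at hle
    obtain ⟨x, y, hxy⟩ := hab
    have := congrArg (Polynomial.eval r) hxy
    simp [hle, hr] at this
  -- The factor `2` leaves room for the point `-(1 + δ)` strictly inside the disc of radius `1 + 2 *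
  -- δ`.
  obtain ⟨δ, hδ, hδr⟩ : ∃ δ : ℝ, 0 < δ ∧ ∀ r ∈ b.roots.toFinset, (1 + r).re < -(2 * δ) := by
    have h1 : ∀ᶠ δ : ℝ in 𝓝[>] 0, ∀ r ∈ b.roots.toFinset, (1 + r).re < -(2 * δ) := by
      refine (Finset.eventually_all _).2 fun r hr => ?_
      have h2 : (1 + r).re < -(2 * (0 : ℝ)) := by
        rw [mul_zero, neg_zero]
        refine hroot r ?_
        simpa [hb0] using hr
      have h3 : Continuous fun δ : ℝ => -(2 * δ) := by fun_prop
      exact nhdsWithin_le_nhds (h3.tendsto 0 (lt_mem_nhds h2))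
    obtain ⟨δ, h2, h3⟩ := (h1.and self_mem_nhdsWithin).exists
    exact ⟨δ, h3, h2⟩
  have hps : (b : PowerSeries ℂ) * PowerSeries.mk c = (a : PowerSeries ℂ) := by
    have h1 := powerSeries_eq_of_eval_eq hsum fun u hu => hQP u (hball u hu)
    rw [hPa, hQb, Polynomial.coe_mul, Polynomial.coe_mul, mul_assoc] at h1
    refine mul_left_cancel₀ ?_ h1
    rw [Ne, Polynomial.coe_eq_zero_iff]
    exact hg0
  have hbne : ∀ u ∈ Metric.ball (0 : ℂ) (1 + 2 * δ), b.eval u ≠ 0 := by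
    intro u hu h0
    have h1 := hδr u (by simpa [hb0] using h0)
    have h2 := neg_abs_le u.re
    have h3 := Complex.abs_re_le_norm u
    simp at h1 hu
    linarith
  have hG : DifferentiableOn ℂ (fun u => a.eval u / b.eval u) (Metric.ball (0 : ℂ) (1 + 2 * δ)) :=
    (Polynomial.differentiable _).differentiableOn.div
      (Polynomial.differentiable _).differentiableOn hbne
  have hT := fun u (hu : u ∈ Metric.ball (0 : ℂ) (1 + 2 * δ)) =>
    Complex.hasSum_taylorSeries_on_ball hG hu
  simp only [sub_zero, smul_eq_mul] at hT
  have hc : c = fun k : ℕ => ((Nat.factorial k : ℂ)⁻¹ *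
      iteratedDeriv k (fun u => a.eval u / b.eval u) 0) := by
    refine coeff_eq_of_hasSum hsum fun u hu => ?_
    have hu' : u ∈ Metric.ball (0 : ℂ) (1 + 2 * δ) := by
      simp only [Metric.mem_ball, dist_zero_right]
      linarith
    have h1 : H u = a.eval u / b.eval u := by
      rw [eq_div_iff (hbne u hu'), mul_comm]
      exact eval_eq_of_powerSeries_eq (hsum u hu) hps
    rw [h1]
    exact hasSum_of_eq (hT u hu') fun k => by ring
  refine ⟨δ, hδ, ?_⟩
  have hu' : (-(1 + δ : ℂ)) ∈ Metric.ball (0 : ℂ) (1 + 2 * δ) := by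
    have h1 : ‖(1 + δ : ℂ)‖ = 1 + δ := by
      have : (1 + δ : ℂ) = ((1 + δ : ℝ) : ℂ) := by push_cast; rfl
      rw [this, Complex.norm_real, Real.norm_of_nonneg (by linarith)]
    rw [Metric.mem_ball, dist_zero_right, norm_neg, h1]
    linarith
  rw [hc]
  exact (hT _ hu').summable.congr fun k => by ring

/-- Taylor coefficients of the transform at `s₁ = 1`. -/
def lstCoeff {Ω : Type*} [MeasurableSpace Ω] (P : Measure Ω) (B A : Ω → ℝ) (k : ℕ) (s : ℂ) : ℂ :=
  ∫ ω, (-(B ω : ℂ)) ^ k / (k.factorial : ℂ) * Complex.exp (-(B ω : ℂ) - s * (A ω : ℂ)) ∂P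

section Transform

variable {Ω : Type*} [MeasurableSpace Ω] {P : Measure Ω} [IsProbabilityMeasure P] {B A : Ω → ℝ}

/-- The factor `exp (-b)` absorbs `b ^ k / k! ≤ exp b`. Expanding at `s₁ = 1` rather than at `0`
thus gives bounded coefficients without moment assumptions. -/
theorem norm_lstCoeff_integrand_le {b a : ℝ} (hb : 0 ≤ b) (ha : 0 ≤ a) (k : ℕ) {s : ℂ}
    (hs : 0 ≤ s.re) :
    ‖(-(b : ℂ)) ^ k / (k.factorial : ℂ) * Complex.exp (-(b : ℂ) - s * (a : ℂ))‖ ≤ 1 := by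
  rw [norm_mul, norm_div, norm_pow, norm_neg, Complex.norm_real, Real.norm_of_nonneg hb,
    Complex.norm_exp, Complex.norm_natCast]
  have h1 : (-(b : ℂ) - s * (a : ℂ)).re ≤ -b := by
    simp
    positivity
  calc b ^ k / k.factorial * Real.exp (-(b : ℂ) - s * (a : ℂ)).re
      ≤ Real.exp b * Real.exp (-b) := mul_le_mul (Real.pow_div_factorial_le_exp b hb k)
        (Real.exp_le_exp.2 h1) (Real.exp_nonneg _) (Real.exp_nonneg _)
    _ = 1 := by rw [← Real.exp_add, add_neg_cancel, Real.exp_zero]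

theorem measurable_lstCoeff_integrand (hB : Measurable B) (hA : Measurable A) (k : ℕ) (s : ℂ) :
    Measurable fun ω => (-(B ω : ℂ)) ^ k / (k.factorial : ℂ) *
      Complex.exp (-(B ω : ℂ) - s * (A ω : ℂ)) := by
  fun_prop

theorem integrable_lstCoeff_integrand (hB : Measurable B) (hA : Measurable A)
    (hnn : ∀ᵐ ω ∂P, 0 ≤ B ω ∧ 0 ≤ A ω) (k : ℕ) {s : ℂ} (hs : 0 ≤ s.re) :
    Integrable (fun ω => (-(B ω : ℂ)) ^ k / (k.factorial : ℂ) *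
      Complex.exp (-(B ω : ℂ) - s * (A ω : ℂ))) P :=
  Integrable.of_bound (measurable_lstCoeff_integrand hB hA k s).aestronglyMeasurable 1
    (hnn.mono fun _ h => norm_lstCoeff_integrand_le h.1 h.2 k hs)

theorem norm_lstCoeff_le (hnn : ∀ᵐ ω ∂P, 0 ≤ B ω ∧ 0 ≤ A ω) (k : ℕ) {s : ℂ} (hs : 0 ≤ s.re) :
    ‖lstCoeff P B A k s‖ ≤ 1 := by
  have := norm_integral_le_of_norm_le_const (μ := P) (hnn.mono fun _ h =>
    norm_lstCoeff_integrand_le h.1 h.2 k hs)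
  rwa [probReal_univ, mul_one] at this

theorem differentiableOn_lstCoeff (hB : Measurable B) (hA : Measurable A)
    (hnn : ∀ᵐ ω ∂P, 0 ≤ B ω ∧ 0 ≤ A ω) (k : ℕ) :
    DifferentiableOn ℂ (lstCoeff P B A k) rightHalf := by
  refine differentiableOn_integral isOpen_rightHalf
    (fun s _ => (measurable_lstCoeff_integrand hB hA k s).aestronglyMeasurable)
    (Eventually.of_forall fun ω => by fun_prop) fun s₀ _ => ⟨1, one_pos, fun _ => 1,
      integrable_const _, hnn.mono fun ω h s _ hs => norm_lstCoeff_integrand_le h.1 h.2 k hs.le⟩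

theorem hasSum_lstCoeff (hB : Measurable B) (hA : Measurable A)
    (hnn : ∀ᵐ ω ∂P, 0 ≤ B ω ∧ 0 ≤ A ω) {s : ℂ} (hs : 0 ≤ s.re) {u : ℂ} (hu : ‖u‖ < 1) :
    HasSum (fun k => lstCoeff P B A k s * u ^ k) (jointLST P B A (1 + u) s) := by
  have h := hasSum_integral_of_summable_integral_norm (μ := P)
    (F := fun k ω => (-(B ω : ℂ)) ^ k / (k.factorial : ℂ) *
      Complex.exp (-(B ω : ℂ) - s * (A ω : ℂ)) * u ^ k)
    (fun k => (integrable_lstCoeff_integrand hB hA hnn k hs).mul_const _) (by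
      refine Summable.of_nonneg_of_le (fun k => integral_nonneg fun _ => norm_nonneg _)
        (fun k => ?_) (summable_geometric_of_lt_one (norm_nonneg u) hu)
      refine (integral_mono_of_nonneg (Eventually.of_forall fun _ => norm_nonneg _)
        (integrable_const (‖u‖ ^ k)) ?_).trans (by simp)
      filter_upwards [hnn] with ω hω
      rw [norm_mul, norm_pow]
      exact mul_le_of_le_one_left (by positivity) (norm_lstCoeff_integrand_le hω.1 hω.2 k hs))
  simp only [integral_mul_const] at h
  suffices hint : jointLST P B A (1 + u) s = ∫ ω, ∑' k : ℕ, (-(B ω : ℂ)) ^ k / (k.factorial : ℂ) *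
      Complex.exp (-(B ω : ℂ) - s * (A ω : ℂ)) * u ^ k ∂P by
    rw [hint]
    exact h
  refine integral_congr_ae (Eventually.of_forall fun ω => ?_)
  have h1 : -(1 + u) * (B ω : ℂ) - s * (A ω : ℂ) =
      (-(B ω : ℂ) * u) + (-(B ω : ℂ) - s * (A ω : ℂ)) := by ring
  simp only [h1, Complex.exp_add]
  rw [Complex.exp_eq_exp_ℂ, ← (NormedSpace.expSeries_div_hasSum_exp (-(B ω : ℂ) * u)).tsum_eq,
    ← tsum_mul_right]
  refine tsum_congr fun k => ?_
  rw [mul_pow]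
  ring

theorem norm_jointLST_le (hnn : ∀ᵐ ω ∂P, 0 ≤ B ω ∧ 0 ≤ A ω) {s₁ s₂ : ℂ} (hs₁ : 0 ≤ s₁.re)
    (hs₂ : 0 ≤ s₂.re) : ‖jointLST P B A s₁ s₂‖ ≤ 1 := by
  have := norm_integral_le_of_norm_le_const (μ := P) (C := 1)
    (f := fun ω => Complex.exp (-s₁ * (B ω : ℂ) - s₂ * (A ω : ℂ))) (hnn.mono fun ω h => by
      rw [Complex.norm_exp, Real.exp_le_one_iff]
      simp
      nlinarith [mul_nonneg hs₁ h.1, mul_nonneg hs₂ h.2])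
  rwa [probReal_univ, mul_one] at this

/-- A transform which is rational in `s₁` at `s₂ = 0` has an exponential moment. -/
theorem exists_integrable_exp (hB : Measurable B) (hA : Measurable A)
    (hnn : ∀ᵐ ω ∂P, 0 ≤ B ω ∧ 0 ≤ A ω) {p₁ p₂ : Polynomial ℂ} (hp₂ : p₂ ≠ 0)
    (hrat : ∀ s₁ : ℂ, 0 ≤ s₁.re → jointLST P B A s₁ 0 * p₂.eval s₁ = p₁.eval s₁) :
    ∃ δ : ℝ, 0 < δ ∧ Integrable (fun ω => Real.exp (δ * B ω)) P := by
  have h0 : (0 : ℝ) ≤ (0 : ℂ).re := le_rfl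
  obtain ⟨δ, hδ, hsm⟩ := exists_summable_beyond (c := fun k => lstCoeff P B A k 0)
    (H := fun u => jointLST P B A (1 + u) 0)
    (P := p₁.comp (1 + Polynomial.X)) (Q := p₂.comp (1 + Polynomial.X))
    (fun u hu => hasSum_lstCoeff hB hA hnn h0 hu)
    (fun u hu => norm_jointLST_le hnn hu h0) (by
      intro h
      have h1 : p₂ = (p₂.comp (1 + Polynomial.X)).comp (Polynomial.X - 1) := by
        rw [Polynomial.comp_assoc]
        simp
      rw [h, Polynomial.zero_comp] at h1
      exact hp₂ h1)
    (fun u hu => by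
      simp only [Polynomial.eval_comp, Polynomial.eval_add, Polynomial.eval_one,
        Polynomial.eval_X]
      rw [mul_comm]
      exact hrat _ hu)
  refine ⟨δ, hδ, (by fun_prop : Measurable _).aestronglyMeasurable, ?_⟩
  -- At `u = -(1 + δ)` the signs cancel and every Taylor term is the mean of a nonnegative variable.
  -- By Tonelli the convergent series is the mean of `exp (δ |B|)`. The absolute values keep the
  -- terms nonnegative for every `ω`.
  set T : ℕ → Ω → ℝ := fun k ω => |B ω| ^ k / k.factorial * Real.exp (-|B ω|) * (1 + δ) ^ k with hT
  have hTint : ∀ k, Integrable (T k) P ∧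
      ((∫ ω, T k ω ∂P : ℝ) : ℂ) = lstCoeff P B A k 0 * (-(1 + δ : ℂ)) ^ k := by
    intro k
    have h1 := (integrable_lstCoeff_integrand hB hA hnn k h0).mul_const ((-(1 + δ : ℂ)) ^ k)
    have h2 : (fun ω => ((T k ω : ℝ) : ℂ)) =ᵐ[P] fun ω =>
        (-(B ω : ℂ)) ^ k / (k.factorial : ℂ) *
          Complex.exp (-(B ω : ℂ) - 0 * (A ω : ℂ)) * (-(1 + δ : ℂ)) ^ k := by
      filter_upwards [hnn] with ω hω
      simp only [hT, abs_of_nonneg hω.1]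
      push_cast
      have h3 : (-(1 + δ : ℂ)) ^ k = (-1) ^ k * (1 + δ : ℂ) ^ k := neg_pow _ _
      have h4 : (-(B ω : ℂ)) ^ k = (-1) ^ k * (B ω : ℂ) ^ k := neg_pow _ _
      have h5 : ((-1 : ℂ) ^ k) * (-1) ^ k = 1 := by rw [← mul_pow]; simp
      rw [h3, h4, zero_mul, sub_zero]
      linear_combination (-(B ω : ℂ) ^ k / (k.factorial : ℂ) * Complex.exp (-(B ω : ℂ)) *
        (1 + δ : ℂ) ^ k) * h5
    refine ⟨?_, ?_⟩
    · have := (h1.congr h2.symm).re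
      simpa using this
    · rw [lstCoeff, ← integral_mul_const, ← integral_complex_ofReal]
      exact integral_congr_ae h2
  have hsum : Summable fun k => ∫ ω, T k ω ∂P := by
    rw [← Complex.summable_ofReal]
    refine hsm.congr fun k => (hTint k).2.symm
  have hTnn : ∀ k ω, 0 ≤ T k ω := fun k ω => by positivity
  have hlin : ∫⁻ ω, ENNReal.ofReal (Real.exp (δ * |B ω|)) ∂P = ∑' k, ENNReal.ofReal (∫ ω, T k ω ∂P) := by
    have h1 : ∀ ω, ENNReal.ofReal (Real.exp (δ * |B ω|)) = ∑' k, ENNReal.ofReal (T k ω) := by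
      intro ω
      have h2 : HasSum (fun k => T k ω) (Real.exp (δ * |B ω|)) := by
        have h3 := (NormedSpace.expSeries_div_hasSum_exp (|B ω| * (1 + δ))).mul_right
          (Real.exp (-|B ω|))
        rw [← Real.exp_eq_exp_ℝ, ← Real.exp_add] at h3
        have h4 : |B ω| * (1 + δ) + -|B ω| = δ * |B ω| := by ring
        rw [h4] at h3
        refine hasSum_of_eq h3 fun k => ?_
        simp only [hT, mul_pow]
        ring
      rw [← h2.tsum_eq, ENNReal.ofReal_tsum_of_nonneg (fun k => hTnn k ω) h2.summable]
    simp only [h1]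
    rw [lintegral_tsum fun k => (by simp only [hT]; fun_prop)]
    exact tsum_congr fun k => (ofReal_integral_eq_lintegral_ofReal (hTint k).1
      (Eventually.of_forall (hTnn k))).symm
  have hfin : ∫⁻ ω, ENNReal.ofReal (Real.exp (δ * |B ω|)) ∂P < ⊤ := by
    rw [hlin, ← ENNReal.ofReal_tsum_of_nonneg (fun k => integral_nonneg (hTnn k)) hsum]
    exact ENNReal.ofReal_lt_top
  rw [hasFiniteIntegral_iff_ofReal (Eventually.of_forall fun _ => (Real.exp_pos _).le)]
  refine lt_of_le_of_lt (lintegral_mono fun ω => ENNReal.ofReal_le_ofReal ?_) hfin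
  exact Real.exp_le_exp.2 (mul_le_mul_of_nonneg_left (le_abs_self _) hδ.le)

end Transform

/-! ### Zeros in the left half-plane and the growth of the numerator. -/

/-- The open left half-plane. -/
def leftHalf : Set ℂ := {s | s.re < 0}

theorem isOpen_leftHalf : IsOpen leftHalf := isOpen_lt Complex.continuous_re continuous_const

/-- Induction on a finite set containing the zeros, with `f` varying: one point is divided out to
its full order, which is finite because the zeros do not accumulate. -/
theorem exists_factor_of_finite_zeros (S : Finset ℂ) : ∀ {f : ℂ → ℂ},
    DifferentiableOn ℂ f leftHalf → (∀ w ∈ leftHalf, f w = 0 → w ∈ S) →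
    ∃ (t : Multiset ℂ) (g : ℂ → ℂ), (∀ a ∈ t, a ∈ leftHalf) ∧ DifferentiableOn ℂ g leftHalf ∧
      (∀ w ∈ leftHalf, g w ≠ 0) ∧ ∀ w ∈ leftHalf, f w = (t.map fun a => w - a).prod * g w := by
  classical
  induction S using Finset.induction_on with
  | empty =>
    intro f hf h0
    exact ⟨0, f, by simp, hf, fun w hw h => by simpa using h0 w hw h, fun w _ => by simp⟩
  | insert a S ha ih =>
    intro f hf h0
    by_cases haL : a ∈ leftHalf
    swap
    · exact ih hf fun w hw h => (Finset.mem_insert.1 (h0 w hw h)).resolve_left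
        fun h => haL (h ▸ hw)
    have han := hf.analyticAt (isOpen_leftHalf.mem_nhds haL)
    have htop : analyticOrderAt f a ≠ ⊤ := by
      intro htop
      rw [analyticOrderAt_eq_top] at htop
      have h1 : ∀ᶠ z in 𝓝 a, z ∈ (insert a S : Finset ℂ) := by
        filter_upwards [htop, isOpen_leftHalf.mem_nhds haL] with z hz hzL using h0 z hzL hz
      have h2 : ((insert a S : Finset ℂ) : Set ℂ).Infinite := infinite_of_mem_nhds a h1
      exact h2 (Finset.finite_toSet _)
    obtain ⟨m, hm⟩ := ENat.ne_top_iff_exists.1 htop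
    obtain ⟨g₀, hg₀, hg₀a, hfg⟩ := (han.analyticOrderAt_eq_natCast (n := m)).1 hm.symm
    set G : ℂ → ℂ := Function.update (fun w => f w / (w - a) ^ m) a (g₀ a) with hG
    have hGne : ∀ w, w ≠ a → G w = f w / (w - a) ^ m := fun w hw => by
      rw [hG, Function.update_of_ne hw]
    have hGa : G =ᶠ[𝓝 a] g₀ := by
      filter_upwards [hfg] with w hw
      by_cases hwa : w = a
      · rw [hwa, hG, Function.update_self]
      · rw [hGne w hwa, hw, smul_eq_mul, mul_div_cancel_left₀]
        exact pow_ne_zero _ (sub_ne_zero.2 hwa)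
    have hGd : DifferentiableOn ℂ G leftHalf := by
      intro w hw
      refine DifferentiableAt.differentiableWithinAt ?_
      by_cases hwa : w = a
      · subst hwa
        exact hg₀.differentiableAt.congr_of_eventuallyEq hGa
      · have h1 : DifferentiableAt ℂ (fun w => f w / (w - a) ^ m) w :=
          (hf.differentiableAt (isOpen_leftHalf.mem_nhds hw)).div (by fun_prop)
            (pow_ne_zero _ (sub_ne_zero.2 hwa))
        refine h1.congr_of_eventuallyEq ?_
        filter_upwards [isOpen_ne.mem_nhds hwa] with z hz using hGne z hz
    obtain ⟨t, g, ht, hgd, hg0, hfac⟩ := ih hGd (by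
      intro w hw h
      by_cases hwa : w = a
      · subst hwa
        rw [hG, Function.update_self] at h
        exact absurd h hg₀a
      · rw [hGne w hwa, div_eq_zero_iff] at h
        have h1 := h.resolve_right (pow_ne_zero _ (sub_ne_zero.2 hwa))
        exact (Finset.mem_insert.1 (h0 w hw h1)).resolve_left hwa)
    refine ⟨Multiset.replicate m a + t, g, ?_, hgd, hg0, ?_⟩
    · intro b hb
      rcases Multiset.mem_add.1 hb with hb | hb
      · rwa [Multiset.eq_of_mem_replicate hb]
      · exact ht b hb
    · intro w hw
      rw [Multiset.map_add, Multiset.prod_add, Multiset.map_replicate, Multiset.prod_replicate,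
        mul_assoc, ← hfac w hw]
      by_cases hwa : w = a
      · subst hwa
        have h1 := hfg.self_of_nhds
        rw [h1, smul_eq_mul, hGa.self_of_nhds]
      · rw [hGne w hwa, mul_div_cancel₀]
        exact pow_ne_zero _ (sub_ne_zero.2 hwa)

theorem exists_fin_factor {f : ℂ → ℂ} (hf : DifferentiableOn ℂ f leftHalf)
    (hfin : {w : ℂ | w.re < 0 ∧ f w = 0}.Finite) :
    ∃ (n : ℕ) (ξ : Fin n → ℂ) (g : ℂ → ℂ), (∀ j, (ξ j).re < 0) ∧ DifferentiableOn ℂ g leftHalf ∧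
      (∀ w ∈ leftHalf, g w ≠ 0) ∧ ∀ w ∈ leftHalf, f w = (∏ j, (w - ξ j)) * g w := by
  obtain ⟨t, g, ht, hg, hg0, hfac⟩ := exists_factor_of_finite_zeros hfin.toFinset hf
    fun w hw h => hfin.mem_toFinset.2 ⟨hw, h⟩
  refine ⟨t.toList.length, fun j => t.toList.get j, g,
    fun j => ht _ (Multiset.mem_toList.1 (List.get_mem _ _)), hg, hg0, fun w hw => ?_⟩
  rw [hfac w hw]
  congr 1
  conv_lhs => rw [← Multiset.coe_toList t]
  rw [Multiset.map_coe, Multiset.prod_coe, ← List.prod_ofFn]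
  congr 1
  exact List.ext_getElem (by simp) (by simp)

theorem analyticOrderAt_sub_const (a w : ℂ) :
    analyticOrderAt (fun z => z - a) w = if a = w then 1 else 0 := by
  have han : AnalyticAt ℂ (fun z => z - a) w := by fun_prop
  split_ifs with h
  · subst h
    have : analyticOrderAt (fun z => z - a) a = ((1 : ℕ) : ℕ∞) := by
      rw [han.analyticOrderAt_eq_natCast]
      exact ⟨fun _ => 1, analyticAt_const, one_ne_zero, Eventually.of_forall fun z => by simp⟩
    simp [this]
  · rw [han.analyticOrderAt_eq_zero]
    exact sub_ne_zero.2 (Ne.symm h)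

theorem isLeftZeroList_of_factor {f g : ℂ → ℂ} {n : ℕ} {ξ : Fin n → ℂ} (hξ : ∀ j, (ξ j).re < 0)
    (hg : DifferentiableOn ℂ g leftHalf) (hg0 : ∀ w ∈ leftHalf, g w ≠ 0)
    (hf : ∀ w ∈ leftHalf, f w = (∏ j, (w - ξ j)) * g w) : IsLeftZeroList f ξ := by
  refine ⟨hξ, fun w hw => ?_⟩
  have hgan := hg.analyticAt (isOpen_leftHalf.mem_nhds hw)
  have hp : ∀ s : Finset (Fin n), AnalyticAt ℂ (fun z => ∏ j ∈ s, (z - ξ j)) w ∧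
      analyticOrderAt (fun z => ∏ j ∈ s, (z - ξ j)) w = ((s.filter fun j => ξ j = w).card : ℕ∞) := by
    intro s
    induction s using Finset.induction_on with
    | empty =>
      simp only [Finset.prod_empty, Finset.filter_empty, Finset.card_empty, Nat.cast_zero]
      exact ⟨analyticAt_const, analyticAt_const.analyticOrderAt_eq_zero.2 one_ne_zero⟩
    | insert a s ha ih =>
      simp only [Finset.prod_insert ha]
      have h1 : AnalyticAt ℂ (fun z => z - ξ a) w := by fun_prop
      refine ⟨h1.mul ih.1, ?_⟩
      have h2 := analyticOrderAt_mul h1 ih.1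
      rw [ih.2, analyticOrderAt_sub_const] at h2
      refine h2.trans ?_
      rw [Finset.filter_insert]
      split_ifs with h
      · rw [Finset.card_insert_of_notMem (by simp [ha])]
        push_cast
        rw [add_comm]
      · simp
  have heq : f =ᶠ[𝓝 w] fun z => (∏ j, (z - ξ j)) * g z := by
    filter_upwards [isOpen_leftHalf.mem_nhds hw] with z hz using hf z hz
  refine ⟨((hp Finset.univ).1.mul hgan).congr heq.symm, ?_⟩
  rw [analyticOrderAt_congr heq]
  have h2 := analyticOrderAt_mul (hp Finset.univ).1 hgan
  rw [(hp Finset.univ).2, hgan.analyticOrderAt_eq_zero.2 (hg0 w hw), add_zero] at h2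
  exact h2

theorem exists_le_norm_eval {W : Polynomial ℂ} (hW : W ≠ 0) :
    ∃ (κ R : ℝ), 0 < κ ∧ ∀ s : ℂ, R ≤ ‖s‖ → κ ≤ ‖W.eval s‖ := by
  by_cases hd : 0 < W.degree
  · have h1 : Tendsto (fun s : ℂ => ‖W.eval s‖) (cocompact ℂ) atTop :=
      W.tendsto_norm_atTop hd tendsto_norm_cocompact_atTop
    have h2 := h1.eventually_ge_atTop 1
    rw [← Metric.cobounded_eq_cocompact, ← comap_norm_atTop, eventually_comap, eventually_atTop] at h2
    obtain ⟨R, hR⟩ := h2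
    exact ⟨1, R, one_pos, fun s hs => hR _ hs s rfl⟩
  · rw [Polynomial.eq_C_of_degree_le_zero (not_lt.1 hd)] at hW ⊢
    refine ⟨‖W.coeff 0‖, 0, ?_, fun s _ => by simp⟩
    rw [norm_pos_iff]
    exact fun h => hW (by rw [h, Polynomial.C_0])

theorem norm_eval_le_of_coeff {p : Polynomial ℂ} {d : ℕ} {K : ℝ} (hd : p.natDegree ≤ d)
    (hK : ∀ i, ‖p.coeff i‖ ≤ K) (u : ℂ) : ‖p.eval u‖ ≤ (d + 1) * K * (1 + ‖u‖) ^ d := by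
  rw [Polynomial.eval_eq_sum_range' (Nat.lt_succ_of_le hd)]
  refine (norm_sum_le _ _).trans ((Finset.sum_le_card_nsmul _ _ (K * (1 + ‖u‖) ^ d) ?_).trans ?_)
  · intro i hi
    have hK0 : 0 ≤ K := (norm_nonneg _).trans (hK 0)
    rw [norm_mul, norm_pow]
    refine mul_le_mul (hK i) ?_ (by positivity) hK0
    calc ‖u‖ ^ i ≤ (1 + ‖u‖) ^ i := pow_le_pow_left₀ (norm_nonneg _) (by linarith) _
      _ ≤ _ := pow_le_pow_right₀ (by linarith [norm_nonneg u])
        (Nat.lt_succ_iff.1 (Finset.mem_range.1 hi))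
  · rw [Finset.card_range, nsmul_eq_mul]
    push_cast
    rw [mul_assoc]

section Transform

variable {Ω : Type*} [MeasurableSpace Ω] {P : Measure Ω} {B A : Ω → ℝ}

theorem norm_exp_le {δ b a : ℝ} (hb : 0 ≤ b) (ha : 0 ≤ a) {w s : ℂ} (hw : -δ ≤ w.re)
    (hs : 0 ≤ s.re) : ‖Complex.exp (-w * (b : ℂ) - s * (a : ℂ))‖ ≤ Real.exp (δ * b) := by
  rw [Complex.norm_exp]
  refine Real.exp_le_exp.2 ?_
  simp
  nlinarith [mul_nonneg hs ha, mul_le_mul_of_nonneg_right hw hb]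

theorem norm_jointLST_le_integral {δ : ℝ} (hnn : ∀ᵐ ω ∂P, 0 ≤ B ω ∧ 0 ≤ A ω)
    (hint : Integrable (fun ω => Real.exp (δ * B ω)) P) {w s : ℂ} (hw : -δ ≤ w.re)
    (hs : 0 ≤ s.re) : ‖jointLST P B A w s‖ ≤ ∫ ω, Real.exp (δ * B ω) ∂P :=
  norm_integral_le_of_norm_le hint (hnn.mono fun _ h => norm_exp_le h.1 h.2 hw hs)

theorem differentiableOn_jointLST {δ : ℝ} (hB : Measurable B) (hA : Measurable A)
    (hnn : ∀ᵐ ω ∂P, 0 ≤ B ω ∧ 0 ≤ A ω) (hint : Integrable (fun ω => Real.exp (δ * B ω)) P) {s : ℂ}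
    (hs : 0 ≤ s.re) : DifferentiableOn ℂ (fun w => jointLST P B A w s) {w | -δ < w.re} := by
  have hopen : IsOpen {w : ℂ | -δ < w.re} := isOpen_lt continuous_const Complex.continuous_re
  refine differentiableOn_integral hopen
    (fun w _ => (by fun_prop : Measurable _).aestronglyMeasurable)
    (Eventually.of_forall fun ω => by fun_prop)
    fun w₀ _ => ⟨1, one_pos, _, hint, hnn.mono fun ω h w _ hw =>
      norm_exp_le h.1 h.2 (le_of_lt hw) hs⟩

theorem jointLST_mul_eval {δ : ℝ} (hδ : 0 < δ) (hB : Measurable B) (hA : Measurable A)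
    (hnn : ∀ᵐ ω ∂P, 0 ≤ B ω ∧ 0 ≤ A ω) (hint : Integrable (fun ω => Real.exp (δ * B ω)) P) {s : ℂ}
    (hs : 0 ≤ s.re) {p₁ p₂ : Polynomial ℂ}
    (hrat : ∀ w : ℂ, 0 ≤ w.re → jointLST P B A w s * p₂.eval w = p₁.eval w) {w : ℂ}
    (hw : -δ < w.re) : jointLST P B A w s * p₂.eval w = p₁.eval w := by
  have hopen : IsOpen {w : ℂ | -δ < w.re} := isOpen_lt continuous_const Complex.continuous_re
  have := AnalyticOnNhd.eqOn_of_preconnected_of_eventuallyEq (𝕜 := ℂ) (z₀ := 1)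
    (U := {w : ℂ | -δ < w.re}) (f := fun w => jointLST P B A w s * p₂.eval w)
    (g := fun w => p₁.eval w)
    (((differentiableOn_jointLST hB hA hnn hint hs).mul
      (Polynomial.differentiable _).differentiableOn).analyticOnNhd hopen)
    ((Polynomial.differentiable _).differentiableOn.analyticOnNhd hopen)
    (convex_halfSpace_re_gt _).isPreconnected (by simpa using by linarith) (by
      filter_upwards [isOpen_rightHalf.mem_nhds (by simp [rightHalf] : (1 : ℂ) ∈ rightHalf)]
        with w hw using hrat w (le_of_lt hw))
  exact this hw

/-- The numerator has polynomial growth relative to the zero-free part of the denominator. -/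
theorem exists_growth_bound [IsProbabilityMeasure P] {δ : ℝ} (hδ : 0 < δ) (hB : Measurable B)
    (hA : Measurable A) (hnn : ∀ᵐ ω ∂P, 0 ≤ B ω ∧ 0 ≤ A ω)
    (hint : Integrable (fun ω => Real.exp (δ * B ω)) P)
    {h₁ h₂ : ℂ → Polynomial ℂ}
    (hrat : ∀ s₂ : ℂ, 0 ≤ s₂.re → h₂ s₂ ≠ 0 ∧ ∀ s₁ : ℂ, 0 ≤ s₁.re →
      jointLST P B A s₁ s₂ * (h₂ s₂).eval s₁ = (h₁ s₂).eval s₁)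
    (hhol₁ : DifferentiableOn ℂ (fun ξ => (h₁ (-ξ)).eval ξ) leftHalf)
    {n : ℕ} {ξ : Fin n → ℂ} {g : ℂ → ℂ} (hg : DifferentiableOn ℂ g leftHalf)
    (hg0 : ∀ w ∈ leftHalf, g w ≠ 0)
    (hfac : ∀ w ∈ leftHalf, (h₂ (-w)).eval w = (∏ j, (w - ξ j)) * g w) :
    ∃ (C : ℝ) (m : ℕ), ∀ w ∈ leftHalf, ‖(h₁ (-w)).eval w / g w‖ ≤ C * (1 + ‖w‖) ^ m := by
  set q : Polynomial ℂ := ∏ j, (Polynomial.X - Polynomial.C (ξ j)) with hq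
  have hqe : ∀ w, q.eval w = ∏ j, (w - ξ j) := fun w => by simp [hq, Polynomial.eval_prod]
  simp only [← hqe] at hfac
  obtain ⟨Kq, hKq⟩ : ∃ Kq : ℝ, ∀ i, ‖q.coeff i‖ ≤ Kq := by
    refine ⟨∑ i ∈ Finset.range (q.natDegree + 1), ‖q.coeff i‖, fun i => ?_⟩
    by_cases hi : i < q.natDegree + 1
    · exact Finset.single_le_sum (f := fun i => ‖q.coeff i‖) (fun _ _ => norm_nonneg _)
        (Finset.mem_range.2 hi)
    · rw [Polynomial.coeff_eq_zero_of_natDegree_lt (by omega), norm_zero]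
      exact Finset.sum_nonneg fun _ _ => norm_nonneg _
  have hqb := norm_eval_le_of_coeff le_rfl hKq
  set comp1 : Polynomial ℂ → Polynomial ℂ := fun p => p.comp (1 + Polynomial.X) with hcomp
  have hc1 : ∀ p u, (comp1 p).eval u = p.eval (1 + u) := fun p u => by simp [hcomp]
  have hpow : ∀ s ∈ rightHalf, (comp1 (h₂ s) : PowerSeries ℂ) *
      PowerSeries.mk (fun k => lstCoeff P B A k s) = (comp1 (h₁ s) : PowerSeries ℂ) := by
    intro s hs
    refine powerSeries_eq_of_eval_eq (H := fun u => jointLST P B A (1 + u) s)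
      (fun u hu => hasSum_lstCoeff hB hA hnn (le_of_lt hs) hu) fun u hu => ?_
    rw [hc1, hc1, mul_comm]
    refine (hrat s (le_of_lt hs)).2 _ ?_
    have h1 := neg_abs_le u.re
    have h2 := Complex.abs_re_le_norm u
    simp
    linarith
  -- These denominators replace the given `h₂ s`, about whose degree and dependence on `s` nothing
  -- uniform is known.
  obtain ⟨d, Q, hQd, hQ0, hQr, hQP⟩ := exists_bounded_denominator (c := lstCoeff P B A) hδ
    (fun k => differentiableOn_lstCoeff hB hA hnn k)
    (fun k s hs => norm_lstCoeff_le hnn k (le_of_lt hs))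
    (H := fun s u => jointLST P B A (1 + u) s)
    (fun s hs u hu => hasSum_lstCoeff hB hA hnn (le_of_lt hs) hu)
    (fun s hs => (differentiableOn_jointLST hB hA hnn hint (le_of_lt hs)).comp
      (f := fun u => 1 + u) (by fun_prop) fun u hu => hu)
    (fun s hs => ⟨_, comp1 (h₂ s), fun h => (hrat s (le_of_lt hs)).1 (by
      have h1 : h₂ s = (comp1 (h₂ s)).comp (Polynomial.X - 1) := by
        rw [hcomp, Polynomial.comp_assoc]
        simp
      rw [h1, h, Polynomial.zero_comp]), hpow s hs⟩)
  obtain ⟨W, E, K, m, hW0, hWE⟩ := exists_polynomial_factor hQd hQ0 hQr (half_pos hδ)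
    (half_lt_self hδ)
  obtain ⟨κ, R, hκ, hκR⟩ := exists_le_norm_eval hW0
  set K₀ := ∫ ω, Real.exp (δ * B ω) ∂P with hK₀
  have hK₀0 : 0 ≤ K₀ := integral_nonneg fun _ => (Real.exp_pos _).le
  have hKq0 : 0 ≤ Kq := (norm_nonneg _).trans (hKq 0)
  obtain ⟨C₁, hC₁⟩ : ∃ C₁ : ℝ, ∀ w ∈ Metric.closedBall (0 : ℂ) R ∩ {w : ℂ | w.re ≤ -(δ / 2)},
      ‖(h₁ (-w)).eval w / g w‖ ≤ C₁ := by
    refine IsCompact.exists_bound_of_continuousOn (f := fun w => (h₁ (-w)).eval w / g w) ?_ ?_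
    · exact (isCompact_closedBall _ _).inter_right
        (isClosed_le Complex.continuous_re continuous_const)
    · refine ((hhol₁.div hg hg0).continuousOn).mono fun w hw => ?_
      have h1 : w.re ≤ -(δ / 2) := hw.2
      have h2 : w.re < 0 := by linarith
      exact h2
  have hK' : ∀ s : ℂ, δ / 2 ≤ s.re → 0 ≤ K * (1 + ‖s‖) ^ m := fun s hs =>
    (norm_nonneg _).trans (hWE s hs).2
  have hK0 : 0 ≤ K := by
    have h := hK' ((δ / 2 : ℝ) : ℂ) (by simp)
    exact nonneg_of_mul_nonneg_left h (by positivity)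
  set Cq := (q.natDegree + 1) * Kq with hCq
  have hCq0 : 0 ≤ Cq := by positivity
  set CP : ℝ := (d + 1) * ((d + 1) * 2 ^ d) * 2 ^ d with hCP
  have hCP0 : 0 ≤ CP := by positivity
  -- Three regions: near the imaginary axis the exponential moment bounds the transform, in a
  -- compact set continuity suffices, and far out the factorisation of the denominator applies.
  refine ⟨max (K₀ * Cq) (max (max C₁ 0) (Cq * CP * K / κ)), q.natDegree + d + m, fun w hw => ?_⟩
  have hw1 : 1 ≤ 1 + ‖w‖ := by linarith [norm_nonneg w]
  have hle : ∀ {C : ℝ} {k : ℕ}, 0 ≤ C → C ≤ max (K₀ * Cq) (max (max C₁ 0) (Cq * CP * K / κ)) →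
      k ≤ q.natDegree + d + m → C * (1 + ‖w‖) ^ k ≤
      max (K₀ * Cq) (max (max C₁ 0) (Cq * CP * K / κ)) * (1 + ‖w‖) ^ (q.natDegree + d + m) := by
    intro C k hC hC' hk
    exact mul_le_mul hC' (pow_le_pow_right₀ hw1 hk) (by positivity) (hC.trans hC')
  have hs : -w ∈ rightHalf := by
    have : w.re < 0 := hw
    simpa [rightHalf] using this
  by_cases hnear : -(δ / 2) < w.re
  · have h1 := jointLST_mul_eval (w := w) hδ hB hA hnn hint (le_of_lt hs)
      (hrat (-w) (le_of_lt hs)).2 (by linarith)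
    rw [hfac w hw] at h1
    have h2 : (h₁ (-w)).eval w / g w = jointLST P B A w (-w) * q.eval w := by
      rw [← h1, mul_div_assoc, mul_div_cancel_right₀ _ (hg0 w hw)]
    rw [h2, norm_mul]
    have h3 := mul_le_mul (norm_jointLST_le_integral hnn hint (w := w) (s := -w) (by linarith)
      (le_of_lt hs)) (hqb w) (norm_nonneg _) hK₀0
    refine h3.trans ?_
    rw [← mul_assoc]
    exact hle (by positivity) (le_max_left _ _) (by omega)
  · rw [not_lt] at hnear
    by_cases hR : ‖w‖ ≤ R
    · refine (hC₁ w ⟨by simpa using hR, hnear⟩).trans ?_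
      have := hle (C := max C₁ 0) (k := 0) (le_max_right _ _)
        ((le_max_left _ _).trans (le_max_right _ _)) (by omega)
      rw [pow_zero, mul_one] at this
      exact (le_max_left _ _).trans this
    · rw [not_le] at hR
      have hs' : δ / 2 ≤ (-w).re := by
        rw [Complex.neg_re]
        linarith
      obtain ⟨hWs, hEs⟩ := hWE (-w) hs'
      have hWk := hκR (-w) (by rw [norm_neg]; exact hR.le)
      obtain ⟨N, hNd, hNc, hNeq⟩ := hQP (-w) hs
      -- Two fractions for the same power series, cross-multiplied. Evaluation at `u = -1 - s` with
      -- `s = -w` means `s₁ = 1 + u = w`, the antidiagonal point. There `g w` cancels, and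
      -- multiplying by `E` replaces the denominator by the polynomial `W`.
      have hpoly : (vecPoly fun i => Q i (-w)) * comp1 (h₁ (-w)) = N * comp1 (h₂ (-w)) := by
        rw [← Polynomial.coe_inj, Polynomial.coe_mul, Polynomial.coe_mul, ← hpow _ hs, ← hNeq]
        ring
      have hev := congrArg (Polynomial.eval (-1 - -w)) hpoly
      have hu : (1 : ℂ) + (-1 - -w) = w := by ring
      rw [Polynomial.eval_mul, Polynomial.eval_mul, hc1, hc1, hu, hfac w hw] at hev
      have hkey : (h₁ (-w)).eval w / g w * W.eval (-w) =
          q.eval w * N.eval (-1 - -w) * E (-w) := by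
        rw [hWs, div_mul_eq_mul_div, div_eq_iff (hg0 w hw)]
        linear_combination E (-w) * hev
      have hNb : ‖N.eval (-1 - -w)‖ ≤ CP * (1 + ‖w‖) ^ d := by
        refine (norm_eval_le_of_coeff hNd hNc _).trans ?_
        rw [hCP, mul_assoc _ ((2 : ℝ) ^ d) ((1 + ‖w‖) ^ d), ← mul_pow]
        have h3 : 1 + ‖-1 - -w‖ ≤ 2 * (1 + ‖w‖) := by
          have := norm_sub_le (-1 : ℂ) (-w)
          rw [norm_neg, norm_one, norm_neg] at this
          linarith [norm_nonneg w]
        gcongr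
      rw [norm_neg] at hEs
      have h4 : ‖(h₁ (-w)).eval w / g w‖ * κ ≤
          (Cq * (1 + ‖w‖) ^ q.natDegree) * (CP * (1 + ‖w‖) ^ d) * (K * (1 + ‖w‖) ^ m) := by
        calc _ ≤ ‖(h₁ (-w)).eval w / g w‖ * ‖W.eval (-w)‖ := by gcongr
          _ = ‖q.eval w‖ * ‖N.eval (-1 - -w)‖ * ‖E (-w)‖ := by
            rw [← norm_mul, hkey, norm_mul, norm_mul]
          _ ≤ _ := by
            gcongr
            exact hqb w
      rw [← le_div_iff₀ hκ] at h4
      refine h4.trans ?_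
      have h5 : (Cq * (1 + ‖w‖) ^ q.natDegree) * (CP * (1 + ‖w‖) ^ d) * (K * (1 + ‖w‖) ^ m) / κ =
          Cq * CP * K / κ * (1 + ‖w‖) ^ (q.natDegree + d + m) := by
        rw [pow_add, pow_add]
        ring
      rw [h5]
      exact hle (by positivity) ((le_max_right _ _).trans (le_max_right _ _)) le_rfl

end Transform

/-! ### Weighted measures, Laplace transforms and generating functions. -/

/-- The submultiplicative weight `max 1 (exp (ε x))`. -/
def weight (ε x : ℝ) : ℝ := max 1 (Real.exp (ε * x))

theorem one_le_weight (ε x : ℝ) : 1 ≤ weight ε x := le_max_left _ _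

theorem measurable_weight (ε : ℝ) : Measurable (weight ε) := by
  unfold weight
  fun_prop

theorem weight_add_le (ε x y : ℝ) : weight ε (x + y) ≤ weight ε x * weight ε y := by
  refine max_le (one_le_mul_of_one_le_of_one_le (one_le_weight _ _) (one_le_weight _ _)) ?_
  rw [mul_add, Real.exp_add]
  exact mul_le_mul (le_max_right _ _) (le_max_right _ _) (Real.exp_nonneg _)
    (zero_le_one.trans (one_le_weight _ _))

/-- The total mass of a measure with respect to the weight. -/
def weightMass (ε : ℝ) (α : Measure ℝ) : ENNReal := ∫⁻ x, ENNReal.ofReal (weight ε x) ∂α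

theorem weightMass_conv_le (ε : ℝ) (α μ : Measure ℝ) [SFinite μ] :
    weightMass ε (α.conv μ) ≤ weightMass ε α * weightMass ε μ := by
  have hm := (measurable_weight ε).ennreal_ofReal
  rw [weightMass, Measure.lintegral_conv hm, weightMass, weightMass,
    ← lintegral_mul_const _ hm]
  refine lintegral_mono fun x => ?_
  rw [← lintegral_const_mul _ hm]
  refine lintegral_mono fun y => ?_
  rw [← ENNReal.ofReal_mul (zero_le_one.trans (one_le_weight _ _))]
  exact ENNReal.ofReal_le_ofReal (weight_add_le ε x y)

theorem weightMass_restrict_le (ε : ℝ) (α : Measure ℝ) (C : Set ℝ) :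
    weightMass ε (α.restrict C) ≤ weightMass ε α :=
  lintegral_mono' Measure.restrict_le_self le_rfl

theorem weightMass_dirac_zero (ε : ℝ) : weightMass ε (Measure.dirac 0) = 1 := by
  rw [weightMass, lintegral_dirac' _ (measurable_weight ε).ennreal_ofReal]
  simp [weight]

/-- The two-sided Laplace transform of a measure on the line. -/
def laplace (α : Measure ℝ) (s : ℂ) : ℂ := ∫ x, Complex.exp (-s * (x : ℂ)) ∂α

theorem norm_exp_neg_mul (s : ℂ) (x : ℝ) :
    ‖Complex.exp (-s * (x : ℂ))‖ = Real.exp (-s.re * x) := by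
  rw [Complex.norm_exp]
  simp

theorem norm_exp_le_weight_strip {ε : ℝ} {s : ℂ} (h1 : -ε ≤ s.re) (h2 : s.re ≤ 0) (x : ℝ) :
    ‖Complex.exp (-s * (x : ℂ))‖ ≤ weight ε x := by
  rw [norm_exp_neg_mul, weight]
  rcases le_total 0 x with hx | hx
  · exact (Real.exp_le_exp.2 (mul_le_mul_of_nonneg_right (by linarith) hx)).trans (le_max_right _ _)
  · exact (Real.exp_le_one_iff.2 (by nlinarith)).trans (le_max_left _ _)

theorem norm_exp_le_weight_nonneg {ε : ℝ} {s : ℂ} (h1 : -ε ≤ s.re) {x : ℝ} (hx : 0 ≤ x) :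
    ‖Complex.exp (-s * (x : ℂ))‖ ≤ weight ε x := by
  rw [norm_exp_neg_mul, weight]
  exact (Real.exp_le_exp.2 (mul_le_mul_of_nonneg_right (by linarith) hx)).trans (le_max_right _ _)

theorem norm_exp_le_one_of_nonneg {s : ℂ} (h1 : 0 ≤ s.re) {x : ℝ} (hx : 0 ≤ x) :
    ‖Complex.exp (-s * (x : ℂ))‖ ≤ 1 := by
  rw [norm_exp_neg_mul, Real.exp_le_one_iff]
  nlinarith

theorem norm_exp_le_one_of_nonpos {s : ℂ} (h1 : s.re ≤ 0) {x : ℝ} (hx : x ≤ 0) :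
    ‖Complex.exp (-s * (x : ℂ))‖ ≤ 1 := by
  rw [norm_exp_neg_mul, Real.exp_le_one_iff]
  nlinarith

theorem aestronglyMeasurable_exp (α : Measure ℝ) (s : ℂ) :
    AEStronglyMeasurable (fun x : ℝ => Complex.exp (-s * (x : ℂ))) α :=
  (by fun_prop : Measurable _).aestronglyMeasurable

theorem integrable_weight {ε K : ℝ} {α : Measure ℝ} (hK : weightMass ε α ≤ ENNReal.ofReal K) :
    Integrable (weight ε) α := by
  refine ⟨(measurable_weight ε).aestronglyMeasurable, ?_⟩
  rw [hasFiniteIntegral_iff_ofReal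
    (Eventually.of_forall fun x => zero_le_one.trans (one_le_weight ε x))]
  exact hK.trans_lt ENNReal.ofReal_lt_top

theorem integral_weight_le {ε K : ℝ} {α : Measure ℝ} (hK0 : 0 ≤ K)
    (hK : weightMass ε α ≤ ENNReal.ofReal K) : ∫ x, weight ε x ∂α ≤ K := by
  rw [integral_eq_lintegral_of_nonneg_ae
    (Eventually.of_forall fun x => zero_le_one.trans (one_le_weight ε x))
    (measurable_weight ε).aestronglyMeasurable]
  exact ENNReal.toReal_le_of_le_ofReal hK0 hK

theorem integrable_exp {ε K : ℝ} {α : Measure ℝ} (hK : weightMass ε α ≤ ENNReal.ofReal K) {s : ℂ}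
    (h : ∀ᵐ x : ℝ ∂α, ‖Complex.exp (-s * (x : ℂ))‖ ≤ weight ε x) :
    Integrable (fun x : ℝ => Complex.exp (-s * (x : ℂ))) α :=
  (integrable_weight hK).mono' (aestronglyMeasurable_exp α s) h

theorem norm_laplace_le {ε K : ℝ} {α : Measure ℝ} (hK0 : 0 ≤ K)
    (hK : weightMass ε α ≤ ENNReal.ofReal K) {s : ℂ}
    (h : ∀ᵐ x : ℝ ∂α, ‖Complex.exp (-s * (x : ℂ))‖ ≤ weight ε x) : ‖laplace α s‖ ≤ K :=
  (norm_integral_le_of_norm_le (integrable_weight hK) h).trans (integral_weight_le hK0 hK)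

theorem differentiableOn_laplace {ε K : ℝ} {α : Measure ℝ}
    (hK : weightMass ε α ≤ ENNReal.ofReal K) {D : Set ℂ} (hD : IsOpen D)
    (h : ∀ᵐ x : ℝ ∂α, ∀ s ∈ D, ‖Complex.exp (-s * (x : ℂ))‖ ≤ weight ε x) :
    DifferentiableOn ℂ (laplace α) D :=
  differentiableOn_integral hD (fun s _ => aestronglyMeasurable_exp α s)
    (Eventually.of_forall fun x => by fun_prop)
    fun s₀ _ => ⟨1, one_pos, weight ε, integrable_weight hK, h.mono fun x hx s _ hs => hx s hs⟩

theorem laplace_conv (α μ : Measure ℝ) [IsFiniteMeasure α] [IsFiniteMeasure μ] (s : ℂ) :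
    laplace (α.conv μ) s = laplace α s * laplace μ s := by
  rw [laplace, Measure.conv, integral_map (by fun_prop) (aestronglyMeasurable_exp _ s), laplace,
    laplace, ← integral_prod_mul]
  refine integral_congr_ae (Eventually.of_forall fun p => ?_)
  simp only
  rw [← Complex.exp_add]
  push_cast
  congr 1
  ring

theorem laplace_restrict_add_compl {ε K : ℝ} {α : Measure ℝ}
    (hα : weightMass ε α ≤ ENNReal.ofReal K) {C : Set ℝ} (hC : MeasurableSet C) {s : ℂ}
    (h1 : -ε ≤ s.re) (h2 : s.re ≤ 0) :
    laplace (α.restrict C) s + laplace (α.restrict Cᶜ) s = laplace α s :=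
  integral_add_compl hC (integrable_exp hα
    (Eventually.of_forall fun x => norm_exp_le_weight_strip h1 h2 x))

theorem laplace_dirac_zero (s : ℂ) : laplace (Measure.dirac 0) s = 1 := by
  simp [laplace]

theorem laplace_zero (α : Measure ℝ) : laplace α 0 = (α.real Set.univ : ℂ) := by
  simp [laplace]

/-- The generating function of the transforms of a sequence of measures. -/
def genFun (z : ℂ) (α : ℕ → Measure ℝ) (s : ℂ) : ℂ := ∑' n, z ^ n * laplace (α n) s

section GenFun

variable {ε C K : ℝ} {z : ℂ} {α : ℕ → Measure ℝ}

theorem norm_pow_mul_laplace_le (hC : 0 ≤ C) (hK : 0 ≤ K)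
    (hα : ∀ n, weightMass ε (α n) ≤ ENNReal.ofReal (C * K ^ n)) {s : ℂ}
    (h : ∀ n, ∀ᵐ x : ℝ ∂(α n), ‖Complex.exp (-s * (x : ℂ))‖ ≤ weight ε x) (n : ℕ) :
    ‖z ^ n * laplace (α n) s‖ ≤ C * (‖z‖ * K) ^ n := by
  rw [norm_mul, norm_pow]
  calc _ ≤ ‖z‖ ^ n * (C * K ^ n) := by
        gcongr
        exact norm_laplace_le (by positivity) (hα n) (h n)
    _ = _ := by ring

theorem summable_genFun (hC : 0 ≤ C) (hK : 0 ≤ K) (hz : ‖z‖ * K < 1)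
    (hα : ∀ n, weightMass ε (α n) ≤ ENNReal.ofReal (C * K ^ n)) {s : ℂ}
    (h : ∀ n, ∀ᵐ x : ℝ ∂(α n), ‖Complex.exp (-s * (x : ℂ))‖ ≤ weight ε x) :
    Summable fun n => z ^ n * laplace (α n) s :=
  Summable.of_norm_bounded ((summable_geometric_of_lt_one (by positivity) hz).mul_left C)
    (norm_pow_mul_laplace_le hC hK hα h)

theorem norm_genFun_le (hC : 0 ≤ C) (hK : 0 ≤ K) (hz : ‖z‖ * K < 1)
    (hα : ∀ n, weightMass ε (α n) ≤ ENNReal.ofReal (C * K ^ n)) {s : ℂ}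
    (h : ∀ n, ∀ᵐ x : ℝ ∂(α n), ‖Complex.exp (-s * (x : ℂ))‖ ≤ weight ε x) :
    ‖genFun z α s‖ ≤ C * (1 - ‖z‖ * K)⁻¹ :=
  tsum_of_norm_bounded ((hasSum_geometric_of_lt_one (by positivity) hz).mul_left C)
    (norm_pow_mul_laplace_le hC hK hα h)

theorem differentiableOn_genFun (hC : 0 ≤ C) (hK : 0 ≤ K) (hz : ‖z‖ * K < 1)
    (hα : ∀ n, weightMass ε (α n) ≤ ENNReal.ofReal (C * K ^ n)) {D : Set ℂ} (hD : IsOpen D)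
    (h : ∀ n, ∀ᵐ x : ℝ ∂(α n), ∀ s ∈ D, ‖Complex.exp (-s * (x : ℂ))‖ ≤ weight ε x) :
    DifferentiableOn ℂ (genFun z α) D := by
  refine Complex.differentiableOn_tsum_of_summable_norm
    ((summable_geometric_of_lt_one (by positivity) hz).mul_left C)
    (fun n => (differentiableOn_laplace (hα n) hD (h n)).const_mul _) hD fun n s hs => ?_
  exact norm_pow_mul_laplace_le hC hK hα (fun n => (h n).mono fun x hx => hx s hs) n

end GenFun

/-! ### The killed and the reflected walk and their recursions. -/

/-- The law of the `n`-th position of the walk with step law `μ` on the event that it has stayed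
in `C` up to time `n`. -/
def stay (μ : Measure ℝ) (C : Set ℝ) : ℕ → Measure ℝ
  | 0 => Measure.dirac 0
  | n + 1 => ((stay μ C n).conv μ).restrict C

/-- The law of the position after leaving `C`, on the event that `C` is left at time `n + 1`. -/
def leave (μ : Measure ℝ) (C : Set ℝ) (n : ℕ) : Measure ℝ := ((stay μ C n).conv μ).restrict Cᶜ

/-- The laws of the reflected walk with step law `μ`. -/
def reflected (μ : Measure ℝ) : ℕ → Measure ℝ
  | 0 => Measure.dirac 0
  | n + 1 => ((reflected μ n).conv μ).map (max 0)

/-- The undershoot measures of the reflected walk. -/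
def undershoot (μ : Measure ℝ) (n : ℕ) : Measure ℝ :=
  ((reflected μ n).conv μ).restrict (Set.Ici 0)ᶜ

theorem ae_stay_mem (μ : Measure ℝ) {C : Set ℝ} (hC : MeasurableSet C) (n : ℕ) : ∀ᵐ x : ℝ ∂(stay μ C n), x = 0 ∨ x ∈ C := by
  cases n with
  | zero =>
    rw [stay, ae_dirac_eq]
    exact Or.inl rfl
  | succ n =>
    rw [stay]
    exact (ae_restrict_mem hC).mono fun x hx => Or.inr hx

theorem ae_leave_notMem (μ : Measure ℝ) {C : Set ℝ} (hC : MeasurableSet C) (n : ℕ) : ∀ᵐ x : ℝ ∂(leave μ C n), x ∉ C := by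
  rw [leave]
  exact ae_restrict_mem hC.compl

theorem ae_reflected_nonneg (μ : Measure ℝ) (n : ℕ) : ∀ᵐ x : ℝ ∂(reflected μ n), 0 ≤ x := by
  cases n with
  | zero =>
    rw [reflected, ae_dirac_eq]
    exact le_refl (0 : ℝ)
  | succ n =>
    rw [reflected]
    refine (ae_map_iff (by fun_prop) measurableSet_Ici).2 (Eventually.of_forall fun x => ?_)
    exact le_max_left _ _

theorem ae_undershoot_neg (μ : Measure ℝ) (n : ℕ) : ∀ᵐ x : ℝ ∂(undershoot μ n), x < 0 := by
  rw [undershoot]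
  exact (ae_restrict_mem measurableSet_Ici.compl).mono fun x hx => not_le.1 hx

section Recursions

variable {μ : Measure ℝ} [IsProbabilityMeasure μ] {C : Set ℝ} {ε K : ℝ} {z : ℂ}

instance isFiniteMeasure_stay (n : ℕ) : IsFiniteMeasure (stay μ C n) := by
  induction n with
  | zero => rw [stay]; infer_instance
  | succ n ih => rw [stay]; infer_instance

instance isFiniteMeasure_leave (n : ℕ) : IsFiniteMeasure (leave μ C n) := by
  rw [leave]
  infer_instance

instance isProbabilityMeasure_reflected (n : ℕ) : IsProbabilityMeasure (reflected μ n) := by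
  induction n with
  | zero => rw [reflected]; infer_instance
  | succ n ih =>
    rw [reflected]
    exact Measure.isProbabilityMeasure_map (by fun_prop)

theorem weightMass_stay_le (hK : 0 ≤ K) (hμ : weightMass ε μ ≤ ENNReal.ofReal K) (n : ℕ) :
    weightMass ε (stay μ C n) ≤ ENNReal.ofReal (1 * K ^ n) := by
  induction n with
  | zero => simp [stay, weightMass_dirac_zero]
  | succ n ih =>
    rw [stay]
    refine (weightMass_restrict_le _ _ _).trans ((weightMass_conv_le _ _ _).trans ?_)
    rw [pow_succ, ← mul_assoc, ENNReal.ofReal_mul (by positivity)]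
    exact mul_le_mul' ih hμ

theorem weightMass_leave_le (hK : 0 ≤ K) (hμ : weightMass ε μ ≤ ENNReal.ofReal K) (n : ℕ) :
    weightMass ε (leave μ C n) ≤ ENNReal.ofReal (K * K ^ n) := by
  rw [leave]
  refine (weightMass_restrict_le _ _ _).trans ((weightMass_conv_le _ _ _).trans ?_)
  rw [mul_comm, ENNReal.ofReal_mul hK]
  refine mul_le_mul' hμ ?_
  simpa using weightMass_stay_le (C := C) hK hμ n

/-- The weight equals `1` on the whole negative half-line, so pushing negative mass to `0` does not
change the weighted mass. -/
theorem weightMass_reflected_le (hε : 0 ≤ ε) (hK : 0 ≤ K)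
    (hμ : weightMass ε μ ≤ ENNReal.ofReal K) (n : ℕ) :
    weightMass ε (reflected μ n) ≤ ENNReal.ofReal (1 * K ^ n) := by
  induction n with
  | zero => simp [reflected, weightMass_dirac_zero]
  | succ n ih =>
    have h1 : weightMass ε (reflected μ (n + 1)) = weightMass ε ((reflected μ n).conv μ) := by
      rw [reflected, weightMass, lintegral_map (measurable_weight ε).ennreal_ofReal (by fun_prop)]
      refine lintegral_congr fun x => ?_
      congr 1
      rcases le_total 0 x with hx | hx
      · rw [max_eq_right hx]
      · rw [max_eq_left hx, weight, weight, mul_zero, Real.exp_zero, max_self, max_eq_left]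
        exact Real.exp_le_one_iff.2 (by nlinarith)
    rw [h1]
    refine (weightMass_conv_le _ _ _).trans ?_
    rw [pow_succ, ← mul_assoc, ENNReal.ofReal_mul (by positivity)]
    exact mul_le_mul' ih hμ

theorem weightMass_undershoot_le (hε : 0 ≤ ε) (hK : 0 ≤ K)
    (hμ : weightMass ε μ ≤ ENNReal.ofReal K) (n : ℕ) :
    weightMass ε (undershoot μ n) ≤ ENNReal.ofReal (K * K ^ n) := by
  rw [undershoot]
  refine (weightMass_restrict_le _ _ _).trans ((weightMass_conv_le _ _ _).trans ?_)
  rw [mul_comm, ENNReal.ofReal_mul hK]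
  refine mul_le_mul' hμ ?_
  simpa using weightMass_reflected_le hε hK hμ n

theorem hasSum_genFun_shift {α : ℕ → Measure ℝ} {s : ℂ}
    (h : Summable fun n => z ^ n * laplace (α n) s) :
    genFun z α s = laplace (α 0) s + z * ∑' n, z ^ n * laplace (α (n + 1)) s := by
  rw [genFun, h.tsum_eq_zero_add, ← tsum_mul_left]
  congr 1
  · simp
  · exact tsum_congr fun n => by ring

/-- The basic relation between the walk staying in `C` and the exit from `C`. -/
theorem wienerHopf_relation (hC : MeasurableSet C) (hK : 0 ≤ K) (hz : ‖z‖ * K < 1)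
    (hμ : weightMass ε μ ≤ ENNReal.ofReal K) {s : ℂ} (h1 : -ε ≤ s.re) (h2 : s.re ≤ 0) :
    (1 - z * laplace μ s) * genFun z (stay μ C) s = 1 - z * genFun z (leave μ C) s := by
  have hb : ∀ α : ℕ → Measure ℝ, ∀ n, ∀ᵐ x : ℝ ∂(α n), ‖Complex.exp (-s * (x : ℂ))‖ ≤ weight ε x :=
    fun α n => Eventually.of_forall fun x => norm_exp_le_weight_strip h1 h2 x
  have hs1 := summable_genFun zero_le_one hK hz (weightMass_stay_le (C := C) hK hμ)
    (hb (stay μ C))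
  have hs2 := summable_genFun hK hK hz (weightMass_leave_le (C := C) hK hμ) (hb (leave μ C))
  -- After one more step the surviving mass splits into the part in `C` and the part that leaves.
  -- Summation over `n` gives the relation.
  have hrec : ∀ n, z ^ n * laplace (stay μ C (n + 1)) s =
      z ^ n * laplace (stay μ C n) s * laplace μ s - z ^ n * laplace (leave μ C n) s := by
    intro n
    have hconv : weightMass ε ((stay μ C n).conv μ) ≤ ENNReal.ofReal (1 * K ^ n * K) := by
      rw [ENNReal.ofReal_mul (by positivity)]
      exact (weightMass_conv_le _ _ _).trans (mul_le_mul' (weightMass_stay_le hK hμ n) hμ)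
    have h3 := laplace_restrict_add_compl hconv hC h1 h2
    rw [laplace_conv] at h3
    rw [stay, leave]
    linear_combination z ^ n * h3
  have h4 := hasSum_genFun_shift hs1
  rw [show (stay μ C 0) = Measure.dirac 0 from rfl, laplace_dirac_zero, tsum_congr hrec,
    (hs1.mul_right _).tsum_sub hs2, tsum_mul_right] at h4
  simp only [genFun] at h4 ⊢
  linear_combination h4

/-- Lindley's recursion in terms of transforms. -/
theorem reflected_relation (hε : 0 ≤ ε) (hK : 0 ≤ K) (hz : ‖z‖ * K < 1)
    (hμ : weightMass ε μ ≤ ENNReal.ofReal K) {s : ℂ} (h1 : -ε ≤ s.re) (h2 : s.re ≤ 0) :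
    (1 - z * laplace μ s) * genFun z (reflected μ) s =
      1 + z * (genFun z (undershoot μ) 0 - genFun z (undershoot μ) s) := by
  have hb : ∀ {s : ℂ}, -ε ≤ s.re → s.re ≤ 0 → ∀ α : ℕ → Measure ℝ, ∀ n, ∀ᵐ x : ℝ ∂(α n),
      ‖Complex.exp (-s * (x : ℂ))‖ ≤ weight ε x :=
    fun h1 h2 α n => Eventually.of_forall fun x => norm_exp_le_weight_strip h1 h2 x
  have hs1 := summable_genFun zero_le_one hK hz (weightMass_reflected_le hε hK hμ)
    (hb h1 h2 (reflected μ))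
  have hs2 := summable_genFun hK hK hz (weightMass_undershoot_le hε hK hμ)
    (hb h1 h2 (undershoot μ))
  have hs3 := summable_genFun hK hK hz (weightMass_undershoot_le hε hK hμ)
    (hb (s := 0) (by simpa using hε) le_rfl (undershoot μ))
  have hrec : ∀ n, z ^ n * laplace (reflected μ (n + 1)) s =
      z ^ n * laplace (reflected μ n) s * laplace μ s +
        (z ^ n * laplace (undershoot μ n) 0 - z ^ n * laplace (undershoot μ n) s) := by
    intro n
    have hconv : weightMass ε ((reflected μ n).conv μ) ≤ ENNReal.ofReal (1 * K ^ n * K) := by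
      rw [ENNReal.ofReal_mul (by positivity)]
      exact (weightMass_conv_le _ _ _).trans (mul_le_mul' (weightMass_reflected_le hε hK hμ n) hμ)
    have h3 := laplace_restrict_add_compl hconv (measurableSet_Ici (a := (0 : ℝ))) h1 h2
    rw [laplace_conv] at h3
    have hint : Integrable (fun x : ℝ => Complex.exp (-s * ((max 0 x : ℝ) : ℂ)))
        ((reflected μ n).conv μ) := by
      refine (integrable_weight hconv).mono' (by fun_prop : Measurable _).aestronglyMeasurable
        (Eventually.of_forall fun x => ?_)
      rcases le_total 0 x with hx | hx
      · rw [max_eq_right hx]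
        exact norm_exp_le_weight_strip h1 h2 x
      · rw [max_eq_left hx]
        simpa using one_le_weight ε x
    -- The part below zero is collapsed to an atom at `0`, so it enters through its total mass, the
    -- transform at `0`.
    have h4 : laplace (reflected μ (n + 1)) s =
        laplace (((reflected μ n).conv μ).restrict (Set.Ici 0)) s +
        laplace (((reflected μ n).conv μ).restrict (Set.Ici 0)ᶜ) 0 := by
      rw [reflected, laplace, integral_map (by fun_prop) (aestronglyMeasurable_exp _ s),
        ← integral_add_compl (measurableSet_Ici (a := (0 : ℝ))) hint]
      congr 1
      · refine setIntegral_congr_fun measurableSet_Ici fun x hx => ?_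
        simp only [max_eq_right (Set.mem_Ici.1 hx)]
      · refine setIntegral_congr_fun measurableSet_Ici.compl fun x hx => ?_
        have hx' : max 0 x = 0 := max_eq_left (not_le.1 fun h : 0 ≤ x => hx h).le
        simp only [hx']
        simp
    rw [h4, undershoot]
    linear_combination z ^ n * h3
  have h4 := hasSum_genFun_shift hs1
  rw [show (reflected μ 0) = Measure.dirac 0 from rfl, laplace_dirac_zero, tsum_congr hrec,
    (hs1.mul_right _).tsum_add (hs3.sub hs2), hs3.tsum_sub hs2, tsum_mul_right] at h4
  simp only [genFun] at h4 ⊢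
  linear_combination h4

end Recursions

/-! ### The Wiener–Hopf factors. -/

theorem norm_laplace_le_real {α : Measure ℝ} [IsFiniteMeasure α] {s : ℂ}
    (h : ∀ᵐ x : ℝ ∂α, ‖Complex.exp (-s * (x : ℂ))‖ ≤ 1) : ‖laplace α s‖ ≤ α.real Set.univ := by
  have := norm_integral_le_of_norm_le_const h
  rwa [one_mul] at this

theorem tendsto_laplace_atTop {α : Measure ℝ} [IsFiniteMeasure α] (h : ∀ᵐ x ∂α, x < 0) :
    Tendsto (fun t : ℝ => laplace α (-(t : ℂ))) atTop (𝓝 0) := by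
  have h1 := tendsto_integral_filter_of_dominated_convergence (μ := α) (l := atTop)
    (F := fun (t : ℝ) (x : ℝ) => Complex.exp (-(-(t : ℂ)) * (x : ℂ))) (f := fun _ => 0)
    (fun _ => 1) (Eventually.of_forall fun t => aestronglyMeasurable_exp α _)
    (by
      filter_upwards [eventually_ge_atTop 0] with t ht
      filter_upwards [h] with x hx
      exact norm_exp_le_one_of_nonpos (by simpa using ht) hx.le)
    (integrable_const _) (by
      filter_upwards [h] with x hx
      rw [tendsto_zero_iff_norm_tendsto_zero]
      simp only [norm_exp_neg_mul]
      refine Real.tendsto_exp_atBot.comp ?_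
      simpa using tendsto_id.atTop_mul_const_of_neg hx)
  rwa [integral_zero] at h1

/-- Conservation of mass. It bounds the total exit mass by `1`, uniformly in the weight, and so
controls the factors up to `|z| = 1`. -/
theorem sum_leave_add_stay (μ : Measure ℝ) [IsProbabilityMeasure μ] {C : Set ℝ}
    (hC : MeasurableSet C) (N : ℕ) :
    ∑ n ∈ Finset.range N, (leave μ C n).real Set.univ + (stay μ C N).real Set.univ = 1 := by
  induction N with
  | zero => simp [stay]
  | succ N ih =>
    rw [Finset.sum_range_succ, ← ih, add_assoc]
    congr 1
    have h1 : (stay μ C (N + 1)).real Set.univ + (leave μ C N).real Set.univ =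
        ((stay μ C N).conv μ).real Set.univ := by
      rw [stay, leave, measureReal_restrict_apply_univ, measureReal_restrict_apply_univ]
      exact measureReal_add_measureReal_compl hC
    have h2 : ((stay μ C N).conv μ).real Set.univ = (stay μ C N).real Set.univ := by
      rw [Measure.conv, map_measureReal_apply (by fun_prop) MeasurableSet.univ, Set.preimage_univ,
        ← Set.univ_prod_univ, measureReal_prod_prod, probReal_univ (μ := μ), mul_one]
    linarith

theorem summable_leave (μ : Measure ℝ) [IsProbabilityMeasure μ] {C : Set ℝ}
    (hC : MeasurableSet C) : Summable fun n => (leave μ C n).real Set.univ :=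
  summable_of_sum_range_le (c := 1) (fun _ => measureReal_nonneg) fun N => by
    linarith [sum_leave_add_stay μ hC N, measureReal_nonneg (μ := stay μ C N) (s := Set.univ)]

theorem tsum_leave_le (μ : Measure ℝ) [IsProbabilityMeasure μ] {C : Set ℝ}
    (hC : MeasurableSet C) : ∑' n, (leave μ C n).real Set.univ ≤ 1 :=
  Real.tsum_le_of_sum_range_le (fun _ => measureReal_nonneg) fun N => by
    linarith [sum_leave_add_stay μ hC N, measureReal_nonneg (μ := stay μ C N) (s := Set.univ)]

/-- One minus the joint transform of the exit time from `C` and the exit position. -/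
def exitFactor (μ : Measure ℝ) (C : Set ℝ) (z s : ℂ) : ℂ := 1 - z * genFun z (leave μ C) s

section Factors

variable {μ : Measure ℝ} [IsProbabilityMeasure μ] {C : Set ℝ} {ε K : ℝ} {z : ℂ}

theorem norm_pow_mul_leave_le (hz : ‖z‖ ≤ 1) {s : ℂ}
    (h : ∀ n, ∀ᵐ x : ℝ ∂(leave μ C n), ‖Complex.exp (-s * (x : ℂ))‖ ≤ 1) (n : ℕ) :
    ‖z ^ n * laplace (leave μ C n) s‖ ≤ (leave μ C n).real Set.univ := by
  rw [norm_mul, norm_pow]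
  exact (mul_le_of_le_one_left (norm_nonneg _) (pow_le_one₀ (norm_nonneg _) hz)).trans
    (norm_laplace_le_real (h n))

theorem norm_exitFactor_sub_one_le (hC : MeasurableSet C) (hz : ‖z‖ ≤ 1) {s : ℂ}
    (h : ∀ n, ∀ᵐ x : ℝ ∂(leave μ C n), ‖Complex.exp (-s * (x : ℂ))‖ ≤ 1) :
    ‖exitFactor μ C z s - 1‖ ≤ ‖z‖ := by
  rw [exitFactor, sub_sub_cancel_left, norm_neg, norm_mul]
  refine mul_le_of_le_one_right (norm_nonneg _) ?_
  exact (tsum_of_norm_bounded (summable_leave μ hC).hasSum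
    (norm_pow_mul_leave_le hz h)).trans (tsum_leave_le μ hC)

theorem exitFactor_ne_zero (hC : MeasurableSet C) (hz : ‖z‖ < 1) {s : ℂ}
    (h : ∀ n, ∀ᵐ x : ℝ ∂(leave μ C n), ‖Complex.exp (-s * (x : ℂ))‖ ≤ 1) :
    exitFactor μ C z s ≠ 0 := by
  intro h0
  have h1 := norm_exitFactor_sub_one_le hC hz.le h
  rw [h0, zero_sub, norm_neg, norm_one] at h1
  linarith

theorem ae_leave_Ici (μ : Measure ℝ) (n : ℕ) : ∀ᵐ x ∂(leave μ (Set.Ici 0) n), x < 0 :=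
  (ae_leave_notMem μ measurableSet_Ici n).mono fun _ hx => not_le.1 hx

theorem ae_leave_Iio (μ : Measure ℝ) (n : ℕ) : ∀ᵐ x ∂(leave μ (Set.Iio 0) n), 0 ≤ x :=
  (ae_leave_notMem μ measurableSet_Iio n).mono fun _ hx => not_lt.1 hx

theorem ae_stay_Ici (μ : Measure ℝ) (n : ℕ) : ∀ᵐ x ∂(stay μ (Set.Ici 0) n), 0 ≤ x :=
  (ae_stay_mem μ measurableSet_Ici n).mono fun _ hx => hx.elim (fun h => h.ge) id

theorem ae_stay_Iio (μ : Measure ℝ) (n : ℕ) : ∀ᵐ x ∂(stay μ (Set.Iio 0) n), x ≤ 0 :=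
  (ae_stay_mem μ measurableSet_Iio n).mono fun _ hx =>
    hx.elim (fun h => h.le) fun h => le_of_lt h

theorem exitFactor_Ici_ne_zero (hz : ‖z‖ < 1) {s : ℂ} (hs : s.re ≤ 0) :
    exitFactor μ (Set.Ici 0) z s ≠ 0 :=
  exitFactor_ne_zero measurableSet_Ici hz fun n => (ae_leave_Ici μ n).mono fun _ hx =>
    norm_exp_le_one_of_nonpos hs hx.le

theorem exitFactor_Iio_ne_zero (hz : ‖z‖ < 1) {s : ℂ} (hs : 0 ≤ s.re) :
    exitFactor μ (Set.Iio 0) z s ≠ 0 :=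
  exitFactor_ne_zero measurableSet_Iio hz fun n => (ae_leave_Iio μ n).mono fun _ hx =>
    norm_exp_le_one_of_nonneg hs hx

theorem isOpen_re_gt (a : ℝ) : IsOpen {s : ℂ | a < s.re} :=
  isOpen_lt continuous_const Complex.continuous_re

theorem differentiableOn_exitFactor_Iio (hK : 0 ≤ K) (hz : ‖z‖ * K < 1)
    (hμ : weightMass ε μ ≤ ENNReal.ofReal K) :
    DifferentiableOn ℂ (exitFactor μ (Set.Iio 0) z) {s | -ε < s.re} :=
  ((differentiableOn_genFun hK hK hz (weightMass_leave_le hK hμ) (isOpen_re_gt _)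
    fun n => (ae_leave_Iio μ n).mono fun _ hx _ hs =>
      norm_exp_le_weight_nonneg (le_of_lt hs) hx).const_mul z).const_sub 1

theorem differentiableOn_exitFactor_Ici (hK : 0 ≤ K) (hz : ‖z‖ * K < 1)
    (hμ : weightMass ε μ ≤ ENNReal.ofReal K) :
    DifferentiableOn ℂ (exitFactor μ (Set.Ici 0) z) leftHalf :=
  ((differentiableOn_genFun hK hK hz (weightMass_leave_le hK hμ) isOpen_leftHalf
    fun n => (ae_leave_Ici μ n).mono fun _ hx _ hs =>
      (norm_exp_le_one_of_nonpos (le_of_lt hs) hx.le).trans (one_le_weight _ _)).const_mul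
        z).const_sub 1

theorem norm_exitFactor_le (hK : 0 ≤ K) (hz : ‖z‖ * K < 1)
    (hμ : weightMass ε μ ≤ ENNReal.ofReal K) {s : ℂ}
    (h : ∀ n, ∀ᵐ x : ℝ ∂(leave μ C n), ‖Complex.exp (-s * (x : ℂ))‖ ≤ weight ε x) :
    ‖exitFactor μ C z s‖ ≤ 1 + ‖z‖ * (K * (1 - ‖z‖ * K)⁻¹) := by
  refine (norm_sub_le _ _).trans ?_
  rw [norm_one, norm_mul]
  gcongr
  exact norm_genFun_le hK hK hz (weightMass_leave_le hK hμ) h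

/-- A bounded multiple of the ascending factor which is bounded holomorphic on the left is
constant. -/
theorem exists_const_mul_exitFactor (hε : 0 < ε) (hK : 0 ≤ K) (hz : ‖z‖ * K < 1)
    (hμ : weightMass ε μ ≤ ENNReal.ofReal K) {φ ψ : ℂ → ℂ} {M : ℝ}
    (hφ : DifferentiableOn ℂ φ {s | -ε < s.re}) (hφb : ∀ s, -ε < s.re → ‖φ s‖ ≤ M)
    (hψ : DifferentiableOn ℂ ψ leftHalf) (hψb : ∀ s ∈ leftHalf, ‖ψ s‖ ≤ M)
    (heq : ∀ s, -ε < s.re → s.re < 0 → (1 - z * laplace μ s) * φ s = ψ s) :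
    ∃ c : ℂ, (∀ s, -ε < s.re → φ s * exitFactor μ (Set.Iio 0) z s = c) ∧
      ∀ s ∈ leftHalf, ψ s * genFun z (stay μ (Set.Iio 0)) s = c := by
  have hM : 0 ≤ M := (norm_nonneg _).trans (hφb 0 (by simpa using hε))
  set R : ℝ := (1 - ‖z‖ * K)⁻¹ with hR
  have hR0 : 0 ≤ R := inv_nonneg.2 (by linarith)
  have hsb : ∀ s ∈ leftHalf, ‖genFun z (stay μ (Set.Iio 0)) s‖ ≤ R := by
    intro s hs
    have := norm_genFun_le zero_le_one hK hz (weightMass_stay_le (C := Set.Iio 0) hK hμ) (s := s)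
      fun n => (ae_stay_Iio μ n).mono fun _ hx =>
        (norm_exp_le_one_of_nonpos (le_of_lt hs) hx).trans (one_le_weight _ _)
    rwa [one_mul] at this
  have hsd : DifferentiableOn ℂ (genFun z (stay μ (Set.Iio 0))) leftHalf :=
    differentiableOn_genFun zero_le_one hK hz (weightMass_stay_le hK hμ) isOpen_leftHalf
      fun n => (ae_stay_Iio μ n).mono fun _ hx _ hs =>
        (norm_exp_le_one_of_nonpos (le_of_lt hs) hx).trans (one_le_weight _ _)
  have hgb : ∀ s : ℂ, -ε < s.re → ‖exitFactor μ (Set.Iio 0) z s‖ ≤ 1 + ‖z‖ * (K * R) :=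
    fun s hs => norm_exitFactor_le hK hz hμ fun n => (ae_leave_Iio μ n).mono fun _ hx =>
      norm_exp_le_weight_nonneg hs.le hx
  have hzKR : 0 ≤ ‖z‖ * (K * R) := by positivity
  -- For the exit from `(-∞, 0)`, `1 - z laplace μ` times the staying series is the exit factor.
  -- Thus `φ` times the exit factor continues to the left as `ψ` times the staying series, and
  -- Liouville applies.
  obtain ⟨c, hc1, hc2⟩ := exists_const_of_bounded_strip (α := -ε) (β := 0)
    (f₁ := fun s => φ s * exitFactor μ (Set.Iio 0) z s)
    (f₂ := fun s => ψ s * genFun z (stay μ (Set.Iio 0)) s)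
    (C := M * (1 + ‖z‖ * (K * R)) + M * R) (by linarith)
    (hφ.mul (differentiableOn_exitFactor_Iio hK hz hμ)) (hψ.mul hsd) (by
      intro s h1 h2
      have h3 := wienerHopf_relation (C := Set.Iio 0) measurableSet_Iio hK hz hμ h1.le h2.le
      rw [exitFactor, ← h3, ← heq s h1 h2]
      ring) (by
      intro s hs
      rw [norm_mul]
      have := mul_le_mul (hφb s hs) (hgb s hs) (norm_nonneg _) hM
      have := mul_nonneg hM hR0
      linarith) (by
      intro s hs
      rw [norm_mul]
      have := mul_le_mul (hψb s hs) (hsb s hs) (norm_nonneg _) hM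
      have : 0 ≤ M * (1 + ‖z‖ * (K * R)) := by positivity
      linarith)
  exact ⟨c, hc1, hc2⟩

theorem tendsto_genFun_atTop {c : ℝ} {α : ℕ → Measure ℝ} [∀ n, IsFiniteMeasure (α n)] (hc : 0 ≤ c)
    (hK : 0 ≤ K) (hz : ‖z‖ * K < 1)
    (hα : ∀ n, weightMass ε (α n) ≤ ENNReal.ofReal (c * K ^ n)) (h : ∀ n, ∀ᵐ x ∂(α n), x < 0) :
    Tendsto (fun t : ℝ => genFun z α (-(t : ℂ))) atTop (𝓝 0) := by
  have h1 := tendsto_tsum_of_dominated_convergence (𝓕 := atTop)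
    (f := fun (t : ℝ) n => z ^ n * laplace (α n) (-(t : ℂ))) (g := fun _ => (0 : ℂ))
    (bound := fun n => c * (‖z‖ * K) ^ n)
    ((summable_geometric_of_lt_one (by positivity) hz).mul_left c) (fun n => by
      simpa using (tendsto_laplace_atTop (h n)).const_mul (z ^ n)) (by
      filter_upwards [eventually_ge_atTop 0] with t ht n
      exact norm_pow_mul_laplace_le hc hK hα (fun n => (h n).mono fun x hx =>
        (norm_exp_le_one_of_nonpos (by simpa using ht) hx.le).trans (one_le_weight _ _)) n)
  rwa [tsum_zero] at h1

/-- The Wiener–Hopf factorisation. -/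
theorem wienerHopf_factorization (hε : 0 < ε) (hK : 0 ≤ K) (hz : ‖z‖ * K < 1)
    (hμ : weightMass ε μ ≤ ENNReal.ofReal K) :
    (∀ s : ℂ, -ε < s.re → s.re ≤ 0 →
      1 - z * laplace μ s = exitFactor μ (Set.Ici 0) z s * exitFactor μ (Set.Iio 0) z s) ∧
    ∀ s ∈ leftHalf, exitFactor μ (Set.Ici 0) z s * genFun z (stay μ (Set.Iio 0)) s = 1 := by
  set R : ℝ := (1 - ‖z‖ * K)⁻¹ with hR
  have hR0 : 0 ≤ R := inv_nonneg.2 (by linarith)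
  have hwh := fun (s : ℂ) (h1 : -ε < s.re) (h2 : s.re ≤ 0) =>
    wienerHopf_relation (C := Set.Ici 0) measurableSet_Ici hK hz hμ h1.le h2
  have hzKR : 0 ≤ ‖z‖ * (K * R) := by positivity
  obtain ⟨c, hc1, hc2⟩ := exists_const_mul_exitFactor (φ := genFun z (stay μ (Set.Ici 0)))
    (ψ := exitFactor μ (Set.Ici 0) z) (M := R + (1 + ‖z‖ * (K * R))) hε hK hz hμ
    (differentiableOn_genFun zero_le_one hK hz (weightMass_stay_le hK hμ) (isOpen_re_gt _)
      fun n => (ae_stay_Ici μ n).mono fun _ hx _ hs => norm_exp_le_weight_nonneg (le_of_lt hs) hx)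
    (fun s hs => by
      have := norm_genFun_le zero_le_one hK hz (weightMass_stay_le (C := Set.Ici 0) hK hμ) (s := s)
        fun n => (ae_stay_Ici μ n).mono fun _ hx => norm_exp_le_weight_nonneg hs.le hx
      rw [one_mul] at this
      linarith)
    (differentiableOn_exitFactor_Ici hK hz hμ)
    (fun s hs => by
      have := norm_exitFactor_le (C := Set.Ici 0) hK hz hμ (s := s) fun n =>
        (ae_leave_Ici μ n).mono fun _ hx =>
          (norm_exp_le_one_of_nonpos (le_of_lt hs) hx.le).trans (one_le_weight _ _)
      linarith)
    (fun s h1 h2 => hwh s h1 h2.le)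
  -- As `s → -∞` along the reals, measures carried by `x < 0` have vanishing transforms. What
  -- remains is the constant `1` in the exit factor and the unit mass at time `0` in the staying
  -- series.
  have hc : c = 1 := by
    have hl1 : Tendsto (fun t : ℝ => exitFactor μ (Set.Ici 0) z (-(t : ℂ))) atTop (𝓝 1) := by
      have := ((tendsto_genFun_atTop hK hK hz (weightMass_leave_le (C := Set.Ici 0) hK hμ)
        (ae_leave_Ici μ)).const_mul z).const_sub 1
      simpa [exitFactor] using this
    have hl2 : Tendsto (fun t : ℝ => genFun z (stay μ (Set.Iio 0)) (-(t : ℂ))) atTop (𝓝 1) := by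
      have h1 : ∀ n, weightMass ε (stay μ (Set.Iio 0) (n + 1)) ≤ ENNReal.ofReal (K * K ^ n) := by
        intro n
        have := weightMass_stay_le (C := Set.Iio 0) hK hμ (n + 1)
        rwa [one_mul, pow_succ'] at this
      have h2 : ∀ n, ∀ᵐ x ∂(stay μ (Set.Iio 0) (n + 1)), x < 0 := fun n => by
        rw [stay]
        exact ae_restrict_mem measurableSet_Iio
      have h3 := ((tendsto_genFun_atTop hK hK hz h1 h2).const_mul z).const_add 1
      rw [mul_zero, add_zero] at h3
      refine h3.congr' ?_
      filter_upwards [eventually_ge_atTop 0] with t ht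
      have h4 := summable_genFun zero_le_one hK hz (weightMass_stay_le (C := Set.Iio 0) hK hμ)
        (s := -(t : ℂ)) fun n => (ae_stay_Iio μ n).mono fun _ hx =>
          (norm_exp_le_one_of_nonpos (by simpa using ht) hx).trans (one_le_weight _ _)
      rw [hasSum_genFun_shift h4, show (stay μ (Set.Iio 0) 0) = Measure.dirac 0 from rfl,
        laplace_dirac_zero]
      rfl
    have hl := hl1.mul hl2
    rw [mul_one] at hl
    refine tendsto_nhds_unique (tendsto_const_nhds.congr' ?_) hl
    filter_upwards [eventually_gt_atTop 0] with t ht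
    exact (hc2 (-(t : ℂ)) (by simpa [leftHalf] using ht)).symm
  rw [hc] at hc1 hc2
  refine ⟨fun s h1 h2 => ?_, hc2⟩
  calc 1 - z * laplace μ s = (1 - z * laplace μ s) * (genFun z (stay μ (Set.Ici 0)) s *
        exitFactor μ (Set.Iio 0) z s) := by rw [hc1 s h1, mul_one]
    _ = _ := by rw [← mul_assoc, hwh s h1 h2, exitFactor, exitFactor]

/-- The transform of the reflected walk in terms of the ascending factor. -/
theorem genFun_reflected_mul_exitFactor (hε : 0 < ε) (hK : 0 ≤ K) (hz : ‖z‖ * K < 1)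
    (hz1 : ‖z‖ < 1) (hμ : weightMass ε μ ≤ ENNReal.ofReal K) {s : ℂ} (hs : -ε < s.re) :
    (1 - z) * genFun z (reflected μ) s * exitFactor μ (Set.Iio 0) z s =
      exitFactor μ (Set.Iio 0) z 0 := by
  set R : ℝ := (1 - ‖z‖ * K)⁻¹ with hR
  have hR0 : 0 ≤ R := inv_nonneg.2 (by linarith)
  have hub : ∀ s : ℂ, s.re ≤ 0 → ∀ n, ∀ᵐ x : ℝ ∂(undershoot μ n),
      ‖Complex.exp (-s * (x : ℂ))‖ ≤ weight ε x := fun s hs n => (ae_undershoot_neg μ n).mono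
    fun _ hx => (norm_exp_le_one_of_nonpos hs hx.le).trans (one_le_weight _ _)
  have hun : ∀ s : ℂ, s.re ≤ 0 → ‖genFun z (undershoot μ) s‖ ≤ K * R := fun s hs =>
    norm_genFun_le hK hK hz (weightMass_undershoot_le hε.le hK hμ) (hub s hs)
  obtain ⟨c, hc, -⟩ := exists_const_mul_exitFactor (φ := genFun z (reflected μ))
    (ψ := fun s => 1 + z * (genFun z (undershoot μ) 0 - genFun z (undershoot μ) s))
    (M := R + (1 + ‖z‖ * (K * R + K * R))) hε hK hz hμ
    (differentiableOn_genFun zero_le_one hK hz (weightMass_reflected_le hε.le hK hμ)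
      (isOpen_re_gt _) fun n => (ae_reflected_nonneg μ n).mono fun _ hx _ hs =>
        norm_exp_le_weight_nonneg (le_of_lt hs) hx)
    (fun s hs => by
      have := norm_genFun_le zero_le_one hK hz (weightMass_reflected_le hε.le hK hμ) (s := s)
        fun n => (ae_reflected_nonneg μ n).mono fun _ hx => norm_exp_le_weight_nonneg hs.le hx
      rw [one_mul] at this
      have : 0 ≤ ‖z‖ * (K * R + K * R) := by positivity
      linarith)
    ((((differentiableOn_genFun hK hK hz (weightMass_undershoot_le hε.le hK hμ) isOpen_leftHalf
      fun n => (ae_undershoot_neg μ n).mono fun _ hx _ hs =>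
        (norm_exp_le_one_of_nonpos (le_of_lt hs) hx.le).trans (one_le_weight _ _)).const_sub
          _).const_mul z).const_add 1)
    (fun s hs => by
      refine (norm_add_le _ _).trans ?_
      rw [norm_one, norm_mul]
      have h1 : ‖genFun z (undershoot μ) 0 - genFun z (undershoot μ) s‖ ≤ K * R + K * R :=
        (norm_sub_le _ _).trans (add_le_add (hun 0 le_rfl) (hun s (le_of_lt hs)))
      have := mul_le_mul_of_nonneg_left h1 (norm_nonneg z)
      linarith)
    (fun s h1 h2 => reflected_relation hε.le hK hz hμ h1.le h2.le)
  -- The reflected laws have mass `1`, so their generating function at `s = 0` is geometric. This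
  -- fixes the constant from Liouville's theorem.
  have h0 : genFun z (reflected μ) 0 = (1 - z)⁻¹ := by
    simp only [genFun, laplace_zero, probReal_univ, Complex.ofReal_one, mul_one]
    exact tsum_geometric_of_norm_lt_one hz1
  have h1 : (1 - z) ≠ 0 := by
    intro h
    rw [← sub_eq_zero.1 h, norm_one] at hz1
    exact lt_irrefl _ hz1
  have h2 := hc 0 (by simpa using hε)
  rw [h0] at h2
  rw [mul_assoc, hc s hs, ← h2, ← mul_assoc, mul_inv_cancel₀ h1, one_mul]

end Factors

/-! ### Mean values on the imaginary axis and the ladder polynomial. -/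

theorem tendsto_eval_div_pow {ι : Type*} {l : Filter ι} {s : ι → ℂ}
    (hs : Tendsto s l (Bornology.cobounded ℂ)) {W : Polynomial ℂ} {n : ℕ} (hW : W.natDegree ≤ n) :
    Tendsto (fun i => W.eval (s i) / s i ^ n) l (𝓝 (W.coeff n)) := by
  have hinv : Tendsto (fun i => (s i)⁻¹) l (𝓝 0) := tendsto_inv₀_cobounded.comp hs
  have hne : ∀ᶠ i in l, s i ≠ 0 := hs.eventually (Bornology.eventually_ne_cobounded 0)
  have h1 : Tendsto (fun i => ∑ k ∈ Finset.range (n + 1), W.coeff k * ((s i)⁻¹) ^ (n - k)) l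
      (𝓝 (∑ k ∈ Finset.range (n + 1), W.coeff k * (0 : ℂ) ^ (n - k))) :=
    tendsto_finsetSum _ fun k _ => (hinv.pow _).const_mul _
  have h2 : ∑ k ∈ Finset.range (n + 1), W.coeff k * (0 : ℂ) ^ (n - k) = W.coeff n := by
    rw [Finset.sum_range_succ, Finset.sum_eq_zero]
    · simp
    · intro k hk
      rw [zero_pow (Nat.sub_ne_zero_of_lt (Finset.mem_range.1 hk)), mul_zero]
  rw [h2] at h1
  refine h1.congr' ?_
  filter_upwards [hne] with i hi
  rw [Polynomial.eval_eq_sum_range' (Nat.lt_succ_of_le hW), Finset.sum_div]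
  refine Finset.sum_congr rfl fun k hk => ?_
  rw [mul_div_assoc, inv_pow]
  congr 1
  rw [eq_div_iff (pow_ne_zero _ hi), inv_mul_eq_div, div_eq_iff (pow_ne_zero _ hi), ← pow_add]
  congr 1
  have := Finset.mem_range.1 hk
  omega

theorem tendsto_ofReal_cobounded : Tendsto (fun x : ℝ => (x : ℂ)) atTop (Bornology.cobounded ℂ) := by
  rw [← tendsto_norm_atTop_iff_cobounded]
  simpa using tendsto_abs_atTop_atTop

theorem tendsto_mul_I_cobounded :
    Tendsto (fun x : ℝ => (x : ℂ) * Complex.I) atTop (Bornology.cobounded ℂ) := by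
  rw [← tendsto_norm_atTop_iff_cobounded]
  simpa using tendsto_abs_atTop_atTop

theorem natDegree_le_of_growth {W : Polynomial ℂ} {n : ℕ} {C : ℝ}
    (h : ∀ x : ℝ, 0 ≤ x → ‖W.eval (x : ℂ)‖ ≤ C * (1 + x) ^ n) : W.natDegree ≤ n := by
  by_contra! hn
  have h1 := (tendsto_eval_div_pow tendsto_ofReal_cobounded (le_refl W.natDegree)).norm
  have hp : Tendsto (fun x : ℝ => (1 + x) ^ n / x ^ W.natDegree) atTop (𝓝 0) := by
    have h2 := Polynomial.div_tendsto_atTop_zero_of_degree_lt ((1 + Polynomial.X : Polynomial ℝ) ^ n)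
      (Polynomial.X ^ W.natDegree) (by
        rw [Polynomial.degree_X_pow, Polynomial.degree_pow, add_comm, ← Polynomial.C_1,
          Polynomial.degree_X_add_C]
        simpa using hn)
    simpa using h2
  have h3 := hp.const_mul C
  rw [mul_zero] at h3
  have h4 : ‖W.coeff W.natDegree‖ ≤ 0 := by
    refine le_of_tendsto_of_tendsto h1 h3 ?_
    filter_upwards [eventually_gt_atTop 0] with x hx
    rw [norm_div, norm_pow, Complex.norm_real, Real.norm_of_nonneg hx.le, ← mul_div_assoc]
    gcongr
    exact h x hx.le
  rw [norm_le_zero_iff, Polynomial.coeff_natDegree, Polynomial.leadingCoeff_eq_zero] at h4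
  rw [h4, Polynomial.natDegree_zero] at hn
  omega

/-- The average of a function over `[T, 2 T]`. -/
def average (f : ℝ → ℂ) (T : ℝ) : ℂ := (T : ℂ)⁻¹ * ∫ y in T..2 * T, f y

theorem norm_average_le {f : ℝ → ℂ} {T c : ℝ} (hT : 0 < T) (h : ∀ y, T ≤ y → ‖f y‖ ≤ c) :
    ‖average f T‖ ≤ c := by
  have h1 := intervalIntegral.norm_integral_le_of_norm_le_const (a := T) (b := 2 * T) (f := f)
    (C := c) fun y hy => h y (by
      rw [Set.uIoc_of_le (by linarith)] at hy
      exact hy.1.le)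
  rw [average, norm_mul, norm_inv, Complex.norm_real, Real.norm_of_nonneg hT.le,
    inv_mul_le_iff₀ hT, mul_comm T]
  refine h1.trans_eq ?_
  rw [abs_of_nonneg (by linarith)]
  ring

theorem tendsto_average_of_tendsto_zero {f : ℝ → ℂ} (h : Tendsto f atTop (𝓝 0)) :
    Tendsto (average f) atTop (𝓝 0) := by
  rw [Metric.tendsto_atTop] at h ⊢
  intro ε hε
  obtain ⟨N, hN⟩ := h (ε / 2) (half_pos hε)
  refine ⟨max N 1, fun T hT => ?_⟩
  rw [dist_zero_right]
  refine (norm_average_le (by linarith [le_max_right N 1]) fun y hy => ?_).trans_lt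
    (half_lt_self hε)
  have := (hN y (by linarith [le_max_left N 1])).le
  rwa [dist_zero_right] at this

theorem average_add {f g : ℝ → ℂ} (hf : Continuous f) (hg : Continuous g) (T : ℝ) :
    average (fun y => f y + g y) T = average f T + average g T := by
  rw [average, intervalIntegral.integral_add (hf.intervalIntegrable _ _)
    (hg.intervalIntegrable _ _), mul_add, average, average]

theorem average_const_mul (c : ℂ) (f : ℝ → ℂ) (T : ℝ) :
    average (fun y => c * f y) T = c * average f T := by
  rw [average, intervalIntegral.integral_const_mul, average]
  ring

theorem average_const {T : ℝ} (hT : 0 < T) (c : ℂ) : average (fun _ => c) T = c := by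
  rw [average, intervalIntegral.integral_const, Complex.real_smul, ← mul_assoc]
  have : (T : ℂ) ≠ 0 := by exact_mod_cast hT.ne'
  push_cast
  field_simp
  ring

theorem norm_exp_I (y x : ℝ) : ‖Complex.exp (-((y : ℂ) * Complex.I) * (x : ℂ))‖ = 1 := by
  rw [norm_exp_neg_mul]
  simp

theorem continuous_laplace_I (α : Measure ℝ) [IsFiniteMeasure α] :
    Continuous fun y : ℝ => laplace α ((y : ℂ) * Complex.I) :=
  continuous_of_dominated (fun y => aestronglyMeasurable_exp α _)
    (fun y => Eventually.of_forall fun x => (norm_exp_I y x).le) (integrable_const 1)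
    (Eventually.of_forall fun x => by fun_prop)

/-- The mean value of the Fourier transform of a measure without an atom at the origin. -/
theorem tendsto_average_laplace {α : Measure ℝ} [IsFiniteMeasure α] (h0 : ∀ᵐ x ∂α, x ≠ 0) :
    Tendsto (average fun y : ℝ => laplace α ((y : ℂ) * Complex.I)) atTop (𝓝 0) := by
  set k : ℝ → ℝ → ℂ := fun T x =>
    average (fun y : ℝ => Complex.exp (-((y : ℂ) * Complex.I) * (x : ℂ))) T with hk
  have hswap : ∀ T, average (fun y : ℝ => laplace α ((y : ℂ) * Complex.I)) T =
      ∫ x, k T x ∂α := by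
    intro T
    simp only [hk, average, laplace]
    rw [integral_const_mul]
    congr 1
    have hfin : IsFiniteMeasure (volume.restrict (Set.uIoc T (2 * T))) := ⟨by simp [Set.uIoc]⟩
    refine intervalIntegral_integral_swap ?_
    refine Integrable.of_bound (C := 1) ?_ ?_
    · exact (by fun_prop : Measurable _).aestronglyMeasurable
    · exact Eventually.of_forall fun p => (norm_exp_I p.1 p.2).le
  have h1 := tendsto_integral_filter_of_dominated_convergence (μ := α) (l := atTop) (F := k)
    (f := fun _ => 0) (fun _ => 1) ?_ ?_ (integrable_const _) ?_
  · rw [integral_zero] at h1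
    exact h1.congr fun T => (hswap T).symm
  · refine Eventually.of_forall fun T => Continuous.aestronglyMeasurable ?_
    refine continuous_const.mul ?_
    exact intervalIntegral.continuous_parametric_intervalIntegral_of_continuous' (by fun_prop) _ _
  · filter_upwards [eventually_gt_atTop 0] with T hT
    exact Eventually.of_forall fun x => norm_average_le hT fun y _ => (norm_exp_I y x).le
  · filter_upwards [h0] with x hx
    rw [tendsto_zero_iff_norm_tendsto_zero]
    have hc : -(Complex.I * (x : ℂ)) ≠ 0 :=
      neg_ne_zero.2 (mul_ne_zero Complex.I_ne_zero (by exact_mod_cast hx))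
    -- The oscillating exponential has the explicit primitive with divisor `x ≠ 0`, so its integral
    -- is at most `2 / |x|` and its average decays like `1 / T`.
    have hle : ∀ᶠ T : ℝ in atTop, ‖k T x‖ ≤ 2 / |x| * T⁻¹ := by
      filter_upwards [eventually_gt_atTop 0] with T hT
      have h2 : ∀ y : ℝ, Complex.exp (-((y : ℂ) * Complex.I) * (x : ℂ)) =
          Complex.exp (-(Complex.I * (x : ℂ)) * y) := fun y => by
        congr 1
        ring
      have hn : ∀ y : ℝ, ‖Complex.exp (-(Complex.I * (x : ℂ)) * y)‖ = 1 := fun y => by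
        rw [← h2, norm_exp_I]
      simp only [hk, average, h2]
      rw [integral_exp_mul_complex hc, norm_mul, norm_inv, Complex.norm_real,
        Real.norm_of_nonneg hT.le, norm_div, norm_neg, norm_mul, Complex.norm_I, one_mul,
        Complex.norm_real, Real.norm_eq_abs, mul_comm]
      refine mul_le_mul_of_nonneg_right ?_ (inv_nonneg.2 hT.le)
      refine div_le_div_of_nonneg_right ?_ (abs_nonneg _)
      refine (norm_sub_le _ _).trans ?_
      rw [hn, hn]
      norm_num
    refine squeeze_zero' (Eventually.of_forall fun _ => norm_nonneg _) hle ?_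
    simpa using tendsto_inv_atTop_zero.const_mul (2 / |x|)

theorem tendsto_average_tsum {f : ℕ → ℝ → ℂ} {b : ℕ → ℝ} (hf : ∀ n, Continuous (f n))
    (hb : Summable b) (hfb : ∀ n y, ‖f n y‖ ≤ b n)
    (h0 : ∀ n, Tendsto (average (f n)) atTop (𝓝 0)) :
    Tendsto (average fun y => ∑' n, f n y) atTop (𝓝 0) := by
  have h1 : ∀ T, average (fun y => ∑' n, f n y) T = ∑' n, average (f n) T := by
    intro T
    have h2 := intervalIntegral.hasSum_integral_of_dominated_convergence (μ := volume) (a := T)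
      (b := 2 * T) (F := f) (f := fun y => ∑' n, f n y) (fun n _ => b n)
      (fun n => (hf n).aestronglyMeasurable) (fun n => Eventually.of_forall fun y _ => hfb n y)
      (Eventually.of_forall fun y _ => hb) (intervalIntegrable_const)
      (Eventually.of_forall fun y _ => (Summable.of_norm_bounded hb fun n => hfb n y).hasSum)
    simp only [average]
    rw [tsum_mul_left, h2.tsum_eq]
  have h2 := tendsto_tsum_of_dominated_convergence (𝓕 := atTop) (f := fun T n => average (f n) T)
    (g := fun _ => (0 : ℂ)) hb h0 (by
      filter_upwards [eventually_gt_atTop 0] with T hT n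
      exact norm_average_le hT fun y _ => hfb n y)
  rw [tsum_zero] at h2
  exact h2.congr fun T => (h1 T).symm

/-- The ascending Wiener–Hopf factor is a quotient of monic polynomials of the same degree. -/
theorem exists_ladder_polynomial {μ : Measure ℝ} [IsProbabilityMeasure μ] {ε K : ℝ} {z : ℂ}
    (hμ0 : ∀ᵐ x ∂μ, x ≠ 0) (hε : 0 < ε) (hK : 0 ≤ K) (hz : ‖z‖ * K < 1) (hz1 : ‖z‖ < 1)
    (hμ : weightMass ε μ ≤ ENNReal.ofReal K) {q : Polynomial ℂ} (hq : q.Monic)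
    (hq0 : ∀ s : ℂ, 0 ≤ s.re → q.eval s ≠ 0) {G : ℂ → ℂ} (hG : DifferentiableOn ℂ G leftHalf)
    {C : ℝ} {m : ℕ} (hGb : ∀ w ∈ leftHalf, ‖G w‖ ≤ C * (1 + ‖w‖) ^ m)
    (hqG : ∀ s : ℂ, -ε < s.re → s.re < 0 → q.eval s * laplace μ s = G s) :
    ∃ W : Polynomial ℂ, W.Monic ∧ W.natDegree = q.natDegree ∧
      (∀ s : ℂ, -ε < s.re → W.eval s = q.eval s * exitFactor μ (Set.Iio 0) z s) ∧
      ∀ w ∈ leftHalf, q.eval w - z * G w = W.eval w * exitFactor μ (Set.Ici 0) z w := by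
  obtain ⟨hfac, hinv⟩ := wienerHopf_factorization hε hK hz hμ
  set n := q.natDegree with hn
  set R : ℝ := (1 - ‖z‖ * K)⁻¹ with hR
  have hR0 : 0 ≤ R := inv_nonneg.2 (by linarith)
  obtain ⟨Kq, hKq0, hKq⟩ : ∃ Kq : ℝ, 0 ≤ Kq ∧ ∀ u, ‖q.eval u‖ ≤ Kq * (1 + ‖u‖) ^ n := by
    have hc : ∀ i, ‖q.coeff i‖ ≤ ∑ i ∈ Finset.range (n + 1), ‖q.coeff i‖ := by
      intro i
      by_cases hi : i < n + 1
      · exact Finset.single_le_sum (f := fun i => ‖q.coeff i‖) (fun _ _ => norm_nonneg _)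
          (Finset.mem_range.2 hi)
      · rw [Polynomial.coeff_eq_zero_of_natDegree_lt (by omega), norm_zero]
        exact Finset.sum_nonneg fun _ _ => norm_nonneg _
    have h0 : 0 ≤ ∑ i ∈ Finset.range (n + 1), ‖q.coeff i‖ :=
      Finset.sum_nonneg fun _ _ => norm_nonneg _
    exact ⟨_, by positivity, norm_eval_le_of_coeff le_rfl hc⟩
  have hC0 : 0 ≤ C := by
    have h := (norm_nonneg _).trans (hGb (-1) (by simp [leftHalf]))
    exact nonneg_of_mul_nonneg_left h (by positivity)
  have hsb : ∀ s ∈ leftHalf, ‖genFun z (stay μ (Set.Iio 0)) s‖ ≤ R := by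
    intro s hs
    have := norm_genFun_le zero_le_one hK hz (weightMass_stay_le (C := Set.Iio 0) hK hμ) (s := s)
      fun n => (ae_stay_Iio μ n).mono fun _ hx =>
        (norm_exp_le_one_of_nonpos (le_of_lt hs) hx).trans (one_le_weight _ _)
    rwa [one_mul] at this
  have hsd : DifferentiableOn ℂ (genFun z (stay μ (Set.Iio 0))) leftHalf :=
    differentiableOn_genFun zero_le_one hK hz (weightMass_stay_le hK hμ) isOpen_leftHalf
      fun n => (ae_stay_Iio μ n).mono fun _ hx _ hs =>
        (norm_exp_le_one_of_nonpos (le_of_lt hs) hx).trans (one_le_weight _ _)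
  set M : ℝ := 1 + ‖z‖ * (K * R) with hM
  have hM0 : 0 ≤ M := by positivity
  have hgb : ∀ s : ℂ, -ε < s.re → ‖exitFactor μ (Set.Iio 0) z s‖ ≤ M :=
    fun s hs => norm_exitFactor_le hK hz hμ fun n => (ae_leave_Iio μ n).mono fun _ hx =>
      norm_exp_le_weight_nonneg hs.le hx
  have hright : ∀ s : ℂ, -ε < s.re → ‖q.eval s * exitFactor μ (Set.Iio 0) z s‖ ≤
      Kq * M * (1 + ‖s‖) ^ n := by
    intro s hs
    rw [norm_mul]
    calc _ ≤ Kq * (1 + ‖s‖) ^ n * M := mul_le_mul (hKq s) (hgb s hs) (norm_nonneg _) (by positivity)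
      _ = _ := by ring
  -- The left-hand function is `q - z G` times the staying series for `(-∞, 0)`, which is the
  -- inverse of the descending factor. Any polynomial growth of `G` suffices here; the sharp degree
  -- comes afterwards from the bound along the positive reals.
  obtain ⟨W, hW1, hW2⟩ := exists_polynomial_of_growth_strip (α := -ε) (β := 0) (γ := -ε / 2)
    (f₁ := fun s => q.eval s * exitFactor μ (Set.Iio 0) z s)
    (f₂ := fun s => (q.eval s - z * G s) * genFun z (stay μ (Set.Iio 0)) s)
    (C := Kq * M + (Kq + ‖z‖ * C) * R) (m := n + m) (by linarith)
    ((Polynomial.differentiable _).differentiableOn.mul (differentiableOn_exitFactor_Iio hK hz hμ))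
    (((Polynomial.differentiable _).differentiableOn.sub (hG.const_mul z)).mul hsd) (by
      intro s h1 h2
      have h3 := wienerHopf_relation (C := Set.Iio 0) measurableSet_Iio hK hz hμ h1.le h2.le
      rw [exitFactor, ← h3, ← hqG s h1 h2]
      ring) (by linarith) (by linarith) (by
      intro s hs
      have h1 : 1 ≤ 1 + ‖s‖ := by linarith [norm_nonneg s]
      refine (hright s (by linarith)).trans ?_
      have h2 : 0 ≤ (Kq + ‖z‖ * C) * R := by positivity
      refine mul_le_mul (by linarith) (pow_le_pow_right₀ h1 (by omega)) (by positivity)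
        (by positivity)) (by
      intro s hs
      have hs' : s ∈ leftHalf := by
        have : s.re < 0 := by linarith
        exact this
      have h1 : 1 ≤ 1 + ‖s‖ := by linarith [norm_nonneg s]
      rw [norm_mul]
      have h2 : ‖q.eval s - z * G s‖ ≤ (Kq + ‖z‖ * C) * (1 + ‖s‖) ^ (n + m) := by
        refine (norm_sub_le _ _).trans ?_
        rw [norm_mul, add_mul, mul_assoc]
        refine add_le_add ((hKq s).trans ?_) (mul_le_mul_of_nonneg_left ((hGb s hs').trans ?_)
          (norm_nonneg _))
        · exact mul_le_mul_of_nonneg_left (pow_le_pow_right₀ h1 (by omega)) hKq0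
        · exact mul_le_mul_of_nonneg_left (pow_le_pow_right₀ h1 (by omega)) hC0
      calc _ ≤ (Kq + ‖z‖ * C) * (1 + ‖s‖) ^ (n + m) * R :=
            mul_le_mul h2 (hsb s hs') (norm_nonneg _) (by positivity)
        _ = (Kq + ‖z‖ * C) * R * (1 + ‖s‖) ^ (n + m) := by ring
        _ ≤ _ := by
          refine mul_le_mul_of_nonneg_right ?_ (by positivity)
          have : 0 ≤ Kq * M := by positivity
          linarith)
  have hWn : W.natDegree ≤ n := by
    refine natDegree_le_of_growth (C := Kq * M) fun x hx => ?_
    have h1 : -ε < ((x : ℂ)).re := by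
      rw [Complex.ofReal_re]
      linarith
    have h2 := hright x h1
    rw [hW1 x h1, Complex.norm_real, Real.norm_of_nonneg hx] at h2
    exact h2
  have hleft : ∀ w ∈ leftHalf, q.eval w - z * G w = W.eval w * exitFactor μ (Set.Ici 0) z w := by
    intro w hw
    rw [← hW2 w hw]
    linear_combination -(q.eval w - z * G w) * hinv w hw
  -- On the imaginary axis `1 - z laplace μ = f₋ W / q`, with `W / q → lam` and `f₋` bounded.
  -- Neither `μ` nor the exit laws below `0` have an atom at `0`, so their transforms have mean zero
  -- along the axis. Comparing means of both sides gives `1 = lam`. The transforms themselves need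
  -- not tend to zero, hence the averages.
  have hlam : W.coeff n = 1 := by
    have hre : ∀ y : ℝ, ((y : ℂ) * Complex.I).re = 0 := fun y => by simp
    set lam := W.coeff n with hlam
    have hRt : Tendsto (fun y : ℝ => W.eval ((y : ℂ) * Complex.I) / q.eval ((y : ℂ) * Complex.I))
        atTop (𝓝 lam) := by
      have h1 := (tendsto_eval_div_pow tendsto_mul_I_cobounded hWn).div
        (tendsto_eval_div_pow tendsto_mul_I_cobounded hn.ge) (by
          rw [hn, hq.coeff_natDegree]
          exact one_ne_zero)
      rw [hn, hq.coeff_natDegree, div_one] at h1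
      refine h1.congr' ?_
      filter_upwards [eventually_gt_atTop 0] with y hy
      refine div_div_div_cancel_right₀ (pow_ne_zero _ (mul_ne_zero ?_ Complex.I_ne_zero)) _ _
      exact_mod_cast hy.ne'
    have hgc : ∀ k, ∀ y : ℝ, ‖z ^ k * laplace (leave μ (Set.Ici 0) k) ((y : ℂ) * Complex.I)‖ ≤
        (leave μ (Set.Ici 0) k).real Set.univ := fun k y =>
      norm_pow_mul_leave_le hz1.le (fun k => (ae_leave_Ici μ k).mono fun x hx =>
        (norm_exp_I y x).le) k
    have hcont : ∀ k, Continuous fun y : ℝ =>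
        z ^ k * laplace (leave μ (Set.Ici 0) k) ((y : ℂ) * Complex.I) := fun k =>
      continuous_const.mul (continuous_laplace_I _)
    have hgF : Continuous fun y : ℝ => genFun z (leave μ (Set.Ici 0)) ((y : ℂ) * Complex.I) :=
      continuous_tsum hcont (summable_leave μ measurableSet_Ici) hgc
    have hm1 := tendsto_average_laplace hμ0
    have hm2 : Tendsto (average fun y : ℝ => genFun z (leave μ (Set.Ici 0)) ((y : ℂ) * Complex.I))
        atTop (𝓝 0) := by
      refine tendsto_average_tsum hcont (summable_leave μ measurableSet_Ici) hgc fun k => ?_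
      have h1 := (tendsto_average_laplace ((ae_leave_Ici μ k).mono fun x hx => hx.ne)).const_mul
        (z ^ k)
      rw [mul_zero] at h1
      exact h1.congr fun T => (average_const_mul _ _ _).symm
    have hid : ∀ y : ℝ, (1 - lam) + (-z * laplace μ ((y : ℂ) * Complex.I) +
        lam * z * genFun z (leave μ (Set.Ici 0)) ((y : ℂ) * Complex.I)) =
        (W.eval ((y : ℂ) * Complex.I) / q.eval ((y : ℂ) * Complex.I) - lam) *
          exitFactor μ (Set.Ici 0) z ((y : ℂ) * Complex.I) := by
      intro y
      have h1 := hfac ((y : ℂ) * Complex.I) (by rw [hre]; linarith) (hre y).le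
      have h2 := hW1 ((y : ℂ) * Complex.I) (by rw [hre]; linarith)
      rw [← h2, mul_div_cancel_left₀ _ (hq0 _ (hre y).ge)]
      have h3 : exitFactor μ (Set.Ici 0) z ((y : ℂ) * Complex.I) =
        1 - z * genFun z (leave μ (Set.Ici 0)) ((y : ℂ) * Complex.I) := rfl
      linear_combination h1 + lam * h3
    have hz0 : Tendsto (fun y : ℝ => (1 - lam) + (-z * laplace μ ((y : ℂ) * Complex.I) +
        lam * z * genFun z (leave μ (Set.Ici 0)) ((y : ℂ) * Complex.I))) atTop (𝓝 0) := by
      simp only [hid]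
      have h1 : Tendsto (fun y : ℝ => W.eval ((y : ℂ) * Complex.I) /
          q.eval ((y : ℂ) * Complex.I) - lam) atTop (𝓝 0) := by
        simpa using hRt.sub_const lam
      refine h1.zero_mul_isBoundedUnder_le ?_
      refine isBoundedUnder_of ⟨2, fun y => ?_⟩
      have h2 := norm_exitFactor_sub_one_le (μ := μ) (C := Set.Ici 0) (z := z)
        (s := (y : ℂ) * Complex.I) measurableSet_Ici hz1.le fun k =>
          (ae_leave_Ici μ k).mono fun x hx => (norm_exp_I y x).le
      have h3 := norm_add_le (exitFactor μ (Set.Ici 0) z ((y : ℂ) * Complex.I) - 1) 1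
      rw [sub_add_cancel, norm_one] at h3
      simp only [Function.comp]
      linarith
    have hav := tendsto_average_of_tendsto_zero hz0
    have hav2 : Tendsto (fun T => (1 - lam) + (-z * average (fun y : ℝ =>
        laplace μ ((y : ℂ) * Complex.I)) T + lam * z * average (fun y : ℝ =>
        genFun z (leave μ (Set.Ici 0)) ((y : ℂ) * Complex.I)) T)) atTop (𝓝 (1 - lam)) := by
      have := ((hm1.const_mul (-z)).add (hm2.const_mul (lam * z))).const_add (1 - lam)
      simpa using this
    have hlim := tendsto_nhds_unique hav (hav2.congr' (by
      filter_upwards [eventually_gt_atTop 0] with T hT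
      have hc1 := continuous_laplace_I μ
      rw [average_add (by fun_prop) (by fun_prop), average_add (by fun_prop) (by fun_prop),
        average_const_mul, average_const_mul, average_const hT]))
    linear_combination hlim
  have hWd : W.natDegree = n := by
    refine le_antisymm hWn (Polynomial.le_natDegree_of_ne_zero ?_)
    rw [hlam]
    exact one_ne_zero
  refine ⟨W, ?_, hWd, fun s hs => (hW1 s hs).symm, hleft⟩
  rw [Polynomial.Monic, Polynomial.leadingCoeff, hWd, hlam]

/-! ### The denominator polynomials for `|z| < 1` and for `z = 1`. -/

/-- By dominated convergence the weighted mass tends to `1` as `ε ↓ 0`. Shrinking the strip thus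
makes the weighted geometric series converge for any given `|z| < 1`. -/
theorem exists_weightMass_le {μ : Measure ℝ} [IsProbabilityMeasure μ] {δ : ℝ} (hδ : 0 < δ)
    (hμ : weightMass δ μ < ⊤) {K : ℝ} (hK : 1 < K) :
    ∃ ε : ℝ, 0 < ε ∧ ε ≤ δ ∧ weightMass ε μ ≤ ENNReal.ofReal K := by
  have h1 : Tendsto (fun ε : ℝ => weightMass ε μ) (𝓝[>] 0) (𝓝 (∫⁻ _ : ℝ, 1 ∂μ)) := by
    refine tendsto_lintegral_filter_of_dominated_convergence
      (fun x => ENNReal.ofReal (weight δ x))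
      (Eventually.of_forall fun ε => (measurable_weight ε).ennreal_ofReal) ?_ hμ.ne ?_
    · filter_upwards [Ioc_mem_nhdsGT hδ] with ε hε
      refine Eventually.of_forall fun x => ENNReal.ofReal_le_ofReal ?_
      rcases le_total 0 x with hx | hx
      · exact max_le_max le_rfl (Real.exp_le_exp.2 (mul_le_mul_of_nonneg_right hε.2 hx))
      · refine max_le (one_le_weight _ _) (le_trans ?_ (one_le_weight _ _))
        exact Real.exp_le_one_iff.2 (mul_nonpos_of_nonneg_of_nonpos hε.1.le hx)
    · refine Eventually.of_forall fun x => ?_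
      have h2 : Continuous fun ε : ℝ => ENNReal.ofReal (weight ε x) := by
        refine ENNReal.continuous_ofReal.comp ?_
        unfold weight
        fun_prop
      have h3 := h2.tendsto 0
      simp only [weight, zero_mul, Real.exp_zero, max_self, ENNReal.ofReal_one] at h3
      exact h3.mono_left nhdsWithin_le_nhds
  rw [lintegral_const, measure_univ, one_mul] at h1
  have h2 : (1 : ENNReal) < ENNReal.ofReal K := by
    rw [← ENNReal.ofReal_one]
    exact (ENNReal.ofReal_lt_ofReal_iff (by linarith)).2 hK
  obtain ⟨ε, h3, h4⟩ := ((h1.eventually_lt_const h2).and (Ioc_mem_nhdsGT hδ)).exists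
  exact ⟨ε, h4.1, h4.2, h3.le⟩

section Stable

variable {μ : Measure ℝ} [IsProbabilityMeasure μ] {δ : ℝ} {q : Polynomial ℂ} {G : ℂ → ℂ} {C : ℝ}
  {m : ℕ}

/-- The denominator polynomial of the transform of the maximum for `‖z‖ < 1`. -/
theorem exists_transform_polynomial (hμ0 : ∀ᵐ x ∂μ, x ≠ 0) (hδ : 0 < δ)
    (hμ : weightMass δ μ < ⊤) (hq : q.Monic) (hq0 : ∀ s : ℂ, 0 ≤ s.re → q.eval s ≠ 0)
    (hG : DifferentiableOn ℂ G leftHalf) (hGb : ∀ w ∈ leftHalf, ‖G w‖ ≤ C * (1 + ‖w‖) ^ m)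
    (hqG : ∀ s : ℂ, -δ < s.re → s.re < 0 → q.eval s * laplace μ s = G s) {z : ℂ} (hz : ‖z‖ < 1) :
    ∃ W : Polynomial ℂ, W.Monic ∧ W.natDegree = q.natDegree ∧
      (∀ s : ℂ, 0 ≤ s.re → W.eval s = q.eval s * exitFactor μ (Set.Iio 0) z s) ∧
      (∀ w ∈ leftHalf, q.eval w - z * G w = W.eval w * exitFactor μ (Set.Ici 0) z w) ∧
      (∀ s : ℂ, 0 ≤ s.re → (1 - z) * genFun z (reflected μ) s * (W.eval s * q.eval 0) =
        q.eval s * W.eval 0) ∧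
      (1 - z) * q.eval 0 = W.eval 0 * exitFactor μ (Set.Ici 0) z 0 ∧
      DifferentiableOn ℂ (exitFactor μ (Set.Ici 0) z) leftHalf := by
  have hz1 : 0 < 1 + ‖z‖ := by linarith [norm_nonneg z]
  -- This constant is larger than `1` and still satisfies `‖z‖ * K < 1`.
  obtain ⟨ε, hε, hεδ, hm⟩ := exists_weightMass_le (K := 2 / (1 + ‖z‖)) hδ hμ (by
    rw [lt_div_iff₀ hz1]
    linarith)
  have hK : 0 ≤ 2 / (1 + ‖z‖) := by positivity
  have hzK : ‖z‖ * (2 / (1 + ‖z‖)) < 1 := by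
    rw [mul_div_assoc', div_lt_one hz1]
    linarith
  obtain ⟨W, h1, h2, h3, h4⟩ := exists_ladder_polynomial hμ0 hε hK hzK hz hm hq hq0 hG hGb
    fun s hs hs' => hqG s (by linarith) hs'
  refine ⟨W, h1, h2, fun s hs => h3 s (by linarith), h4, fun s hs => ?_, ?_,
    differentiableOn_exitFactor_Ici hK hzK hm⟩
  · have h5 := genFun_reflected_mul_exitFactor hε hK hzK hz hm (s := s) (by linarith)
    rw [h3 s (by linarith), h3 0 (by simpa using hε), ← h5]
    ring
  · have h5 := (wienerHopf_factorization hε hK hzK hm).1 0 (by simpa using hε) le_rfl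
    rw [laplace_zero, probReal_univ, Complex.ofReal_one, mul_one] at h5
    rw [h5, h3 0 (by simpa using hε)]
    ring

theorem tendsto_exitFactor {C : Set ℝ} (hC : MeasurableSet C) {s : ℂ}
    (h : ∀ n, ∀ᵐ x : ℝ ∂(leave μ C n), ‖Complex.exp (-s * (x : ℂ))‖ ≤ 1) :
    Tendsto (fun r : ℝ => exitFactor μ C (r : ℂ) s) (𝓝[<] 1) (𝓝 (exitFactor μ C 1 s)) := by
  have hr : Tendsto (fun r : ℝ => (r : ℂ)) (𝓝[<] 1) (𝓝 1) := by
    have := (Complex.continuous_ofReal.tendsto 1).mono_left (nhdsWithin_le_nhds (s := Set.Iio 1))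
    simpa using this
  have h1 := tendsto_tsum_of_dominated_convergence (𝓕 := 𝓝[<] (1 : ℝ))
    (f := fun r n => (r : ℂ) ^ n * laplace (leave μ C n) s)
    (g := fun n => (1 : ℂ) ^ n * laplace (leave μ C n) s) (summable_leave μ hC)
    (fun n => (hr.pow n).mul_const _) (by
      filter_upwards [Ioo_mem_nhdsLT (zero_lt_one (α := ℝ))] with r hr n
      refine norm_pow_mul_leave_le ?_ h n
      rw [Complex.norm_real, Real.norm_of_nonneg hr.1.le]
      exact hr.2.le)
  exact (hr.mul h1).const_sub 1

theorem norm_laplace_lt {α : Measure ℝ} [IsFiniteMeasure α] (hα : ∀ᵐ x ∂α, x < 0)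
    (h0 : α ≠ 0) {s : ℂ} (hs : s.re < 0) : ‖laplace α s‖ < α.real Set.univ := by
  have hint : Integrable (fun x : ℝ => Real.exp (-s.re * x)) α := by
    refine Integrable.of_bound (C := 1) (by fun_prop : Measurable _).aestronglyMeasurable ?_
    filter_upwards [hα] with x hx
    rw [← norm_exp_neg_mul, norm_norm]
    exact norm_exp_le_one_of_nonpos hs.le hx.le
  have h1 : ‖laplace α s‖ ≤ ∫ x, Real.exp (-s.re * x) ∂α := by
    refine (norm_integral_le_integral_norm _).trans_eq ?_
    exact integral_congr_ae (Eventually.of_forall fun x => norm_exp_neg_mul s x)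
  refine h1.trans_lt ?_
  have h2 : ∀ᵐ x ∂α, 0 < 1 - Real.exp (-s.re * x) := by
    filter_upwards [hα] with x hx
    have := Real.exp_lt_one_iff.2 (by nlinarith : -s.re * x < 0)
    linarith
  have h3 : 0 < ∫ x, (1 - Real.exp (-s.re * x)) ∂α := by
    rw [integral_pos_iff_support_of_nonneg_ae (h2.mono fun x hx => hx.le)
      ((integrable_const 1).sub hint)]
    rw [pos_iff_ne_zero]
    intro h4
    refine h0 (Measure.measure_univ_eq_zero.1 ?_)
    refine le_antisymm ?_ zero_le
    calc α Set.univ ≤ α (Function.support fun x => 1 - Real.exp (-s.re * x)) :=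
          measure_mono_ae (h2.mono fun x hx _ => hx.ne')
      _ = 0 := h4
  rw [integral_sub (integrable_const 1) hint, integral_const, smul_eq_mul, mul_one] at h3
  linarith

/-- At `z = 1` the factor `|z|` no longer gives strictness. It comes from the exit positions being
strictly negative and `Re s < 0`, unless the walk never leaves, when the series is zero. -/
theorem exitFactor_Ici_one_ne_zero {s : ℂ} (hs : s.re < 0) :
    exitFactor μ (Set.Ici 0) 1 s ≠ 0 := by
  have hb : ∀ n, ∀ᵐ x : ℝ ∂(leave μ (Set.Ici 0) n), ‖Complex.exp (-s * (x : ℂ))‖ ≤ 1 :=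
    fun n => (ae_leave_Ici μ n).mono fun _ hx => norm_exp_le_one_of_nonpos hs.le hx.le
  have hle := norm_pow_mul_leave_le (μ := μ) (C := Set.Ici 0) (z := 1) (s := s) (by simp) hb
  have hsm := Summable.of_nonneg_of_le (fun n => norm_nonneg _) hle
    (summable_leave μ measurableSet_Ici)
  have hlt : ‖genFun 1 (leave μ (Set.Ici 0)) s‖ < 1 := by
    refine (norm_tsum_le_tsum_norm hsm).trans_lt ?_
    by_cases hz : ∀ n, leave μ (Set.Ici 0) n = 0
    · have : ∀ n, ‖(1 : ℂ) ^ n * laplace (leave μ (Set.Ici 0) n) s‖ = 0 := fun n => by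
        rw [hz n]
        simp [laplace]
      rw [tsum_congr this, tsum_zero]
      exact one_pos
    · obtain ⟨n, hn⟩ := not_forall.1 hz
      refine lt_of_lt_of_le (Summable.tsum_lt_tsum (i := n) hle ?_ hsm
        (summable_leave μ measurableSet_Ici)) (tsum_leave_le μ measurableSet_Ici)
      rw [one_pow, one_mul]
      exact norm_laplace_lt (ae_leave_Ici μ n) hn hs
  intro h0
  rw [exitFactor, one_mul, sub_eq_zero] at h0
  rw [← h0, norm_one] at hlt
  exact lt_irrefl _ hlt

theorem differentiableOn_exitFactor_Ici_one :
    DifferentiableOn ℂ (exitFactor μ (Set.Ici 0) 1) leftHalf := by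
  refine (DifferentiableOn.const_mul ?_ 1).const_sub 1
  refine Complex.differentiableOn_tsum_of_summable_norm (summable_leave μ measurableSet_Ici)
    (fun n => DifferentiableOn.const_mul ?_ _) isOpen_leftHalf fun n s hs =>
      norm_pow_mul_leave_le (by simp) (fun n => (ae_leave_Ici μ n).mono fun _ hx =>
        norm_exp_le_one_of_nonpos (le_of_lt hs) hx.le) n
  refine differentiableOn_laplace (ε := 0) (K := (leave μ (Set.Ici 0) n).real Set.univ) ?_
    isOpen_leftHalf ((ae_leave_Ici μ n).mono fun _ hx _ hs =>
      (norm_exp_le_one_of_nonpos (le_of_lt hs) hx.le).trans (one_le_weight _ _))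
  simp [weightMass, weight]

/-- The denominator polynomial at `z = 1`. -/
theorem exists_transform_polynomial_one (hμ0 : ∀ᵐ x ∂μ, x ≠ 0) (hδ : 0 < δ)
    (hμ : weightMass δ μ < ⊤) (hq : q.Monic) (hq0 : ∀ s : ℂ, 0 ≤ s.re → q.eval s ≠ 0)
    (hG : DifferentiableOn ℂ G leftHalf) (hGb : ∀ w ∈ leftHalf, ‖G w‖ ≤ C * (1 + ‖w‖) ^ m)
    (hqG : ∀ s : ℂ, -δ < s.re → s.re < 0 → q.eval s * laplace μ s = G s) {L : ℂ → ℂ}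
    (hL : ∀ s : ℂ, 0 < s.re → Tendsto (fun r : ℝ => (1 - (r : ℂ)) * genFun (r : ℂ) (reflected μ) s)
      (𝓝[<] 1) (𝓝 (L s))) (hL0 : ∀ x : ℝ, 0 < x → L x ≠ 0) :
    ∃ W : Polynomial ℂ, W.Monic ∧ W.natDegree = q.natDegree ∧
      (∀ s : ℂ, 0 ≤ s.re → W.eval s ≠ 0) ∧
      (∀ w ∈ leftHalf, q.eval w - G w = W.eval w * exitFactor μ (Set.Ici 0) 1 w) ∧
      ∀ s : ℂ, 0 < s.re → L s * (W.eval s * q.eval 0) = q.eval s * W.eval 0 := by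
  classical
  set n := q.natDegree with hn
  have hex : ∀ r : ℝ, ∃ W : Polynomial ℂ, 0 < r → r < 1 → W.Monic ∧ W.natDegree = q.natDegree ∧
      (∀ s : ℂ, 0 ≤ s.re → W.eval s = q.eval s * exitFactor μ (Set.Iio 0) r s) ∧
      (∀ w ∈ leftHalf, q.eval w - r * G w = W.eval w * exitFactor μ (Set.Ici 0) r w) ∧
      (∀ s : ℂ, 0 ≤ s.re → (1 - (r : ℂ)) * genFun r (reflected μ) s * (W.eval s * q.eval 0) =
        q.eval s * W.eval 0) := by
    intro r
    by_cases hr : 0 < r ∧ r < 1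
    · obtain ⟨W, h1, h2, h3, h4, h5, -⟩ := exists_transform_polynomial hμ0 hδ hμ hq hq0 hG hGb hqG
        (z := (r : ℂ)) (by rw [Complex.norm_real, Real.norm_of_nonneg hr.1.le]; exact hr.2)
      exact ⟨W, fun _ _ => ⟨h1, h2, h3, h4, h5⟩⟩
    · exact ⟨0, fun h1 h2 => absurd ⟨h1, h2⟩ hr⟩
  choose W hW using hex
  have hev : ∀ᶠ r : ℝ in 𝓝[<] 1, 0 < r ∧ r < 1 := Ioo_mem_nhdsLT (zero_lt_one (α := ℝ))
  have hplus : ∀ s : ℂ, 0 ≤ s.re → Tendsto (fun r : ℝ => exitFactor μ (Set.Iio 0) (r : ℂ) s)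
      (𝓝[<] 1) (𝓝 (exitFactor μ (Set.Iio 0) 1 s)) := fun s hs =>
    tendsto_exitFactor measurableSet_Iio fun k => (ae_leave_Iio μ k).mono fun _ hx =>
      norm_exp_le_one_of_nonneg hs hx
  have hWr : ∀ s : ℂ, 0 ≤ s.re → Tendsto (fun r : ℝ => (W r).eval s) (𝓝[<] 1)
      (𝓝 (q.eval s * exitFactor μ (Set.Iio 0) 1 s)) := by
    intro s hs
    refine ((hplus s hs).const_mul (q.eval s)).congr' ?_
    filter_upwards [hev] with r hr
    exact ((hW r hr.1 hr.2).2.2.1 s hs).symm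
  -- Any `n` distinct nodes in the closed right half-plane will do: there `W r = q f₊`, and `f₊`
  -- converges as `r ↑ 1`. A monic polynomial of degree `n` is determined by its values at `n`
  -- points, so interpolating `W - X ^ n` carries the convergence to all of `ℂ`.
  set v : Fin n → ℂ := fun i => ((i : ℕ) : ℂ) with hv
  have hvinj : Set.InjOn v (Finset.univ : Finset (Fin n)) := by
    intro i _ j _ hij
    simpa [hv, Fin.ext_iff] using hij
  set W₁ : Polynomial ℂ := Polynomial.X ^ n + Lagrange.interpolate Finset.univ v
    (fun i => q.eval (v i) * exitFactor μ (Set.Iio 0) 1 (v i) - v i ^ n) with hW₁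
  have hI : (Lagrange.interpolate Finset.univ v
      (fun i => q.eval (v i) * exitFactor μ (Set.Iio 0) 1 (v i) - v i ^ n)).degree < n := by
    have := Lagrange.degree_interpolate_lt
      (fun i => q.eval (v i) * exitFactor μ (Set.Iio 0) 1 (v i) - v i ^ n) hvinj
    simpa using this
  have hW₁m : W₁.Monic := Polynomial.monic_X_pow_add hI
  have hW₁d : W₁.natDegree = n := by
    have h1 : W₁.degree = n := by
      rw [hW₁, Polynomial.degree_add_eq_left_of_degree_lt (by rwa [Polynomial.degree_X_pow]),
        Polynomial.degree_X_pow]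
    exact Polynomial.natDegree_eq_of_degree_eq_some h1
  have hlim : ∀ s : ℂ, Tendsto (fun r : ℝ => (W r).eval s) (𝓝[<] 1) (𝓝 (W₁.eval s)) := by
    intro s
    have h1 : Tendsto (fun r : ℝ => s ^ n + ∑ i : Fin n, ((W r).eval (v i) - v i ^ n) *
        (Lagrange.basis Finset.univ v i).eval s) (𝓝[<] 1) (𝓝 (W₁.eval s)) := by
      rw [hW₁, Polynomial.eval_add, Polynomial.eval_pow, Polynomial.eval_X,
        Lagrange.interpolate_apply, Polynomial.eval_finsetSum]
      simp only [Polynomial.eval_mul, Polynomial.eval_C]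
      refine tendsto_const_nhds.add (tendsto_finsetSum _ fun i _ => ?_)
      exact ((hWr (v i) (by simp [hv])).sub_const _).mul_const _
    refine h1.congr' ?_
    filter_upwards [hev] with r hr
    obtain ⟨hm, hd, -⟩ := hW r hr.1 hr.2
    have hdeg : (W r - Polynomial.X ^ n).degree < ((Finset.univ : Finset (Fin n)).card : WithBot ℕ) := by
      rw [Finset.card_univ, Fintype.card_fin]
      have h2 : (W r).degree = n := by
        rw [Polynomial.degree_eq_natDegree hm.ne_zero, hd]
      have := Polynomial.degree_sub_lt_left (p := W r) (q := Polynomial.X ^ n)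
        (by rw [h2, Polynomial.degree_X_pow]) hm.ne_zero (by
          rw [hm.leadingCoeff, (Polynomial.monic_X_pow n).leadingCoeff])
      rwa [h2] at this
    have h3 := Lagrange.eq_interpolate hvinj hdeg
    have h4 := congrArg (Polynomial.eval s) h3
    rw [Lagrange.interpolate_apply, Polynomial.eval_finsetSum] at h4
    simp only [Polynomial.eval_mul, Polynomial.eval_C, Polynomial.eval_sub, Polynomial.eval_pow,
      Polynomial.eval_X] at h4
    rw [← h4]
    ring
  have hright : ∀ s : ℂ, 0 ≤ s.re → W₁.eval s = q.eval s * exitFactor μ (Set.Iio 0) 1 s :=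
    fun s hs => tendsto_nhds_unique (hlim s) (hWr s hs)
  have hcast : Tendsto (fun r : ℝ => (r : ℂ)) (𝓝[<] 1) (𝓝 1) := by
    have := (Complex.continuous_ofReal.tendsto 1).mono_left (nhdsWithin_le_nhds (s := Set.Iio 1))
    simpa using this
  have hleft : ∀ w ∈ leftHalf, q.eval w - G w = W₁.eval w * exitFactor μ (Set.Ici 0) 1 w := by
    intro w hw
    have h1 := (hlim w).mul (tendsto_exitFactor (μ := μ) (C := Set.Ici 0) (s := w)
      measurableSet_Ici fun k => (ae_leave_Ici μ k).mono fun _ hx =>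
        norm_exp_le_one_of_nonpos (le_of_lt hw) hx.le)
    have h2 : Tendsto (fun r : ℝ => q.eval w - r * G w) (𝓝[<] 1) (𝓝 (q.eval w - G w)) := by
      have := (hcast.mul_const (G w)).const_sub (q.eval w)
      rwa [one_mul] at this
    refine tendsto_nhds_unique h2 (h1.congr' ?_)
    filter_upwards [hev] with r hr
    exact ((hW r hr.1 hr.2).2.2.2.1 w hw).symm
  have hform : ∀ s : ℂ, 0 < s.re → L s * (W₁.eval s * q.eval 0) = q.eval s * W₁.eval 0 := by
    intro s hs
    have h1 := (hL s hs).mul ((hlim s).mul_const (q.eval 0))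
    refine tendsto_nhds_unique h1 (((hlim 0).const_mul (q.eval s)).congr' ?_)
    filter_upwards [hev] with r hr
    exact ((hW r hr.1 hr.2).2.2.2.2 s hs.le).symm
  -- Otherwise the limit formula with `L ≠ 0` would make `W₁` vanish on the whole positive axis.
  have hW0 : W₁.eval 0 ≠ 0 := by
    intro h0
    refine hW₁m.ne_zero (Polynomial.eq_zero_of_infinite_isRoot _ ?_)
    refine Set.Infinite.mono (s := (fun x : ℝ => (x : ℂ)) '' Set.Ioi 0) ?_
      ((Set.Ioi_infinite 0).image (fun x _ y _ h => by simpa using h))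
    rintro _ ⟨x, hx, rfl⟩
    have hx' : 0 < (x : ℂ).re := by simpa using hx
    have h1 := hform x hx'
    rw [h0, mul_zero] at h1
    exact (mul_eq_zero.1 ((mul_eq_zero.1 h1).resolve_left (hL0 x hx))).resolve_right
      (hq0 0 le_rfl)
  -- The probability of ever returning to `[0, ∞)`. Since `W₁(0) = q(0) (1 - p)` is nonzero, `p <
  -- 1`. Then `f₊` at `z = 1` is at distance at most `p` from `1` throughout the closed right
  -- half-plane, and `W₁` has no zeros there.
  set p : ℝ := ∑' k, (leave μ (Set.Iio 0) k).real Set.univ with hp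
  have hp1 : p < 1 := by
    refine lt_of_le_of_ne (tsum_leave_le μ measurableSet_Iio) fun h1 => hW0 ?_
    rw [hright 0 le_rfl, exitFactor, genFun]
    simp only [one_pow, one_mul, laplace_zero]
    rw [← Complex.ofReal_tsum, ← hp, h1]
    simp
  refine ⟨W₁, hW₁m, hW₁d, fun s hs => ?_, hleft, hform⟩
  rw [hright s hs]
  refine mul_ne_zero (hq0 s hs) fun h0 => ?_
  rw [exitFactor, one_mul, sub_eq_zero] at h0
  have h1 : ‖genFun 1 (leave μ (Set.Iio 0)) s‖ ≤ p :=
    tsum_of_norm_bounded (summable_leave μ measurableSet_Iio).hasSum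
      (norm_pow_mul_leave_le (by simp) fun k => (ae_leave_Iio μ k).mono fun _ hx =>
        norm_exp_le_one_of_nonneg hs hx)
  rw [← h0, norm_one] at h1
  linarith

end Stable

/-! ### Laws of the partial sums, the exit events and the maximum. -/

section WalkLaws

variable {Ω : Type*}

/-- Partial sums. -/
def psum (X : ℕ → Ω → ℝ) (n : ℕ) (ω : Ω) : ℝ := ∑ i ∈ Finset.range n, X i ω

/-- The event that the partial sums `1, ..., n` lie in `C`. -/
def stayEvent (X : ℕ → Ω → ℝ) (C : Set ℝ) (n : ℕ) : Set Ω :=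
  {ω | ∀ k, 1 ≤ k → k ≤ n → psum X k ω ∈ C}

theorem psum_succ (X : ℕ → Ω → ℝ) (n : ℕ) (ω : Ω) : psum X (n + 1) ω = psum X n ω + X n ω :=
  Finset.sum_range_succ _ _

/-- The σ-algebra generated by the variables with index in `S`. -/
abbrev sigmaOf (X : ℕ → Ω → ℝ) (S : Set ℕ) : MeasurableSpace Ω :=
  ⨆ i ∈ S, MeasurableSpace.comap (X i) inferInstance

theorem measurable_sigmaOf {X : ℕ → Ω → ℝ} {S : Set ℕ} {i : ℕ} (hi : i ∈ S) :
    Measurable[sigmaOf X S] (X i) := by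
  have h1 : MeasurableSpace.comap (X i) inferInstance ≤ sigmaOf X S :=
    le_iSup₂ (f := fun i (_ : i ∈ S) => MeasurableSpace.comap (X i) inferInstance) i hi
  exact (comap_measurable (X i)).mono h1 le_rfl

theorem measurable_psum_sigmaOf {X : ℕ → Ω → ℝ} {n k : ℕ} (hk : k ≤ n) :
    Measurable[sigmaOf X (Set.Iio n)] (psum X k) := by
  unfold psum
  refine Finset.measurable_fun_sum _ fun i hi => ?_
  exact measurable_sigmaOf (Set.mem_Iio.2 ((Finset.mem_range.1 hi).trans_le hk))

theorem measurableSet_stayEvent_sigmaOf {X : ℕ → Ω → ℝ} {C : Set ℝ} (hC : MeasurableSet C)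
    (n : ℕ) : MeasurableSet[sigmaOf X (Set.Iio n)] (stayEvent X C n) := by
  have : stayEvent X C n = ⋂ k : ℕ, ⋂ _ : 1 ≤ k, ⋂ _ : k ≤ n, psum X k ⁻¹' C := by
    ext ω
    simp [stayEvent]
  rw [this]
  refine MeasurableSet.iInter fun k => MeasurableSet.iInter fun _ => MeasurableSet.iInter
    fun hk => ?_
  exact measurable_psum_sigmaOf hk hC

theorem stayEvent_succ (X : ℕ → Ω → ℝ) (C : Set ℝ) (n : ℕ) :
    stayEvent X C (n + 1) = psum X (n + 1) ⁻¹' C ∩ stayEvent X C n := by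
  ext ω
  simp only [stayEvent, Set.mem_inter_iff, Set.mem_preimage, Set.mem_ofPred_eq]
  constructor
  · exact fun h => ⟨h _ (by omega) le_rfl, fun k h1 h2 => h k h1 (by omega)⟩
  · rintro ⟨h1, h2⟩ k h3 h4
    rcases Nat.lt_or_ge n k with h5 | h5
    · rwa [show k = n + 1 by omega]
    · exact h2 k h3 h5

/-- The maximum of the partial sums, by recursion on the first step. -/
def maxRec : ℕ → (ℕ → Ω → ℝ) → Ω → ℝ
  | 0, _, _ => 0
  | k + 1, X, ω => max 0 (maxRec k (fun i => X (i + 1)) ω + X 0 ω)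

theorem measurable_maxRec (k : ℕ) : ∀ {m : MeasurableSpace Ω} {X : ℕ → Ω → ℝ},
    (∀ i, Measurable[m] (X i)) → Measurable[m] (maxRec k X) := by
  induction k with
  | zero =>
    intro m X hX
    exact measurable_const
  | succ k ih =>
    intro m X hX
    exact measurable_const.max ((ih fun i => hX (i + 1)).add (hX 0))

theorem psum_shift (X : ℕ → Ω → ℝ) (n : ℕ) (ω : Ω) :
    psum X (n + 1) ω = psum (fun i => X (i + 1)) n ω + X 0 ω :=
  Finset.sum_range_succ' _ _

theorem sup_psum_eq_maxRec (k : ℕ) : ∀ (X : ℕ → Ω → ℝ) (ω : Ω),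
    (Finset.range (k + 1)).sup' Finset.nonempty_range_add_one (fun j => psum X j ω) =
      maxRec k X ω := by
  induction k with
  | zero =>
    intro X ω
    simp [maxRec, psum]
  | succ k ih =>
    intro X ω
    rw [maxRec, ← ih]
    refine le_antisymm (Finset.sup'_le _ _ fun j hj => ?_) (max_le ?_ ?_)
    · cases j with
      | zero => exact le_max_of_le_left (by simp [psum])
      | succ j =>
        rw [psum_shift]
        refine le_max_of_le_right (add_le_add_left ?_ _)
        exact Finset.le_sup' (fun j => psum (fun i => X (i + 1)) j ω)
          (Finset.mem_range.2 (by have := Finset.mem_range.1 hj; omega))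
    · have := Finset.le_sup' (fun j => psum X j ω)
        (Finset.mem_range.2 (Nat.succ_pos (k + 1)))
      have h0 : psum X 0 ω = 0 := by simp [psum]
      exact h0.ge.trans this
    · rw [← le_sub_iff_add_le]
      refine Finset.sup'_le _ _ fun j hj => ?_
      rw [le_sub_iff_add_le, ← psum_shift]
      exact Finset.le_sup' (fun j => psum X j ω)
        (Finset.mem_range.2 (by have := Finset.mem_range.1 hj; omega))

variable [mΩ : MeasurableSpace Ω] {P : Measure Ω}

theorem sigmaOf_le {X : ℕ → Ω → ℝ} (hX : ∀ i, Measurable (X i)) (S : Set ℕ) : sigmaOf X S ≤ mΩ :=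
  iSup₂_le fun i _ => (hX i).comap_le

theorem indep_sigmaOf {X : ℕ → Ω → ℝ} (hX : ∀ i, Measurable (X i)) (hind : iIndepFun X P)
    {S T : Set ℕ} (hST : Disjoint S T) : Indep (sigmaOf X S) (sigmaOf X T) P :=
  indep_iSup_of_disjoint (fun i => (hX i).comap_le) hind hST

variable [IsProbabilityMeasure P]

theorem map_psum_succ {X : ℕ → Ω → ℝ} {μ : Measure ℝ} [IsProbabilityMeasure μ]
    (hX : ∀ i, Measurable (X i)) (hind : iIndepFun X P) (hlaw : ∀ i, P.map (X i) = μ) {C : Set ℝ}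
    (hC : MeasurableSet C) (n : ℕ) :
    (P.restrict (stayEvent X C n)).map (psum X (n + 1)) =
      ((P.restrict (stayEvent X C n)).map (psum X n)).conv μ := by
  have hps : ∀ n, Measurable (psum X n) := fun n =>
    (measurable_psum_sigmaOf le_rfl).mono (sigmaOf_le hX _) le_rfl
  have hT : MeasurableSet (stayEvent X C n) :=
    sigmaOf_le hX _ _ (measurableSet_stayEvent_sigmaOf hC n)
  have hprod : (P.restrict (stayEvent X C n)).map (fun ω => (psum X n ω, X n ω)) =
      ((P.restrict (stayEvent X C n)).map (psum X n)).prod μ := by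
    refine (Measure.prod_eq fun s t hs ht => ?_).symm
    rw [Measure.map_apply ((hps n).prodMk (hX n)) (hs.prod ht), Measure.map_apply (hps n) hs,
      Measure.restrict_apply (((hps n).prodMk (hX n)) (hs.prod ht)),
      Measure.restrict_apply ((hps n) hs), ← hlaw n, Measure.map_apply (hX n) ht]
    -- Position and survival up to time `n` depend only on the steps with index below `n`, hence are
    -- independent of step `n`.
    have hi := indep_sigmaOf hX hind (S := Set.Iio n) (T := {n}) (by simp)
    have h1 := (Indep_iff _ _ _).1 hi _ _
      ((measurable_psum_sigmaOf (le_refl n) hs).inter (measurableSet_stayEvent_sigmaOf hC n))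
      (measurable_sigmaOf (X := X) (Set.mem_singleton n) ht)
    rw [← h1]
    congr 1
    ext ω
    simp only [Set.mem_inter_iff, Set.mem_preimage, Set.mem_prod]
    tauto
  rw [Measure.conv, ← hprod, Measure.map_map (by fun_prop) ((hps n).prodMk (hX n))]
  congr 1
  funext ω
  exact psum_succ X n ω

/-- The laws of the walk killed on leaving `C`. -/
theorem map_psum_stayEvent {X : ℕ → Ω → ℝ} {μ : Measure ℝ} [IsProbabilityMeasure μ]
    (hX : ∀ i, Measurable (X i)) (hind : iIndepFun X P) (hlaw : ∀ i, P.map (X i) = μ) {C : Set ℝ}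
    (hC : MeasurableSet C) (n : ℕ) :
    (P.restrict (stayEvent X C n)).map (psum X n) = stay μ C n := by
  have hps : ∀ n, Measurable (psum X n) := fun n =>
    (measurable_psum_sigmaOf le_rfl).mono (sigmaOf_le hX _) le_rfl
  induction n with
  | zero =>
    have h1 : stayEvent X C 0 = Set.univ := by
      ext ω
      simp only [stayEvent, Set.mem_ofPred_eq, Set.mem_univ, iff_true]
      intro k h1 h2
      omega
    have h2 : psum X 0 = fun _ => (0 : ℝ) := by
      funext ω
      simp [psum]
    rw [h1, h2, Measure.restrict_univ, Measure.map_const, measure_univ, one_smul, stay]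
  | succ n ih =>
    rw [stay, ← ih, ← map_psum_succ hX hind hlaw hC, Measure.restrict_map (hps _) hC,
      Measure.restrict_restrict (hps _ hC), stayEvent_succ]

theorem measureReal_leave {X : ℕ → Ω → ℝ} {μ : Measure ℝ} [IsProbabilityMeasure μ]
    (hX : ∀ i, Measurable (X i)) (hind : iIndepFun X P) (hlaw : ∀ i, P.map (X i) = μ) {C : Set ℝ}
    (hC : MeasurableSet C) (n : ℕ) :
    P.real (psum X (n + 1) ⁻¹' Cᶜ ∩ stayEvent X C n) = (leave μ C n).real Set.univ := by
  have hps : ∀ n, Measurable (psum X n) := fun n =>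
    (measurable_psum_sigmaOf le_rfl).mono (sigmaOf_le hX _) le_rfl
  rw [leave, ← map_psum_stayEvent hX hind hlaw hC, ← map_psum_succ hX hind hlaw hC,
    measureReal_restrict_apply_univ, map_measureReal_apply (hps _) hC.compl,
    measureReal_restrict_apply (hps _ hC.compl)]

/-- Removing the first step replaces time reversal. The maximum of the shifted walk is independent
of `X 0` and has, by induction over all such sequences, the law of the reflected walk. The equality
concerns the law at each fixed time only. -/
theorem map_maxRec {μ : Measure ℝ} [IsProbabilityMeasure μ] (k : ℕ) : ∀ {X : ℕ → Ω → ℝ},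
    (∀ i, Measurable (X i)) → iIndepFun X P → (∀ i, P.map (X i) = μ) →
    P.map (maxRec k X) = reflected μ k := by
  induction k with
  | zero =>
    intro X hX hind hlaw
    have h1 : maxRec 0 X = fun _ => (0 : ℝ) := rfl
    rw [h1, Measure.map_const, measure_univ, one_smul, reflected]
  | succ k ih =>
    intro X hX hind hlaw
    have hind' : iIndepFun (fun i => X (i + 1)) P := hind.precomp (Nat.succ_injective)
    have h1 := ih (fun i => hX (i + 1)) hind' fun i => hlaw (i + 1)
    have hm : Measurable (maxRec k fun i => X (i + 1)) := measurable_maxRec k fun i => hX (i + 1)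
    have hi : IndepFun (maxRec k fun i => X (i + 1)) (X 0) P := by
      have h2 := indep_sigmaOf hX hind (S := Set.Ioi 0) (T := {0}) (by simp)
      rw [IndepFun_iff_Indep]
      refine indep_of_indep_of_le_left (indep_of_indep_of_le_right h2 ?_) ?_
      · exact (measurable_sigmaOf (X := X) (Set.mem_singleton 0)).comap_le
      · refine Measurable.comap_le (measurable_maxRec k fun i => ?_)
        exact measurable_sigmaOf (Set.mem_Ioi.2 (Nat.succ_pos i))
    rw [reflected, ← h1, ← hlaw 0, ← hi.map_add_eq_map_conv_map hm (hX 0),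
      Measure.map_map (by fun_prop) (hm.add (hX 0))]
    rfl

end WalkLaws

/-! ### From the walk to the transforms: the first negative time, the maximum and Abel means. -/

section Link

variable {Ω : Type*} {B A : ℕ → Ω → ℝ} {ω : Ω}

theorem firstNeg_eq_top (h : ∀ n, 0 ≤ walk B A n ω) : firstNeg B A ω = ⊤ := by
  have : {k : ℕ∞ | ∃ n : ℕ, k = (n : ℕ∞) ∧ walk B A n ω < 0} = ∅ := by
    ext k
    simp only [Set.mem_ofPred_eq, Set.mem_empty_iff_false, iff_false]
    rintro ⟨n, -, hn⟩
    exact absurd (h n) (not_le.2 hn)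
  rw [firstNeg, this, sInf_empty]

theorem firstNeg_eq_coe {m : ℕ} (hm : walk B A m ω < 0) (h : ∀ k < m, 0 ≤ walk B A k ω) :
    firstNeg B A ω = m := by
  refine le_antisymm (sInf_le ⟨m, rfl, hm⟩) (le_sInf ?_)
  rintro _ ⟨n, rfl, hn⟩
  by_contra hlt
  rw [not_le, Nat.cast_lt] at hlt
  exact absurd (h n hlt) (not_le.2 hn)

theorem walk_eq_psum (B A : ℕ → Ω → ℝ) : walk B A = psum fun i ω => B i ω - A i ω := rfl

/-- The events "first negative at time `n + 1`" are disjoint, so at most one term is nonzero. The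
walk starts at `0`, so time `0` never counts, and if no event occurs the sum is `0`, matching the
convention for `N = ∞`. -/
theorem hasSum_zpowExt (z : ℂ) (B A : ℕ → Ω → ℝ) (ω : Ω) :
    HasSum (fun n => (psum (fun i ω => B i ω - A i ω) (n + 1) ⁻¹' (Set.Ici 0)ᶜ ∩
      stayEvent (fun i ω => B i ω - A i ω) (Set.Ici 0) n).indicator (fun _ => z ^ (n + 1)) ω)
      (zpowExt z (firstNeg B A ω)) := by
  classical
  rw [← walk_eq_psum]
  have hw0 : walk B A 0 ω = 0 := by simp [walk]
  have hmem : ∀ n, ω ∈ walk B A (n + 1) ⁻¹' (Set.Ici 0)ᶜ ∩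
      stayEvent (fun i ω => B i ω - A i ω) (Set.Ici 0) n ↔
      walk B A (n + 1) ω < 0 ∧ ∀ k < n + 1, 0 ≤ walk B A k ω := by
    intro n
    simp only [stayEvent, ← walk_eq_psum, Set.mem_inter_iff, Set.mem_preimage, Set.mem_compl_iff,
      Set.mem_Ici, not_le, Set.mem_ofPred_eq]
    refine and_congr_right fun _ => ⟨fun h k hk => ?_, fun h k _ hk => h k (by omega)⟩
    rcases Nat.eq_zero_or_pos k with rfl | hk0
    · exact hw0.ge
    · exact h k hk0 (by omega)
  by_cases hex : ∃ n, walk B A n ω < 0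
  · obtain ⟨m, hm⟩ : ∃ m, Nat.find hex = m + 1 := Nat.exists_eq_succ_of_ne_zero fun h0 => by
      have := Nat.find_spec hex
      rw [h0, hw0] at this
      exact lt_irrefl _ this
    have h1 : walk B A (m + 1) ω < 0 := hm ▸ Nat.find_spec hex
    have h2 : ∀ k < m + 1, 0 ≤ walk B A k ω := fun k hk =>
      not_lt.1 (Nat.find_min hex (hm ▸ hk))
    rw [firstNeg_eq_coe h1 h2, zpowExt, if_neg (ENat.natCast_ne_top _), ENat.toNat_natCast]
    have h3 := hasSum_single (f := fun n => (walk B A (n + 1) ⁻¹' (Set.Ici 0)ᶜ ∩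
      stayEvent (fun i ω => B i ω - A i ω) (Set.Ici 0) n).indicator
        (fun _ => z ^ (n + 1)) ω) m (by
      intro n hn
      refine Set.indicator_of_notMem (fun h => hn ?_) _
      obtain ⟨h4, h5⟩ := (hmem n).1 h
      rcases lt_trichotomy n m with h6 | h6 | h6
      · exact absurd (h2 (n + 1) (by omega)) (not_le.2 h4)
      · exact h6
      · exact absurd (h5 (m + 1) (by omega)) (not_le.2 h1))
    rwa [Set.indicator_of_mem ((hmem m).2 ⟨h1, h2⟩)] at h3
  · push Not at hex
    rw [firstNeg_eq_top hex, zpowExt, if_pos rfl]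
    refine hasSum_of_eq hasSum_zero fun n => Set.indicator_of_notMem (fun h => ?_) _
    exact absurd (hex (n + 1)) (not_le.2 ((hmem n).1 h).1)

theorem runMax_eq_maxRec (k : ℕ) :
    runMax B A k = maxRec k fun i ω => B i ω - A i ω := by
  funext ω
  rw [← sup_psum_eq_maxRec]
  rfl

theorem runMax_nonneg (k : ℕ) (ω : Ω) : 0 ≤ runMax B A k ω := by
  have h := Finset.le_sup' (fun j => walk B A j ω) (Finset.mem_range.2 (Nat.succ_pos k))
  have h0 : walk B A 0 ω = 0 := by simp [walk]
  exact h0.ge.trans h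

theorem runMax_eq_of_nonpos {N : ℕ} (h : ∀ n, N ≤ n → walk B A n ω ≤ 0) {k : ℕ} (hk : N ≤ k) :
    runMax B A k ω = runMax B A N ω := by
  refine le_antisymm (Finset.sup'_le _ _ fun j hj => ?_) (Finset.sup'_mono _ ?_ _)
  · rcases le_total N j with h1 | h1
    · exact (h j h1).trans (runMax_nonneg N ω)
    · exact Finset.le_sup' (fun j => walk B A j ω) (Finset.mem_range.2 (Nat.lt_succ_of_le h1))
  · exact Finset.range_subset_range.2 (by omega)

variable [MeasurableSpace Ω] {P : Measure Ω} [IsProbabilityMeasure P] {μ : Measure ℝ}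
  [IsProbabilityMeasure μ]

theorem integral_zpowExt (hX : ∀ i, Measurable fun ω => B i ω - A i ω)
    (hind : iIndepFun (fun i ω => B i ω - A i ω) P)
    (hlaw : ∀ i, P.map (fun ω => B i ω - A i ω) = μ) {z : ℂ} (hz : ‖z‖ < 1) :
    ∫ ω, zpowExt z (firstNeg B A ω) ∂P = 1 - exitFactor μ (Set.Ici 0) z 0 := by
  set X : ℕ → Ω → ℝ := fun i ω => B i ω - A i ω with hXdef
  set S : ℕ → Set Ω := fun n => psum X (n + 1) ⁻¹' (Set.Ici 0)ᶜ ∩ stayEvent X (Set.Ici 0) n with hS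
  have hSm : ∀ n, MeasurableSet (S n) := fun n =>
    (((measurable_psum_sigmaOf le_rfl).mono (sigmaOf_le hX _) le_rfl)
      measurableSet_Ici.compl).inter
      (sigmaOf_le hX _ _ (measurableSet_stayEvent_sigmaOf measurableSet_Ici n))
  have hmass : ∀ n, P.real (S n) = (leave μ (Set.Ici 0) n).real Set.univ := fun n =>
    measureReal_leave hX hind hlaw measurableSet_Ici n
  have h := hasSum_integral_of_summable_integral_norm (μ := P)
    (F := fun n ω => (S n).indicator (fun _ => z ^ (n + 1)) ω)
    (fun n => (integrable_const _).indicator (hSm n)) (by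
      refine Summable.of_nonneg_of_le (fun n => integral_nonneg fun _ => norm_nonneg _)
        (fun n => ?_) (summable_leave μ (measurableSet_Ici (a := (0 : ℝ))))
      simp only [norm_indicator_eq_indicator_norm]
      rw [integral_indicator_const _ (hSm n), hmass, smul_eq_mul, norm_pow]
      exact mul_le_of_le_one_right measureReal_nonneg (pow_le_one₀ (norm_nonneg _) hz.le))
  have h1 : ∀ ω, ∑' n, (S n).indicator (fun _ => z ^ (n + 1)) ω = zpowExt z (firstNeg B A ω) :=
    fun ω => (hasSum_zpowExt z B A ω).tsum_eq
  simp only [h1] at h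
  rw [← h.tsum_eq, exitFactor, sub_sub_cancel, genFun, ← tsum_mul_left]
  refine tsum_congr fun n => ?_
  rw [integral_indicator_const _ (hSm n), hmass, laplace_zero, Complex.real_smul]
  ring

theorem integral_exp_runMax (hX : ∀ i, Measurable fun ω => B i ω - A i ω)
    (hind : iIndepFun (fun i ω => B i ω - A i ω) P)
    (hlaw : ∀ i, P.map (fun ω => B i ω - A i ω) = μ) (k : ℕ) (s : ℂ) :
    ∫ ω, Complex.exp (-s * (runMax B A k ω : ℂ)) ∂P = laplace (reflected μ k) s := by
  rw [← map_maxRec k hX hind hlaw, laplace, integral_map (measurable_maxRec k hX).aemeasurable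
    (aestronglyMeasurable_exp _ s), runMax_eq_maxRec]

/-- Abel summation of a convergent bounded sequence. -/
theorem tendsto_abel_mean {a : ℕ → ℂ} {l : ℂ} (ha : Tendsto a atTop (𝓝 l))
    (hb : ∀ n, ‖a n‖ ≤ 1) :
    Tendsto (fun r : ℝ => (1 - (r : ℂ)) * ∑' k : ℕ, (r : ℂ) ^ k * a k) (𝓝[<] 1) (𝓝 l) := by
  -- The increments of `a`: their partial sums converge to `l`, Abel's limit theorem applies to
  -- their power series, and summation by parts produces the factor `1 - r`.
  set f : ℕ → ℂ := fun n => Nat.casesOn n (a 0) fun k => a (k + 1) - a k with hf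
  have hps : ∀ n, ∑ i ∈ Finset.range (n + 1), f i = a n := by
    intro n
    induction n with
    | zero => simp [hf]
    | succ n ih =>
      rw [Finset.sum_range_succ, ih]
      simp [hf]
  have h1 : Tendsto (fun n => ∑ i ∈ Finset.range n, f i) atTop (𝓝 l) := by
    rw [← tendsto_add_atTop_iff_nat 1]
    exact ha.congr fun n => (hps n).symm
  have h2 := Complex.tendsto_tsum_powerSeries_nhdsWithin_lt h1
  rw [tendsto_map'_iff] at h2
  refine h2.congr' ?_
  filter_upwards [Ioo_mem_nhdsLT (zero_lt_one (α := ℝ))] with r hr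
  have hr1 : ‖(r : ℂ)‖ < 1 := by
    rw [Complex.norm_real, Real.norm_of_nonneg hr.1.le]
    exact hr.2
  have hs : Summable fun k : ℕ => (r : ℂ) ^ k * a k := by
    refine Summable.of_norm_bounded (summable_geometric_of_lt_one (norm_nonneg _) hr1) fun k => ?_
    rw [norm_mul, norm_pow]
    exact mul_le_of_le_one_right (by positivity) (hb k)
  have hs' : Summable fun k : ℕ => (r : ℂ) ^ (k + 1) * a (k + 1) :=
    (summable_nat_add_iff 1).2 hs
  have hs2 : Summable fun k : ℕ => f (k + 1) * (r : ℂ) ^ (k + 1) := by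
    refine (hs'.sub (hs.mul_left (r : ℂ))).congr fun k => ?_
    simp only [hf]
    ring
  have hsf : Summable fun k : ℕ => f k * (r : ℂ) ^ k := (summable_nat_add_iff 1).1 hs2
  simp only [Function.comp]
  rw [hsf.tsum_eq_zero_add, sub_mul, one_mul, hs.tsum_eq_zero_add]
  have h3 : ∑' k : ℕ, f (k + 1) * (r : ℂ) ^ (k + 1) =
      ∑' k : ℕ, (r : ℂ) ^ (k + 1) * a (k + 1) - r * ∑' k : ℕ, (r : ℂ) ^ k * a k := by
    rw [← tsum_mul_left, ← hs'.tsum_sub (hs.mul_left (r : ℂ))]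
    refine tsum_congr fun k => ?_
    simp only [hf]
    ring
  rw [h3, hs.tsum_eq_zero_add]
  simp [hf]
  ring

end Link

/-! ### Negative drift and the limiting maximum. -/

section Drift

variable {Ω : Type*} [MeasurableSpace Ω] {P : Measure Ω} [IsProbabilityMeasure P]
  {B A : ℕ → Ω → ℝ}

/-- With negative drift the walk is eventually nonpositive. -/
theorem ae_eventually_walk_nonpos (hAm : ∀ n, Measurable (A n))
    (hindep : iIndepFun (fun n ω => (B n ω, A n ω)) P)
    (hident : ∀ n, IdentDistrib (fun ω => (B n ω, A n ω)) (fun ω => (B 0 ω, A 0 ω)) P P)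
    (hnn : ∀ᵐ ω ∂P, 0 ≤ B 0 ω ∧ 0 ≤ A 0 ω) (hBint : Integrable (B 0) P)
    (hlt : ∫⁻ ω, ENNReal.ofReal (B 0 ω) ∂P < ∫⁻ ω, ENNReal.ofReal (A 0 ω) ∂P) :
    ∀ᵐ ω ∂P, ∃ N, ∀ n, N ≤ n → walk B A n ω ≤ 0 := by
  -- `A` may have infinite mean. Monotone convergence gives a truncation level with the mean of the
  -- truncated `A` still above that of `B`. The walk with truncated `A` dominates the original one,
  -- and the strong law makes it eventually negative.
  obtain ⟨c, hc⟩ : ∃ c : ℕ, ∫⁻ ω, ENNReal.ofReal (B 0 ω) ∂P <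
      ∫⁻ ω, ENNReal.ofReal (min (A 0 ω) c) ∂P := by
    have h1 : Tendsto (fun c : ℕ => ∫⁻ ω, ENNReal.ofReal (min (A 0 ω) c) ∂P) atTop
        (𝓝 (∫⁻ ω, ENNReal.ofReal (A 0 ω) ∂P)) := by
      refine lintegral_tendsto_of_tendsto_of_monotone (fun c => ?_) ?_ ?_
      · exact (((hAm 0).min measurable_const).ennreal_ofReal).aemeasurable
      · refine Eventually.of_forall fun ω c d hcd => ENNReal.ofReal_le_ofReal ?_
        exact min_le_min le_rfl (by exact_mod_cast hcd)
      · refine Eventually.of_forall fun ω => tendsto_const_nhds.congr' ?_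
        obtain ⟨c₀, hc₀⟩ := exists_nat_ge (A 0 ω)
        filter_upwards [eventually_ge_atTop c₀] with c hc
        rw [min_eq_left (hc₀.trans (by exact_mod_cast hc))]
    exact ((h1.eventually_const_lt hlt)).exists
  set φ : ℝ × ℝ → ℝ := fun p => p.1 - min p.2 c with hφ
  have hφm : Measurable φ := by fun_prop
  have hYint : Integrable (fun ω => φ (B 0 ω, A 0 ω)) P := by
    refine hBint.sub (Integrable.of_bound (C := c)
      ((hAm 0).min measurable_const).aestronglyMeasurable ?_)
    filter_upwards [hnn] with ω hω
    rw [Real.norm_of_nonneg (le_min hω.2 (Nat.cast_nonneg c))]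
    exact min_le_right _ _
  have hneg : ∫ ω, φ (B 0 ω, A 0 ω) ∂P < 0 := by
    have hAint : Integrable (fun ω => min (A 0 ω) (c : ℝ)) P := by
      refine Integrable.of_bound (C := c)
        ((hAm 0).min measurable_const).aestronglyMeasurable ?_
      filter_upwards [hnn] with ω hω
      rw [Real.norm_of_nonneg (le_min hω.2 (Nat.cast_nonneg c))]
      exact min_le_right _ _
    have hAnn : 0 ≤ᵐ[P] fun ω => min (A 0 ω) (c : ℝ) := by
      filter_upwards [hnn] with ω hω using le_min hω.2 (Nat.cast_nonneg c)
    rw [← ofReal_integral_eq_lintegral_ofReal hBint (hnn.mono fun ω h => h.1),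
      ← ofReal_integral_eq_lintegral_ofReal hAint hAnn] at hc
    have h2 := (ENNReal.ofReal_lt_ofReal_iff_of_nonneg
      (integral_nonneg_of_ae (hnn.mono fun ω h => h.1))).1 hc
    simp only [hφ]
    rw [integral_sub hBint hAint]
    linarith
  have hpair : Pairwise fun i j => IndepFun (fun ω => φ (B i ω, A i ω))
      (fun ω => φ (B j ω, A j ω)) P := fun i j hij =>
    (hindep.indepFun hij).comp hφm hφm
  have hslln := strong_law_ae_real (μ := P) (fun i ω => φ (B i ω, A i ω)) hYint hpair
    fun i => (hident i).comp hφm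
  filter_upwards [hslln] with ω hω
  obtain ⟨N, hN⟩ := eventually_atTop.1 (hω.eventually_lt_const hneg)
  refine ⟨max N 1, fun n hn => ?_⟩
  have h1 := hN n ((le_max_left _ _).trans hn)
  have hn0 : (0 : ℝ) < n := by exact_mod_cast (le_max_right N 1).trans hn
  rw [div_lt_iff₀ hn0, zero_mul] at h1
  refine le_trans ?_ h1.le
  refine Finset.sum_le_sum fun i _ => ?_
  simp only [hφ]
  linarith [min_le_left (A i ω) (c : ℝ)]

end Drift

section Limit

variable {Ω : Type*} [MeasurableSpace Ω] {P : Measure Ω} [IsProbabilityMeasure P]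
  {B A : ℕ → Ω → ℝ}

theorem measurable_runMax (hX : ∀ i, Measurable fun ω => B i ω - A i ω) (k : ℕ) :
    Measurable (runMax B A k) := by
  rw [runMax_eq_maxRec]
  exact measurable_maxRec k hX

/-- If the walk is eventually nonpositive, the running maximum converges, and so do the Abel means
of its transforms. -/
theorem exists_limit_runMax (hX : ∀ i, Measurable fun ω => B i ω - A i ω)
    (h : ∀ᵐ ω ∂P, ∃ N, ∀ n, N ≤ n → walk B A n ω ≤ 0) :
    ∃ M : Ω → ℝ, TendstoInDistribution (fun k : ℕ => runMax B A k) atTop M (fun _ => P) P ∧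
      (∀ s : ℂ, 0 < s.re → Tendsto (fun r : ℝ => (1 - (r : ℂ)) * ∑' k : ℕ, (r : ℂ) ^ k *
        ∫ ω, Complex.exp (-s * (runMax B A k ω : ℂ)) ∂P) (𝓝[<] 1)
          (𝓝 (∫ ω, Complex.exp (-s * (M ω : ℂ)) ∂P))) ∧
      ∀ x : ℝ, 0 < x → ∫ ω, Complex.exp (-(x : ℂ) * (M ω : ℂ)) ∂P ≠ 0 := by
  have hm := measurable_runMax hX
  -- Once the walk stays nonpositive the running maximum is constant, so it converges almost surely,
  -- and the other limits follow by dominated convergence.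
  obtain ⟨M, hM, hlim⟩ := measurable_limit_of_tendsto_metrizable_ae (μ := P) (L := atTop)
    (f := fun k => runMax B A k) (fun k => (hm k).aemeasurable) (by
      filter_upwards [h] with ω hω
      obtain ⟨N, hN⟩ := hω
      refine ⟨runMax B A N ω, tendsto_const_nhds.congr' ?_⟩
      filter_upwards [eventually_ge_atTop N] with k hk using (runMax_eq_of_nonpos hN hk).symm)
  have hMnn : ∀ᵐ ω ∂P, 0 ≤ M ω := by
    filter_upwards [hlim] with ω hω using ge_of_tendsto' hω fun k => runMax_nonneg k ω
  refine ⟨M, tendstoInDistribution_of_ae_tendsto (fun k => (hm k).aemeasurable) hM.aemeasurable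
    hlim, fun s hs => tendsto_abel_mean ?_ fun k => ?_, fun x hx => ?_⟩
  · refine tendsto_integral_of_dominated_convergence (fun _ => 1) (fun k => ?_)
      (integrable_const _) (fun k => Eventually.of_forall fun ω =>
        norm_exp_le_one_of_nonneg hs.le (runMax_nonneg k ω)) ?_
    · exact (Complex.measurable_exp.comp (measurable_const.mul
        (Complex.measurable_ofReal.comp (hm k)))).aestronglyMeasurable
    · filter_upwards [hlim] with ω hω
      exact ((Complex.continuous_exp.comp (continuous_const.mul
        Complex.continuous_ofReal)).tendsto (M ω)).comp hω
  · refine (norm_integral_le_integral_norm _).trans ?_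
    refine (integral_mono_of_nonneg (Eventually.of_forall fun _ => norm_nonneg _)
      (integrable_const (1 : ℝ)) (Eventually.of_forall fun ω =>
        norm_exp_le_one_of_nonneg hs.le (runMax_nonneg k ω))).trans ?_
    simp
  · have h1 : ∀ ω, Complex.exp (-(x : ℂ) * (M ω : ℂ)) = ((Real.exp (-x * M ω) : ℝ) : ℂ) := by
      intro ω
      push_cast
      rfl
    simp only [h1]
    rw [integral_complex_ofReal, Ne, Complex.ofReal_eq_zero]
    refine (integral_exp_pos ?_).ne'
    refine Integrable.of_bound (C := 1) (by fun_prop) ?_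
    filter_upwards [hMnn] with ω hω
    rw [Real.norm_of_nonneg (Real.exp_pos _).le, Real.exp_le_one_iff]
    nlinarith

end Limit

/-! ### Root families and the law of one step. -/

section Roots

open Polynomial in
theorem exists_root_family_leftHalf {W : ℂ[X]} (hW : W.Monic) {n : ℕ} (hn : W.natDegree = n)
    (hW0 : ∀ s : ℂ, 0 ≤ s.re → W.eval s ≠ 0) :
    ∃ r : Fin n → ℂ, (∀ j, (r j).re < 0) ∧ ∀ u, W.eval u = ∏ j, (u - r j) := by
  subst hn
  obtain ⟨r, hr, hWr⟩ := exists_root_family W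
  refine ⟨r, fun j => ?_, fun u => ?_⟩
  · by_contra h
    exact hW0 _ (not_lt.1 h) (Polynomial.isRoot_of_mem_roots (hr j))
  · rw [hWr, hW.leadingCoeff, one_mul]

/-- Both families have the same number of members, so the signs cancel. -/
theorem prod_zero_sub_div {n : ℕ} (a b : Fin n → ℂ) :
    (∏ j, (0 - a j)) / ∏ j, (0 - b j) = (∏ j, a j) / ∏ j, b j := by
  simp only [← Finset.prod_div_distrib, zero_sub, neg_div_neg_eq]

theorem prod_sub_ne_zero {n : ℕ} {a : Fin n → ℂ} (ha : ∀ j, (a j).re < 0) {s : ℂ}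
    (hs : 0 ≤ s.re) : ∏ j, (s - a j) ≠ 0 := by
  refine Finset.prod_ne_zero_iff.2 fun j _ h => ?_
  rw [sub_eq_zero] at h
  exact absurd (h ▸ hs) (not_le.2 (ha j))

/-- Solves the multiplied-out transform identity for the transform. -/
theorem eq_prod_div_of_mul_eq {n : ℕ} {a b : Fin n → ℂ} (ha : ∀ j, (a j).re < 0)
    (hb : ∀ j, (b j).re < 0) {s F : ℂ} (hs : 0 ≤ s.re)
    (h : F * ((∏ j, (s - b j)) * ∏ j, (0 - a j)) = (∏ j, (s - a j)) * ∏ j, (0 - b j)) :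
    F = ((∏ j, (s - a j)) / ∏ j, (s - b j)) * ((∏ j, b j) / ∏ j, a j) := by
  have h1 := prod_sub_ne_zero hb hs
  have h2 := prod_sub_ne_zero ha (s := 0) le_rfl
  rw [← prod_zero_sub_div b a, div_mul_div_comm, eq_div_iff (mul_ne_zero h1 h2), h]

end Roots

section StepLaw

variable {Ω : Type*} [MeasurableSpace Ω] {P : Measure Ω}
  {B A : Ω → ℝ}

theorem laplace_map_sub (hB : Measurable B) (hA : Measurable A) (s : ℂ) :
    laplace (P.map fun ω => B ω - A ω) s = jointLST P B A s (-s) := by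
  have hm : Measurable fun ω => B ω - A ω := hB.sub hA
  rw [laplace, integral_map hm.aemeasurable (aestronglyMeasurable_exp _ s), jointLST]
  refine integral_congr_ae (Eventually.of_forall fun ω => ?_)
  simp only
  congr 1
  push_cast
  ring

theorem weightMass_map_sub_lt_top {δ : ℝ} (hδ : 0 < δ) (hB : Measurable B) (hA : Measurable A)
    (hnn : ∀ᵐ ω ∂P, 0 ≤ B ω ∧ 0 ≤ A ω) (hint : Integrable (fun ω => Real.exp (δ * B ω)) P) :
    weightMass δ (P.map fun ω => B ω - A ω) < ⊤ := by
  have hm : Measurable fun ω => B ω - A ω := hB.sub hA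
  rw [weightMass, lintegral_map (by unfold weight; fun_prop) hm]
  refine lt_of_le_of_lt (lintegral_mono_ae (g := fun ω => ENNReal.ofReal (Real.exp (δ * B ω))) ?_)
    hint.lintegral_lt_top
  filter_upwards [hnn] with ω hω
  refine ENNReal.ofReal_le_ofReal (max_le (Real.one_le_exp (mul_nonneg hδ.le hω.1)) ?_)
  exact Real.exp_le_exp.2 (mul_le_mul_of_nonneg_left (by linarith [hω.2]) hδ.le)

end StepLaw

end CorrelatedWalk

end

/-! ### Assembly of the theorem. -/

open CorrelatedWalk in
theorem mainTheorem7
    {Ω : Type*} [MeasurableSpace Ω] (P : Measure Ω) [IsProbabilityMeasure P]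
    (B A : ℕ → Ω → ℝ)
    (hBmeas : ∀ n, Measurable (B n)) (hAmeas : ∀ n, Measurable (A n))
    -- the pairs `(B_n, A_n)` are independent and identically distributed
    (hindep : iIndepFun (fun n ω => (B n ω, A n ω)) P)
    (hident : ∀ n, IdentDistrib (fun ω => (B n ω, A n ω)) (fun ω => (B 0 ω, A 0 ω)) P P)
    -- they take values in the closed positive quadrant, and `P(A = B) = 0`
    (hnonneg : ∀ᵐ ω ∂P, 0 ≤ B 0 ω ∧ 0 ≤ A 0 ω)
    (hne : ∀ᵐ ω ∂P, B 0 ω ≠ A 0 ω)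
    -- for each `s₂` the transform is a quotient of polynomials in `s₁`
    (h₁ h₂ : ℂ → Polynomial ℂ)
    (hrat : ∀ s₂ : ℂ, 0 ≤ s₂.re → h₂ s₂ ≠ 0 ∧ ∀ s₁ : ℂ, 0 ≤ s₁.re →
      CorrelatedWalk.jointLST P (B 0) (A 0) s₁ s₂ * (h₂ s₂).eval s₁ = (h₁ s₂).eval s₁)
    -- `ξ ↦ h_i(ξ, -ξ)` is holomorphic in the left half-plane, finitely many zeros of the denominator
    (hhol₁ : DifferentiableOn ℂ (fun ξ => (h₁ (-ξ)).eval ξ) {ξ : ℂ | ξ.re < 0})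
    (hhol₂ : DifferentiableOn ℂ (fun ξ => (h₂ (-ξ)).eval ξ) {ξ : ℂ | ξ.re < 0})
    (hfin : {ξ : ℂ | ξ.re < 0 ∧ (h₂ (-ξ)).eval ξ = 0}.Finite) :
    ∃ (n : ℕ) (ξ₀ : Fin n → ℂ) (ξ : ℂ → Fin n → ℂ),
      CorrelatedWalk.IsLeftZeroList (fun w => (h₂ (-w)).eval w) ξ₀ ∧
      (∀ z : ℂ, ‖z‖ < 1 →
        CorrelatedWalk.IsLeftZeroList
          (fun w => (h₂ (-w)).eval w - z * (h₁ (-w)).eval w) (ξ z) ∧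
        (∀ s : ℂ, 0 < s.re →
          Summable (fun k : ℕ =>
            z ^ k * ∫ ω, Complex.exp (-s * (CorrelatedWalk.runMax B A k ω : ℂ)) ∂P) ∧
          (1 - z) * ∑' k : ℕ,
              z ^ k * ∫ ω, Complex.exp (-s * (CorrelatedWalk.runMax B A k ω : ℂ)) ∂P =
            ((∏ j, (s - ξ₀ j)) / ∏ j, (s - ξ z j)) * ((∏ j, ξ z j) / ∏ j, ξ₀ j)) ∧
        ∫ ω, CorrelatedWalk.zpowExt z (CorrelatedWalk.firstNeg B A ω) ∂P =
          1 - (1 - z) * ((∏ j, ξ₀ j) / ∏ j, ξ z j)) ∧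
      -- the stable case `E B < E A` (here `E A = ∞` is allowed)
      (∫⁻ ω, ENNReal.ofReal (B 0 ω) ∂P < ∫⁻ ω, ENNReal.ofReal (A 0 ω) ∂P →
        CorrelatedWalk.IsLeftZeroList
          (fun w => (h₂ (-w)).eval w - (h₁ (-w)).eval w) (ξ 1) ∧
        ∃ M : Ω → ℝ,
          TendstoInDistribution (fun k : ℕ => CorrelatedWalk.runMax B A k) atTop M
            (fun _ => P) P ∧
          ∀ s : ℂ, 0 < s.re →
            Tendsto (fun r : ℝ => (1 - (r : ℂ)) * ∑' k : ℕ, (r : ℂ) ^ k *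
                ∫ ω, Complex.exp (-s * (CorrelatedWalk.runMax B A k ω : ℂ)) ∂P)
              (𝓝[<] 1) (𝓝 (∫ ω, Complex.exp (-s * (M ω : ℂ)) ∂P)) ∧
            ∫ ω, Complex.exp (-s * (M ω : ℂ)) ∂P =
              ((∏ j, (s - ξ₀ j)) / ∏ j, (s - ξ 1 j)) * ((∏ j, ξ 1 j) / ∏ j, ξ₀ j)) := by
  have hB := hBmeas 0
  have hA := hAmeas 0
  have hX : ∀ i, Measurable fun ω => B i ω - A i ω := fun i => (hBmeas i).sub (hAmeas i)
  have hsub : Measurable fun p : ℝ × ℝ => p.1 - p.2 := by fun_prop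
  have hind : iIndepFun (fun i ω => B i ω - A i ω) P :=
    hindep.comp (fun _ p => p.1 - p.2) fun _ => hsub
  obtain ⟨μ, hμdef⟩ : ∃ μ, μ = P.map fun ω => B 0 ω - A 0 ω := ⟨_, rfl⟩
  have hlaw : ∀ i, P.map (fun ω => B i ω - A i ω) = μ := fun i =>
    ((hident i).comp hsub).map_eq.trans hμdef.symm
  have : IsProbabilityMeasure μ := hμdef ▸ Measure.isProbabilityMeasure_map (hX 0).aemeasurable
  -- This is where `P(A = B) = 0` enters. It makes the ladder polynomial monic.
  have hμ0 : ∀ᵐ x ∂μ, x ≠ 0 := by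
    rw [hμdef, ae_map_iff (p := fun x => x ≠ 0) (hX 0).aemeasurable
      (measurableSet_singleton 0).compl]
    exact hne.mono fun ω h => sub_ne_zero.2 h
  obtain ⟨δ, hδ, hint⟩ := exists_integrable_exp hB hA hnonneg (hrat 0 le_rfl).1 (hrat 0 le_rfl).2
  have hμ : weightMass δ μ < ⊤ := hμdef ▸ weightMass_map_sub_lt_top hδ hB hA hnonneg hint
  obtain ⟨n, ξ₀, g, hξ₀, hg, hg0, hfac⟩ := exists_fin_factor hhol₂ hfin
  obtain ⟨C, m, hGb⟩ := exists_growth_bound hδ hB hA hnonneg hint hrat hhol₁ hg hg0 hfac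
  set q : Polynomial ℂ := ∏ j, (Polynomial.X - Polynomial.C (ξ₀ j)) with hqdef
  have hq : q.Monic := Polynomial.monic_prod_X_sub_C _ _
  have hqn : q.natDegree = n := by simp [hqdef]
  have hqe : ∀ w, q.eval w = ∏ j, (w - ξ₀ j) := fun w => by simp [hqdef, Polynomial.eval_prod]
  have hq0 : ∀ s : ℂ, 0 ≤ s.re → q.eval s ≠ 0 := fun s hs => by
    rw [hqe]
    exact prod_sub_ne_zero hξ₀ hs
  set G : ℂ → ℂ := fun w => (h₁ (-w)).eval w / g w with hGdef
  have hG : DifferentiableOn ℂ G leftHalf := hhol₁.div hg hg0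
  have hqG : ∀ s : ℂ, -δ < s.re → s.re < 0 → q.eval s * laplace μ s = G s := by
    intro s hs hs0
    have hs' : 0 ≤ (-s).re := by simpa using hs0.le
    have h := jointLST_mul_eval hδ hB hA hnonneg hint hs' (hrat (-s) hs').2 hs
    rw [hfac s hs0, ← hqe] at h
    rw [hμdef, laplace_map_sub hB hA, hGdef, eq_div_iff (hg0 s hs0), ← h]
    ring
  have hf : ∀ z : ℂ, ∀ w ∈ leftHalf, (h₂ (-w)).eval w - z * (h₁ (-w)).eval w =
      (q.eval w - z * G w) * g w := by
    intro z w hw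
    rw [hfac w hw, hqe, sub_mul, mul_assoc z, hGdef, div_mul_cancel₀ _ (hg0 w hw)]
  have hzeros : ∀ {z : ℂ} {r : Fin n → ℂ} {e : ℂ → ℂ}, (∀ j, (r j).re < 0) →
      DifferentiableOn ℂ e leftHalf → (∀ w ∈ leftHalf, e w ≠ 0) →
      (∀ w ∈ leftHalf, q.eval w - z * G w = (∏ j, (w - r j)) * e w) →
      IsLeftZeroList (fun w => (h₂ (-w)).eval w - z * (h₁ (-w)).eval w) r := by
    intro z r e hr he he0 h
    refine isLeftZeroList_of_factor hr (he.mul hg) (fun w hw => mul_ne_zero (he0 w hw) (hg0 w hw))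
      fun w hw => ?_
    rw [hf z w hw, h w hw, mul_assoc, Pi.mul_apply]
  have hmax := integral_exp_runMax hX hind hlaw
  have hnorm : ∀ {s : ℂ}, 0 < s.re → ∀ k, ‖laplace (reflected μ k) s‖ ≤ 1 := by
    intro s hs k
    refine (norm_integral_le_of_norm_le (integrable_const (1 : ℝ)) ?_).trans (by simp)
    filter_upwards [ae_reflected_nonneg μ k] with x hx using norm_exp_le_one_of_nonneg hs.le hx
  have key : ∀ z : ℂ, ∃ r : Fin n → ℂ,
      (‖z‖ < 1 → IsLeftZeroList (fun w => (h₂ (-w)).eval w - z * (h₁ (-w)).eval w) r ∧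
        (∀ s : ℂ, 0 < s.re → (1 - z) * genFun z (reflected μ) s =
          ((∏ j, (s - ξ₀ j)) / ∏ j, (s - r j)) * ((∏ j, r j) / ∏ j, ξ₀ j)) ∧
        exitFactor μ (Set.Ici 0) z 0 = (1 - z) * ((∏ j, ξ₀ j) / ∏ j, r j)) ∧
      (z = 1 → ∀ L : ℂ → ℂ, (∀ s : ℂ, 0 < s.re →
          Tendsto (fun r : ℝ => (1 - (r : ℂ)) * genFun (r : ℂ) (reflected μ) s)
            (𝓝[<] 1) (𝓝 (L s))) → (∀ x : ℝ, 0 < x → L x ≠ 0) →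
        IsLeftZeroList (fun w => (h₂ (-w)).eval w - z * (h₁ (-w)).eval w) r ∧
        ∀ s : ℂ, 0 < s.re →
          L s = ((∏ j, (s - ξ₀ j)) / ∏ j, (s - r j)) * ((∏ j, r j) / ∏ j, ξ₀ j)) := by
    intro z
    rcases eq_or_ne z 1 with rfl | hz1
    · by_cases hL : ∃ L : ℂ → ℂ, (∀ s : ℂ, 0 < s.re →
          Tendsto (fun r : ℝ => (1 - (r : ℂ)) * genFun (r : ℂ) (reflected μ) s)
            (𝓝[<] 1) (𝓝 (L s))) ∧ ∀ x : ℝ, 0 < x → L x ≠ 0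
      · obtain ⟨L₀, hL, hL0⟩ := hL
        obtain ⟨W, hW, hWn, hW0, hWm, hWL⟩ :=
          exists_transform_polynomial_one hμ0 hδ hμ hq hq0 hG hGb hqG hL hL0
        obtain ⟨r, hr, hWr⟩ := exists_root_family_leftHalf hW (hWn.trans hqn) hW0
        refine ⟨r, fun h => absurd h (by simp), fun _ L hL' _ => ⟨hzeros hr
          (differentiableOn_exitFactor_Ici_one (μ := μ)) (fun w hw => exitFactor_Ici_one_ne_zero (μ := μ) hw)
          fun w hw => ?_, fun s hs => eq_prod_div_of_mul_eq hξ₀ hr hs.le ?_⟩⟩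
        · rw [one_mul, hWm w hw, hWr]
        · rw [tendsto_nhds_unique (hL' s hs) (hL s hs), ← hqe, ← hqe, ← hWr, ← hWr]
          exact hWL s hs
      · exact ⟨ξ₀, fun h => absurd h (by simp), fun _ L hL1 hL2 => absurd ⟨L, hL1, hL2⟩ hL⟩
    · by_cases hz : ‖z‖ < 1
      · obtain ⟨W, hW, hWn, hWp, hWm, hWL, hWe, hdiff⟩ :=
          exists_transform_polynomial hμ0 hδ hμ hq hq0 hG hGb hqG hz
        have hW0 : ∀ s : ℂ, 0 ≤ s.re → W.eval s ≠ 0 := fun s hs => by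
          rw [hWp s hs]
          exact mul_ne_zero (hq0 s hs) (exitFactor_Iio_ne_zero hz hs)
        obtain ⟨r, hr, hWr⟩ := exists_root_family_leftHalf hW (hWn.trans hqn) hW0
        refine ⟨r, fun _ => ⟨hzeros hr hdiff (fun w hw => exitFactor_Ici_ne_zero hz (le_of_lt hw))
          fun w hw => by rw [hWm w hw, hWr], fun s hs => eq_prod_div_of_mul_eq hξ₀ hr hs.le ?_, ?_⟩,
          fun h => absurd h hz1⟩
        · rw [← hqe, ← hqe, ← hWr, ← hWr]
          exact hWL s hs.le
        -- The factorisation at `s = 0` reads `(1 - z) q(0) = W(0) f₋(0)`, and `1 - f₋(0)` is the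
        -- generating function of `N`.
        · rw [← prod_zero_sub_div, ← hqe, ← hWr, mul_div_assoc', eq_div_iff (hW0 0 le_rfl), hWe,
            mul_comm]
      · exact ⟨ξ₀, fun h => absurd h hz, fun h => absurd h hz1⟩
  choose ξ hξ hξ1 using key
  refine ⟨n, ξ₀, ξ, isLeftZeroList_of_factor hξ₀ hg hg0 hfac, fun z hz => ?_, fun hlt => ?_⟩
  · obtain ⟨h1, h2, h3⟩ := hξ z hz
    refine ⟨h1, fun s hs => ⟨?_, ?_⟩, ?_⟩
    · refine Summable.of_norm_bounded (summable_geometric_of_lt_one (norm_nonneg _) hz) fun k => ?_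
      rw [hmax, norm_mul, norm_pow]
      exact mul_le_of_le_one_right (by positivity) (hnorm hs k)
    · simp only [hmax]
      exact h2 s hs
    · rw [integral_zpowExt hX hind hlaw hz, h3]
  · have hBint : Integrable (B 0) P := by
      refine ⟨hB.aestronglyMeasurable, ?_⟩
      rw [hasFiniteIntegral_iff_ofReal (hnonneg.mono fun ω h => h.1)]
      exact hlt.trans_le le_top
    obtain ⟨M, hM, hMlim, hM0⟩ := exists_limit_runMax hX
      (ae_eventually_walk_nonpos hAmeas hindep hident hnonneg hBint hlt)
    -- The drift condition supplies the limits required at `z = 1`: the transform of `M` is the Abel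
    -- limit and is nonzero on the positive axis.
    obtain ⟨h1, h2⟩ := hξ1 1 rfl (fun s => ∫ ω, Complex.exp (-s * (M ω : ℂ)) ∂P)
      (fun s hs => by simpa only [hmax, genFun] using hMlim s hs) hM0
    simp only [one_mul] at h1
    exact ⟨h1, M, hM, fun s hs => ⟨hMlim s hs, h2 s hs⟩⟩
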